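/- Let $\theta\in\mathbb R$ and let $L=\ell^2(\mathbb Z^2)$ be the GNS space of the noncommutative $2$-torus for its canonical trace, with orthonormal basis $U^mV^n$, where $UV=e^{2\pi i\theta}VU$. Let $d_1,d_2$ be the operators $d_1(U^mV^n)=m\,U^mV^n$, $d_2(U^mV^n)=n\,U^mV^n$ on $L$ (with maximal domains), and let $\mathcal A(\mathbb T^2_\theta)$ be the $*$-algebra generated by $U,V$, with norm closure $C(\mathbb T^2_\theta)$. Let $\mathcal A$ be any unital $*$-algebra with $\mathcal A(\mathbb T^2_\theta)\subseteq\mathcal A\subseteq C(\mathbb T^2_\theta)$ such that for all $a\in\mathcal A$ and $j=1,2$, $a$ preserves the domain of $d_j$ and $[d_j,a]$ extends to an element of $\mathcal A$ (for instance $\mathcal A=\mathcal A(\mathbb T^2_\theta)$ or $\mathcal A=C^\infty(\mathbb T^2_\theta)$). Put $\partial_j(a)=\sqrt{-1}\,[d_j,a]$, let $\mathcal A$ act diagonally on $L\oplus L$, and let $D=\begin{pmatrix}0&d_1+id_2\\ d_1-id_2&0\end{pmatrix}$, $d(a)=\sqrt{-1}\,[D,a]$. Let $\mathcal E\subseteq\mathcal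 B(L\oplus L)$ be the $\mathcal A$-bimodule of one-forms (the span of all $a\,d(b)$), $\Omega^2$ the space of products of one-forms modulo junk forms, $m:\mathcal E\otimes_{\mathcal A}\mathcal E\to\Omega^2$ the multiplication, and $d:\mathcal E\to\Omega^2$, $d(\sum a_i\,d(b_i))=\sum d(a_i)d(b_i)$ modulo junk forms. Let $e_1=1\otimes\gamma_1$, $e_2=1\otimes\gamma_2\in\mathcal E$ with $\gamma_1=\begin{pmatrix}0&1\\1&0\end{pmatrix}$, $\gamma_2=\begin{pmatrix}0&i\\-i&0\end{pmatrix}$. There are a unique bimodule map $\sigma$ of $\mathcal E\otimes_{\mathcal A}\mathcal E$ with $\sigma^2=1$, $\ker m=\ker(1-\sigma)$ and $\sigma(\omega\otimes\eta)=\eta\otimes\omega$ for central $\omega,\eta$, and a unique bimodule map $g_0:\mathcal E\otimes_{\mathcal A}\mathcal E\to\mathcal A$ with $g_0(e_j\otimes e_l)=\delta_{jl}1$. A pseudo-Riemannian metric is a right $\mathcal A$-linear map $g:\mathcal E\otimes_{\mathcal A}\mathcal E\to\mathcal A$ with $g\sigma=g$ for which $V_g:\mathcal E\to\mathcal E^*=\mathrm{Hom}_{\mathcal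 A}(\mathcal E,\mathcal A)$ (right $\mathcal A$-linear maps), $V_g(\omega)(\eta)=g(\omega\otimes\eta)$, is bijective. A connection is a $\mathbb C$-linear map $\nabla:\mathcal E\to\mathcal E\otimes_{\mathcal A}\mathcal E$ with $\nabla(\omega a)=\nabla(\omega)a+\omega\otimes da$. It is torsion-free if $m\circ\nabla+d=0$. It is compatible with $g$ if $\Pi_g(\nabla)(\omega\otimes\eta)=d(g(\omega\otimes\eta))$ for all $\omega,\eta$, where $\Pi_g(\nabla)$ is the map for which $d\circ g-\Pi_g(\nabla)$ is right $\mathcal A$-linear and $\Pi_g(\nabla)(\omega\otimes\eta)=(g\otimes\mathrm{id})\sigma_{23}(\nabla(\omega)\otimes\eta+\nabla(\eta)\otimes\omega)$ for central $\omega,\eta$, with $\sigma_{23}=\mathrm{id}\otimes\sigma$. It is a Levi-Civita connection for $g$ if both hold. Identify two-forms with antisymmetric tensors by $q:\Omega^2\to\mathcal E\otimes_{\mathcal A}\mathcal E$, $q(m(z))=z-\sigma(z)$. The curvature operator is $R(\nabla)=H\circ\nabla$ with $$H(\omega\otimes\eta)=(\mathrm{id}\otimes(1-\sigma))(\nabla\omega\otimes\eta)+\omega\otimes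 q(d\eta).$$ Let $\zeta:\mathcal E^{\otimes 3}\otimes_{\mathcal A}\mathcal E^*\to\mathrm{Hom}_{\mathcal A}(\mathcal E,\mathcal E^{\otimes3})$, $\zeta(x\otimes\phi)(e)=x\,\phi(e)$. The Ricci curvature is $$\mathrm{Ric}=(\mathrm{id}\otimes\mathrm{id}\otimes\tau)(\sigma_{23}\otimes\mathrm{id})\,\zeta^{-1}\big((\mathrm{id}\otimes\tfrac{1-\sigma}{2})R(\nabla)\big)\in\mathcal E\otimes_{\mathcal A}\mathcal E,$$ where $\tau:\mathcal E\otimes_{\mathcal A}\mathcal E^*\to\mathcal A$ is the left $\mathcal A$-linear map with $\tau(e\otimes\phi)=\phi(e)$ for central $e$; its coefficients $\mathrm{Ric}(e_j,e_l)\in\mathcal A$ are defined by $\mathrm{Ric}=\sum_{j,l}e_j\otimes e_l\,\mathrm{Ric}(e_j,e_l)$. The scalar curvature $\mathrm{Scal}\in\mathcal A$ is the image of $\mathrm{Ric}$ under $x\otimes y\mapsto V_g(x)(y)$. **Theorem.** Let $k\in\mathcal A$ be invertible and $g=k\,g_0$. Then $g_0$ and $g$ are pseudo-Riemannian metrics,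 $g$ has a unique Levi-Civita connection $\nabla$, its Ricci curvature is well defined, the coefficients $\mathrm{Ric}(e_j,e_l)$ exist and are unique, and $$\mathrm{Ric}(e_1,e_1)=\mathrm{Ric}(e_2,e_2)=-\tfrac12\big(k^{-1}(\partial_1^2+\partial_2^2)(k)+\partial_1(k^{-1})\partial_1(k)+\partial_2(k^{-1})\partial_2(k)\big),$$ $$\mathrm{Ric}(e_1,e_2)=-\mathrm{Ric}(e_2,e_1)=\tfrac12\big(\partial_1(k^{-1})\partial_2(k)-\partial_2(k^{-1})\partial_1(k)\big),$$ $$\mathrm{Scal}=-(\partial_1^2+\partial_2^2)(k)-k\big(\partial_2(k^{-1})\partial_2(k)+\partial_1(k^{-1})\partial_1(k)\big).$$ -/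

import Mathlib

open scoped TensorProduct RightActions

noncomputable section

namespace NCG

/-- `E` is an `A`-`A`-bimodule over a complex algebra `A`: a left module (`a • x`) and a right module
(`x <• a`), with commuting actions that both restrict to the same action of the scalars. -/
class IsBimodule (A E : Type*) [Ring A] [Algebra ℂ A] [AddCommGroup E] [Module ℂ E]
    [Module A E] [Module Aᵐᵒᵖ E] : Prop where
  scalar_left : ∀ (c : ℂ) (a : A) (x : E), (c • a) • x = c • (a • x)
  scalar_right : ∀ (c : ℂ) (a : A) (x : E), x <• (c • a) = c • (x <• a)
  assoc : ∀ (a b : A) (x : E), (a • x) <• b = a • (x <• b)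

section Basic

variable (A E F G : Type*) [Ring A] [Algebra ℂ A]
  [AddCommGroup E] [Module ℂ E] [Module A E] [Module Aᵐᵒᵖ E] [IsBimodule A E]
  [AddCommGroup F] [Module ℂ F] [Module A F] [Module Aᵐᵒᵖ F] [IsBimodule A F]
  [AddCommGroup G] [Module ℂ G] [Module A G] [Module Aᵐᵒᵖ G] [IsBimodule A G]

instance IsBimodule.towerLeft : IsScalarTower ℂ A E :=
  ⟨fun c a x => IsBimodule.scalar_left c a x⟩

instance IsBimodule.towerRight : IsScalarTower ℂ Aᵐᵒᵖ E :=
  ⟨fun c a x => IsBimodule.scalar_right c a.unop x⟩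

instance IsBimodule.self : IsBimodule A A where
  scalar_left c a x := by simp
  scalar_right c a x := by simp
  assoc a b x := by simp [mul_assoc]

end Basic

section Tensor

variable (A E F : Type*) [Ring A]
  [AddCommGroup E] [Module ℂ E] [Module Aᵐᵒᵖ E] [AddCommGroup F] [Module ℂ F] [Module A F]

/-- The relations `(x a) ⊗ y = x ⊗ (a y)`. -/
def balanced : Submodule ℂ (E ⊗[ℂ] F) :=
  Submodule.span ℂ {z | ∃ (x : E) (a : A) (y : F), z = (x <• a) ⊗ₜ[ℂ] y - x ⊗ₜ[ℂ] (a • y)}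

/-- The tensor product `E ⊗_A F` of a right and a left module over the noncommutative algebra `A`. -/
def BTensor : Type _ := (E ⊗[ℂ] F) ⧸ balanced A E F

instance : AddCommGroup (BTensor A E F) :=
  inferInstanceAs (AddCommGroup ((E ⊗[ℂ] F) ⧸ balanced A E F))

instance : Module ℂ (BTensor A E F) :=
  inferInstanceAs (Module ℂ ((E ⊗[ℂ] F) ⧸ balanced A E F))

namespace BTensor

variable {A E F} {G : Type*} [AddCommGroup G] [Module ℂ G]

/-- The class `x ⊗_A y`. -/
def tmul (A : Type*) [Ring A] [Module Aᵐᵒᵖ E] [Module A F] (x : E) (y : F) : BTensor A E F :=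
  (balanced A E F).mkQ (x ⊗ₜ[ℂ] y)

theorem balance (x : E) (a : A) (y : F) : tmul A (x <• a) y = tmul A x (a • y) :=
  (Submodule.Quotient.eq _).2 (Submodule.subset_span ⟨x, a, y, rfl⟩)

theorem add_tmul (x x' : E) (y : F) : tmul A (x + x') y = tmul A x y + tmul A x' y := by
  rw [tmul, TensorProduct.add_tmul, map_add]; rfl

theorem tmul_add (x : E) (y y' : F) : tmul A x (y + y') = tmul A x y + tmul A x y' := by
  rw [tmul, TensorProduct.tmul_add, map_add]; rfl

theorem smul_tmul (c : ℂ) (x : E) (y : F) : tmul A (c • x) y = c • tmul A x y := by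
  simp only [tmul, ← TensorProduct.smul_tmul', map_smul]; rfl

theorem tmul_smul (c : ℂ) (x : E) (y : F) : tmul A x (c • y) = c • tmul A x y := by
  simp only [tmul, TensorProduct.tmul_smul, map_smul]; rfl

/-- The map out of `E ⊗_A F` induced by a balanced bilinear map. -/
def lift (f : E →ₗ[ℂ] F →ₗ[ℂ] G) (h : ∀ x (a : A) y, f (x <• a) y = f x (a • y)) :
    BTensor A E F →ₗ[ℂ] G :=
  (balanced A E F).liftQ (TensorProduct.lift f) (by
    rw [balanced, Submodule.span_le]
    rintro _ ⟨x, a, y, rfl⟩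
    simp [h])

@[simp] theorem lift_tmul (f : E →ₗ[ℂ] F →ₗ[ℂ] G) (h : ∀ x (a : A) y, f (x <• a) y = f x (a • y))
    (x : E) (y : F) : lift f h (tmul A x y) = f x y := by
  simp only [lift, tmul, Submodule.mkQ_apply]
  exact (Submodule.liftQ_apply _ _ _).trans (by simp)

theorem induction {p : BTensor A E F → Prop} (z : BTensor A E F)
    (h0 : p 0) (ht : ∀ x y, p (tmul A x y)) (ha : ∀ z w, p z → p w → p (z + w)) : p z := by
  obtain ⟨t, rfl⟩ := Submodule.mkQ_surjective (balanced A E F) z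
  induction t using TensorProduct.induction_on with
  | zero => rw [map_zero]; exact h0
  | tmul x y => exact ht x y
  | add s t hs ht' => rw [map_add]; exact ha _ _ hs ht'

theorem hom_ext {f g : BTensor A E F →ₗ[ℂ] G}
    (h : ∀ x y, f (tmul A x y) = g (tmul A x y)) : f = g := by
  ext z
  induction z using induction with
  | h0 => simp
  | ht x y => exact h x y
  | ha z w hz hw => rw [map_add, map_add, hz, hw]

end BTensor

end Tensor

section TensorActions

variable {A E F G : Type*} [Ring A] [Algebra ℂ A]

/-- Multiplication by `a` from the left as a complex-linear map. -/
def lmulHom [AddCommGroup E] [Module ℂ E] [Module A E] [Module Aᵐᵒᵖ E] [IsBimodule A E] (a : A) :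
    E →ₗ[ℂ] E where
  toFun x := a • x
  map_add' := smul_add a
  map_smul' c x := smul_comm a c x

/-- Multiplication by `a` from the right as a complex-linear map. -/
def rmulHom [AddCommGroup E] [Module ℂ E] [Module A E] [Module Aᵐᵒᵖ E] [IsBimodule A E] (a : A) :
    E →ₗ[ℂ] E where
  toFun x := x <• a
  map_add' := smul_add _
  map_smul' c x := smul_comm (MulOpposite.op a) c x

namespace BTensor

section Left

variable [AddCommGroup E] [Module ℂ E] [Module A E] [Module Aᵐᵒᵖ E] [IsBimodule A E]
  [AddCommGroup F] [Module ℂ F] [Module A F]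

/-- `x ⊗ y ↦ (a x) ⊗ y`. -/
def lact (a : A) : BTensor A E F →ₗ[ℂ] BTensor A E F :=
  lift (LinearMap.mk₂ ℂ (fun x y => tmul A (a • x) y)
    (fun x x' y => by rw [smul_add, add_tmul])
    (fun c x y => by rw [smul_comm a c x, smul_tmul])
    (fun x y y' => tmul_add _ _ _) (fun c x y => tmul_smul _ _ _))
    (fun x b y => by
      simp only [LinearMap.mk₂_apply]
      rw [← IsBimodule.assoc, balance])

instance : SMul A (BTensor A E F) := ⟨fun a z => lact a z⟩

theorem lact_tmul (a : A) (x : E) (y : F) : a • tmul A x y = tmul A (a • x) y :=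
  lift_tmul _ _ _ _

instance : Module A (BTensor A E F) where
  one_smul z := by
    change (lact 1 : BTensor A E F →ₗ[ℂ] BTensor A E F) z = (LinearMap.id : BTensor A E F →ₗ[ℂ] BTensor A E F) z
    congr 1
    exact hom_ext fun x y => (lact_tmul _ _ _).trans (by simp)
  mul_smul a b z := by
    change lact (a * b) z = ((lact a : BTensor A E F →ₗ[ℂ] BTensor A E F) ∘ₗ (lact b : BTensor A E F →ₗ[ℂ] BTensor A E F)) z
    congr 1
    refine hom_ext fun x y => (lact_tmul _ _ _).trans ?_
    change _ = a • b • tmul A x y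
    rw [lact_tmul, lact_tmul, mul_smul]
  smul_zero a := map_zero (lact a)
  smul_add a := map_add (lact a)
  add_smul a b z := by
    change lact (a + b) z = ((lact a : BTensor A E F →ₗ[ℂ] BTensor A E F) + (lact b : BTensor A E F →ₗ[ℂ] BTensor A E F)) z
    congr 1
    refine hom_ext fun x y => (lact_tmul _ _ _).trans ?_
    change _ = a • tmul A x y + b • tmul A x y
    rw [lact_tmul, lact_tmul, add_smul, add_tmul]
  zero_smul z := by
    change lact 0 z = (0 : BTensor A E F →ₗ[ℂ] BTensor A E F) z
    congr 1
    refine hom_ext fun x y => (lact_tmul _ _ _).trans ?_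
    rw [zero_smul, ← zero_smul ℂ (0 : E), smul_tmul, zero_smul]; rfl

end Left

section Right

variable [AddCommGroup E] [Module ℂ E] [Module Aᵐᵒᵖ E]
  [AddCommGroup F] [Module ℂ F] [Module A F] [Module Aᵐᵒᵖ F] [IsBimodule A F]

/-- `x ⊗ y ↦ x ⊗ (y a)`. -/
def ract (a : Aᵐᵒᵖ) : BTensor A E F →ₗ[ℂ] BTensor A E F :=
  lift (LinearMap.mk₂ ℂ (fun x y => tmul A x (a • y))
    (fun x x' y => add_tmul _ _ _)
    (fun c x y => smul_tmul _ _ _)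
    (fun x y y' => by rw [smul_add, tmul_add])
    (fun c x y => by rw [smul_comm a c y, tmul_smul]))
    (fun x b y => by
      simp only [LinearMap.mk₂_apply]
      rw [balance]
      exact congrArg _ (IsBimodule.assoc b a.unop y).symm)

instance : SMul Aᵐᵒᵖ (BTensor A E F) := ⟨fun a z => ract a z⟩

theorem ract_tmul (a : Aᵐᵒᵖ) (x : E) (y : F) : a • tmul A x y = tmul A x (a • y) :=
  lift_tmul _ _ _ _

instance : Module Aᵐᵒᵖ (BTensor A E F) where
  one_smul z := by
    change (ract 1 : BTensor A E F →ₗ[ℂ] BTensor A E F) z = (LinearMap.id : BTensor A E F →ₗ[ℂ] BTensor A E F) z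
    congr 1
    exact hom_ext fun x y => (ract_tmul _ _ _).trans (by simp)
  mul_smul a b z := by
    change ract (a * b) z = ((ract a : BTensor A E F →ₗ[ℂ] BTensor A E F) ∘ₗ (ract b : BTensor A E F →ₗ[ℂ] BTensor A E F)) z
    congr 1
    refine hom_ext fun x y => (ract_tmul _ _ _).trans ?_
    change _ = a • b • tmul A x y
    rw [ract_tmul, ract_tmul, mul_smul]
  smul_zero a := map_zero (ract a)
  smul_add a := map_add (ract a)
  add_smul a b z := by
    change ract (a + b) z = ((ract a : BTensor A E F →ₗ[ℂ] BTensor A E F) + (ract b : BTensor A E F →ₗ[ℂ] BTensor A E F)) z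
    congr 1
    refine hom_ext fun x y => (ract_tmul _ _ _).trans ?_
    change _ = a • tmul A x y + b • tmul A x y
    rw [ract_tmul, ract_tmul, add_smul, tmul_add]
  zero_smul z := by
    change ract 0 z = (0 : BTensor A E F →ₗ[ℂ] BTensor A E F) z
    congr 1
    refine hom_ext fun x y => (ract_tmul _ _ _).trans ?_
    rw [zero_smul, ← zero_smul ℂ (0 : F), tmul_smul, zero_smul]; rfl

end Right

variable [AddCommGroup E] [Module ℂ E] [Module A E] [Module Aᵐᵒᵖ E] [IsBimodule A E]
  [AddCommGroup F] [Module ℂ F] [Module A F] [Module Aᵐᵒᵖ F] [IsBimodule A F]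
  [AddCommGroup G] [Module ℂ G] [Module A G] [Module Aᵐᵒᵖ G] [IsBimodule A G]

instance : IsBimodule A (BTensor A E F) where
  scalar_left c a z := by
    induction z using induction with
    | h0 => simp
    | ht x y => rw [lact_tmul, lact_tmul, IsBimodule.scalar_left, smul_tmul]
    | ha z w hz hw => simp only [smul_add, hz, hw]
  scalar_right c a z := by
    induction z using induction with
    | h0 => simp
    | ht x y => rw [ract_tmul, ract_tmul, IsBimodule.scalar_right, tmul_smul]
    | ha z w hz hw => simp only [smul_add, hz, hw]
  assoc a b z := by
    induction z using induction with
    | h0 => simp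
    | ht x y => rw [lact_tmul, ract_tmul, ract_tmul, lact_tmul]
    | ha z w hz hw => simp only [smul_add, hz, hw]

end BTensor

end TensorActions

section Maps

variable {A E F G : Type*} [Ring A] [Algebra ℂ A]
  [AddCommGroup E] [Module ℂ E] [Module A E] [Module Aᵐᵒᵖ E] [IsBimodule A E]
  [AddCommGroup F] [Module ℂ F] [Module A F] [Module Aᵐᵒᵖ F] [IsBimodule A F]
  [AddCommGroup G] [Module ℂ G] [Module A G]

namespace BTensor

/-- The reassociation `(E ⊗_A F) ⊗_A G → E ⊗_A (F ⊗_A G)`. -/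
def assoc : BTensor A (BTensor A E F) G →ₗ[ℂ] BTensor A E (BTensor A F G) :=
  lift (LinearMap.flip
    { toFun := fun z => lift (LinearMap.mk₂ ℂ (fun x y => tmul A x (tmul A y z))
          (fun x x' y => add_tmul _ _ _) (fun c x y => smul_tmul _ _ _)
          (fun x y y' => by rw [add_tmul, tmul_add])
          (fun c x y => by rw [smul_tmul, tmul_smul]))
        (fun x a y => by
          simp only [LinearMap.mk₂_apply]
          rw [balance, lact_tmul])
      map_add' := fun z z' => hom_ext fun x y => by simp [tmul_add]
      map_smul' := fun c z => hom_ext fun x y => by simp [tmul_smul] })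
    (fun w a z => by
      simp only [LinearMap.flip_apply, LinearMap.coe_mk, AddHom.coe_mk]
      induction w using induction with
      | h0 => simp
      | ht x y => rw [ract_tmul, lift_tmul, lift_tmul, LinearMap.mk₂_apply, LinearMap.mk₂_apply,
          balance]
      | ha v w hv hw => rw [smul_add, map_add, map_add, hv, hw])

set_option linter.unusedSectionVars false in
theorem assoc_tmul (x : E) (y : F) (z : G) :
    assoc (tmul A (tmul A x y) z) = tmul A x (tmul A y z) := by
  simp [assoc]

end BTensor

end Maps

section BimodHom

/-- Homomorphisms of `A`-`A`-bimodules. -/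
@[ext] structure BimodHom (A E F : Type*) [Ring A] [Algebra ℂ A]
    [AddCommGroup E] [Module ℂ E] [Module A E] [Module Aᵐᵒᵖ E]
    [AddCommGroup F] [Module ℂ F] [Module A F] [Module Aᵐᵒᵖ F] extends E →ₗ[ℂ] F where
  map_lsmul : ∀ (a : A) (x : E), toFun (a • x) = a • toFun x
  map_rsmul : ∀ (a : A) (x : E), toFun (x <• a) = toFun x <• a

variable {A E F G : Type*} [Ring A] [Algebra ℂ A]
  [AddCommGroup E] [Module ℂ E] [Module A E] [Module Aᵐᵒᵖ E] [IsBimodule A E]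
  [AddCommGroup F] [Module ℂ F] [Module A F] [Module Aᵐᵒᵖ F] [IsBimodule A F]
  [AddCommGroup G] [Module ℂ G] [Module A G] [Module Aᵐᵒᵖ G] [IsBimodule A G]

instance : CoeFun (BimodHom A E F) (fun _ => E → F) := ⟨fun f => f.toFun⟩

/-- The bimodule map `id - σ`. -/
def BimodHom.idSub (σ : BimodHom A E E) : BimodHom A E E where
  toLinearMap := LinearMap.id - σ.toLinearMap
  map_lsmul a x := by
    change a • x - σ (a • x) = a • (x - σ x)
    rw [σ.map_lsmul, smul_sub]
  map_rsmul a x := by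
    change x <• a - σ (x <• a) = (x - σ x) <• a
    rw [σ.map_rsmul, smul_sub]

/-- A complex multiple of a bimodule map. -/
def BimodHom.scale (c : ℂ) (σ : BimodHom A E F) : BimodHom A E F where
  toLinearMap := c • σ.toLinearMap
  map_lsmul a x := by
    change c • σ (a • x) = a • (c • σ x)
    rw [σ.map_lsmul, smul_comm]
  map_rsmul a x := by
    change c • σ (x <• a) = (c • σ x) <• a
    rw [σ.map_rsmul]; exact smul_comm c (MulOpposite.op a) (σ x)

namespace BTensor

/-- `id_E ⊗_A f` for a left `A`-linear map `f`. -/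
def lTensorAux {F G : Type*} [AddCommGroup F] [Module ℂ F] [Module A F]
    [AddCommGroup G] [Module ℂ G] [Module A G] (E : Type*) [AddCommGroup E] [Module ℂ E]
    [Module Aᵐᵒᵖ E] (f : F →ₗ[ℂ] G) (hf : ∀ (a : A) (y : F), f (a • y) = a • f y) :
    BTensor A E F →ₗ[ℂ] BTensor A E G :=
  lift (LinearMap.mk₂ ℂ (fun x y => tmul A x (f y))
    (fun x x' y => add_tmul _ _ _) (fun c x y => smul_tmul _ _ _)
    (fun x y y' => by rw [map_add, tmul_add]) (fun c x y => by rw [map_smul, tmul_smul]))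
    (fun x a y => by
      simp only [LinearMap.mk₂_apply]
      rw [hf, balance])

/-- `id_E ⊗_A f` for a bimodule map `f`. -/
def lTensor (E : Type*) [AddCommGroup E] [Module ℂ E] [Module A E]
    [Module Aᵐᵒᵖ E] [IsBimodule A E] (f : BimodHom A F G) :
    BimodHom A (BTensor A E F) (BTensor A E G) where
  toLinearMap := lTensorAux E f.toLinearMap f.map_lsmul
  map_lsmul a z := by
    change lTensorAux E f.toLinearMap f.map_lsmul (a • z) =
      a • lTensorAux E f.toLinearMap f.map_lsmul z
    induction z using induction with
    | h0 => simp
    | ht x y => simp only [lact_tmul, lTensorAux, lift_tmul, LinearMap.mk₂_apply]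
    | ha v w hv hw => rw [smul_add, map_add, map_add, smul_add, hv, hw]
  map_rsmul a z := by
    change lTensorAux E f.toLinearMap f.map_lsmul (z <• a) =
      lTensorAux E f.toLinearMap f.map_lsmul z <• a
    induction z using induction with
    | h0 => simp
    | ht x y =>
      simp only [ract_tmul, lTensorAux, lift_tmul, LinearMap.mk₂_apply]
      exact congrArg _ (f.map_rsmul a y)
    | ha v w hv hw => rw [smul_add, map_add, map_add, smul_add, hv, hw]

/-- `f ⊗_A id_G` for a bimodule map `f`. -/
def rTensor (G : Type*) [AddCommGroup G] [Module ℂ G] [Module A G] (f : BimodHom A E F) :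
    BTensor A E G →ₗ[ℂ] BTensor A F G :=
  lift (LinearMap.mk₂ ℂ (fun x y => tmul A (f x) y)
    (fun x x' y => by rw [← add_tmul]; exact congrArg (tmul A · y) (map_add f.toLinearMap x x'))
    (fun c x y => by rw [← smul_tmul]; exact congrArg (tmul A · y) (map_smul f.toLinearMap c x))
    (fun x y y' => tmul_add _ _ _) (fun c x y => tmul_smul _ _ _))
    (fun x a y => by
      simp only [LinearMap.mk₂_apply]
      rw [f.map_rsmul, balance])

end BTensor

end BimodHom

section Duality

variable {A E X : Type*} [Ring A] [Algebra ℂ A]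
  [AddCommGroup E] [Module ℂ E] [Module A E] [Module Aᵐᵒᵖ E] [IsBimodule A E]
  [AddCommGroup X] [Module ℂ X] [Module A X] [Module Aᵐᵒᵖ X] [IsBimodule A X]

/-- The dual `E* = Hom_A(E, A)` of right `A`-linear maps, a left module by `(a φ)(x) = a φ(x)`. -/
abbrev RDual (A E : Type*) [Ring A] [AddCommGroup E] [Module Aᵐᵒᵖ E] : Type _ := E →ₗ[Aᵐᵒᵖ] A

/-- The map `ζ : X ⊗_A E* → Hom_A(E, X)`, `ζ(x ⊗ φ)(e) = x φ(e)`, evaluated at `e`. -/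
def zetaAt (e : E) : BTensor A X (RDual A E) →ₗ[ℂ] X :=
  BTensor.lift (LinearMap.mk₂ ℂ (fun x (φ : RDual A E) => x <• φ e)
    (fun x x' φ => smul_add _ _ _)
    (fun c x φ => smul_comm _ c x)
    (fun x φ ψ => by rw [LinearMap.add_apply, MulOpposite.op_add, add_smul])
    (fun c x φ => by rw [LinearMap.smul_apply, IsBimodule.scalar_right]))
    (fun x a φ => by
      simp only [LinearMap.mk₂_apply, LinearMap.smul_apply, smul_eq_mul, MulOpposite.op_mul,
        mul_smul])

/-- `y ⊗ z ↦ y τ(z ⊗ φ)`. -/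
def contractInner (τ : BTensor A E (RDual A E) →ₗ[ℂ] A)
    (hτ : ∀ (a : A) z, τ (a • z) = a * τ z) (φ : RDual A E) : BTensor A E E →ₗ[ℂ] E :=
  BTensor.lift (LinearMap.mk₂ ℂ (fun y z => y <• τ (BTensor.tmul A z φ))
    (fun y y' z => smul_add _ _ _)
    (fun c y z => smul_comm _ c y)
    (fun y z z' => by rw [BTensor.add_tmul, map_add, MulOpposite.op_add, add_smul])
    (fun c y z => by rw [BTensor.smul_tmul, map_smul, IsBimodule.scalar_right]))
    (fun y a z => by
      simp only [LinearMap.mk₂_apply]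
      rw [← BTensor.lact_tmul, hτ, MulOpposite.op_mul, mul_smul])

theorem contractInner_lsmul (τ : BTensor A E (RDual A E) →ₗ[ℂ] A)
    (hτ : ∀ (a : A) z, τ (a • z) = a * τ z) (φ : RDual A E) (a : A) (w : BTensor A E E) :
    contractInner τ hτ φ (a • w) = a • contractInner τ hτ φ w := by
  induction w using BTensor.induction with
  | h0 => simp
  | ht y z =>
    simp only [BTensor.lact_tmul, contractInner, BTensor.lift_tmul, LinearMap.mk₂_apply]
    exact IsBimodule.assoc _ _ _
  | ha v w hv hw => rw [smul_add, map_add, map_add, smul_add, hv, hw]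

/-- The contraction `id_{E ⊗ E} ⊗_A τ` of the last two factors: `x ⊗ y ⊗ z ⊗ φ ↦ x ⊗ y τ(z ⊗ φ)`. -/
def contractLast (τ : BTensor A E (RDual A E) →ₗ[ℂ] A) (hτ : ∀ (a : A) z, τ (a • z) = a * τ z) :
    BTensor A (BTensor A E (BTensor A E E)) (RDual A E) →ₗ[ℂ] BTensor A E E :=
  BTensor.lift (LinearMap.flip
    { toFun := fun φ => BTensor.lTensorAux E (contractInner τ hτ φ) (contractInner_lsmul τ hτ φ)
      map_add' := fun φ ψ => BTensor.hom_ext fun x w => by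
        have h : contractInner τ hτ (φ + ψ) = contractInner τ hτ φ + contractInner τ hτ ψ :=
          BTensor.hom_ext fun y z => by
            simp [contractInner, BTensor.tmul_add, add_smul]
        simp [BTensor.lTensorAux, h, BTensor.tmul_add]
      map_smul' := fun c φ => BTensor.hom_ext fun x w => by
        have h : contractInner τ hτ (c • φ) = c • contractInner τ hτ φ :=
          BTensor.hom_ext fun y z => by
            simp only [contractInner, BTensor.lift_tmul, LinearMap.mk₂_apply,
              LinearMap.smul_apply, BTensor.tmul_smul, map_smul]
            exact IsBimodule.scalar_right _ _ _
        simp [BTensor.lTensorAux, h, BTensor.tmul_smul] })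
    (fun v a φ => by
      have h : ∀ w : BTensor A E E,
          contractInner τ hτ φ (w <• a) = contractInner τ hτ (a • φ) w := fun w => by
        induction w using BTensor.induction with
        | h0 => simp
        | ht y z =>
          simp only [BTensor.ract_tmul, contractInner, BTensor.lift_tmul, LinearMap.mk₂_apply]
          rw [BTensor.balance]
        | ha v w hv hw => rw [smul_add, map_add, map_add, hv, hw]
      simp only [LinearMap.flip_apply, LinearMap.coe_mk, AddHom.coe_mk]
      induction v using BTensor.induction with
      | h0 => simp
      | ht x w =>
        simp only [BTensor.ract_tmul, BTensor.lTensorAux, BTensor.lift_tmul, LinearMap.mk₂_apply, h]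
      | ha v w hv hw => rw [smul_add, map_add, map_add, hv, hw])

/-- Central elements of a bimodule. -/
def IsCentral (A : Type*) {E : Type*} [Ring A] [AddCommGroup E] [Module A E] [Module Aᵐᵒᵖ E]
    (x : E) : Prop := ∀ a : A, a • x = x <• a

/-- The map `g ⊗_A id : E ⊗_A E ⊗_A E → E`, `x ⊗ y ⊗ z ↦ g(x ⊗ y) z`. -/
def metricId (g : BTensor A E E →ₗ[Aᵐᵒᵖ] A) : BTensor A E (BTensor A E E) →ₗ[ℂ] E :=
  have hg : ∀ (c : ℂ) (x : BTensor A E E), g (c • x) = c • g x := fun c x =>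
    LinearMap.map_smul_of_tower g c x
  BTensor.lift
    { toFun := fun x => BTensor.lift (LinearMap.mk₂ ℂ (fun y z => g (BTensor.tmul A x y) • z)
          (fun y y' z => by rw [BTensor.tmul_add, map_add, add_smul])
          (fun c y z => by rw [BTensor.tmul_smul, hg, smul_assoc])
          (fun y z z' => smul_add _ _ _)
          (fun c y z => smul_comm _ c z))
        (fun y a z => by
          simp only [LinearMap.mk₂_apply]
          rw [← BTensor.ract_tmul, map_smul, MulOpposite.smul_eq_mul_unop, MulOpposite.unop_op,
            mul_smul])
      map_add' := fun x x' => BTensor.hom_ext fun y z => by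
        simp [BTensor.add_tmul, add_smul]
      map_smul' := fun c x => BTensor.hom_ext fun y z => by
        simp [BTensor.smul_tmul, hg] }
    (fun x a w => by
      simp only [LinearMap.coe_mk, AddHom.coe_mk]
      induction w using BTensor.induction with
      | h0 => simp
      | ht y z =>
        simp only [BTensor.lact_tmul, BTensor.lift_tmul, LinearMap.mk₂_apply, BTensor.balance]
      | ha v w hv hw => rw [smul_add, map_add, map_add, hv, hw])

/-- The map `V_g : E → E*`, `V_g(x)(y) = g(x ⊗ y)`. -/
def metricDual (g : BTensor A E E →ₗ[Aᵐᵒᵖ] A) (x : E) : RDual A E where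
  toFun y := g (BTensor.tmul A x y)
  map_add' y y' := by rw [BTensor.tmul_add, map_add]
  map_smul' a y := by rw [← BTensor.ract_tmul, map_smul]; rfl

/-- The scalar curvature `ev ((V_g ⊗_A id)(Ric))`, where `ev(φ ⊗ y) = φ(y)`; that is, the image of `Ric`
under the map `x ⊗ y ↦ V_g(x)(y)`. -/
def scalarCurvature (g : BTensor A E E →ₗ[Aᵐᵒᵖ] A) (Ric : BTensor A E E) : A :=
  BTensor.lift (LinearMap.mk₂ ℂ (fun x y => metricDual g x y)
    (fun x x' y => by
      change g (BTensor.tmul A (x + x') y) = g (BTensor.tmul A x y) + g (BTensor.tmul A x' y)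
      rw [BTensor.add_tmul, map_add])
    (fun c x y => by
      change g (BTensor.tmul A (c • x) y) = c • g (BTensor.tmul A x y)
      rw [BTensor.smul_tmul]; exact LinearMap.map_smul_of_tower g c _)
    (fun x y y' => map_add _ _ _)
    (fun c x y => LinearMap.map_smul_of_tower (metricDual g x) c y))
    (fun x a y => by
      change g (BTensor.tmul A (x <• a) y) = g (BTensor.tmul A x (a • y))
      rw [BTensor.balance]) Ric

/-- `g` is a pseudo-Riemannian metric relative to the flip `σ`: a right `A`-linear map
`E ⊗_A E → A` with `g ∘ σ = g` such that `V_g` is an isomorphism. -/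
structure IsPseudoRiemannian (σ : BimodHom A (BTensor A E E) (BTensor A E E))
    (g : BTensor A E E →ₗ[Aᵐᵒᵖ] A) : Prop where
  symm : ∀ z, g (σ z) = g z
  nondegenerate : Function.Bijective (metricDual g)

end Duality

/-- The data of a derivation `δ : A → B` into an algebra `B` (for a spectral triple: the bounded
operators), along a representation `π : A → B`. -/
structure Calculus (A B : Type*) [Ring A] [Algebra ℂ A] [Ring B] [Algebra ℂ B] where
  π : A →ₐ[ℂ] B
  δ : A →ₗ[ℂ] B
  leibniz : ∀ a b, δ (a * b) = δ a * π b + π a * δ b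

namespace Calculus

variable {A B : Type*} [Ring A] [Algebra ℂ A] [Ring B] [Algebra ℂ B] (C : Calculus A B)

/-- `a ⊗ b ↦ a δ(b)`. -/
def formMap : A ⊗[ℂ] A →ₗ[ℂ] B :=
  TensorProduct.lift ((LinearMap.mul ℂ B).compl₁₂ C.π.toLinearMap C.δ)

/-- `a ⊗ b ↦ δ(a) δ(b)`. -/
def formMap₂ : A ⊗[ℂ] A →ₗ[ℂ] B :=
  TensorProduct.lift ((LinearMap.mul ℂ B).compl₁₂ C.δ C.δ)

/-- The space of one-forms: the span of all `a δ(b)` in `B`. -/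
def oneForms : Submodule ℂ B := LinearMap.range C.formMap

/-- The image of the multiplication map: the span of all products of two one-forms. -/
def preTwoForms : Submodule ℂ B := C.oneForms * C.oneForms

/-- The junk forms: the right submodule generated by all `∑ δ(aᵢ) δ(bᵢ)` with `∑ aᵢ δ(bᵢ) = 0`. -/
def junk : Submodule ℂ B :=
  Submodule.span ℂ {z | ∃ (t : A ⊗[ℂ] A) (c : A), C.formMap t = 0 ∧ z = C.formMap₂ t * C.π c}

/-- One-forms as a type. -/
def OneForm : Type _ := C.oneForms

/-- Two-forms: products of one-forms modulo junk forms. -/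
def TwoForm : Type _ := C.preTwoForms ⧸ C.junk.submoduleOf C.preTwoForms

instance : AddCommGroup C.OneForm := inferInstanceAs (AddCommGroup C.oneForms)
instance : Module ℂ C.OneForm := inferInstanceAs (Module ℂ C.oneForms)
instance : AddCommGroup C.TwoForm :=
  inferInstanceAs (AddCommGroup (C.preTwoForms ⧸ C.junk.submoduleOf C.preTwoForms))
instance : Module ℂ C.TwoForm :=
  inferInstanceAs (Module ℂ (C.preTwoForms ⧸ C.junk.submoduleOf C.preTwoForms))

variable {C}

/-- The element of `B` underlying a one-form. -/
def OneForm.val (ω : C.OneForm) : B := Subtype.val (p := (· ∈ C.oneForms)) ω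

theorem OneForm.val_mem (ω : C.OneForm) : ω.val ∈ C.oneForms := Subtype.property _

theorem OneForm.ext {ω η : C.OneForm} (h : ω.val = η.val) : ω = η := Subtype.ext h

/-- The one-form with a given underlying element. -/
def OneForm.mk (b : B) (h : b ∈ C.oneForms) : C.OneForm := (⟨b, h⟩ : C.oneForms)

theorem mem_oneForms (a b : A) : C.π a * C.δ b ∈ C.oneForms := ⟨a ⊗ₜ b, by simp [formMap]⟩

theorem δ_mem (a : A) : C.δ a ∈ C.oneForms := by simpa using C.mem_oneForms 1 a

theorem π_mul_mem (a : A) {x : B} (hx : x ∈ C.oneForms) : C.π a * x ∈ C.oneForms := by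
  obtain ⟨t, rfl⟩ := hx
  induction t using TensorProduct.induction_on with
  | zero => simp
  | tmul b c =>
    have : C.π a * C.formMap (b ⊗ₜ c) = C.π (a * b) * C.δ c := by simp [formMap, mul_assoc]
    rw [this]; exact mem_oneForms _ _
  | add s t hs ht => rw [map_add, mul_add]; exact add_mem hs ht

theorem mul_π_mem (a : A) {x : B} (hx : x ∈ C.oneForms) : x * C.π a ∈ C.oneForms := by
  obtain ⟨t, rfl⟩ := hx
  induction t using TensorProduct.induction_on with
  | zero => simp
  | tmul b c =>
    have : C.formMap (b ⊗ₜ c) * C.π a = C.π b * C.δ (c * a) - C.π (b * c) * C.δ a := by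
      simp [formMap, C.leibniz, mul_add, mul_assoc]
    rw [this]; exact sub_mem (mem_oneForms _ _) (mem_oneForms _ _)
  | add s t hs ht => rw [map_add, add_mul]; exact add_mem hs ht

/-- Left multiplication of one-forms by `A`. -/
instance : Module A C.OneForm where
  smul a ω := OneForm.mk (C.π a * ω.val) (π_mul_mem a ω.val_mem)
  one_smul ω := OneForm.ext (by change C.π 1 * ω.val = _; simp)
  mul_smul a b ω := OneForm.ext (by
    change C.π (a * b) * ω.val = C.π a * (C.π b * ω.val); simp [mul_assoc])
  smul_zero a := OneForm.ext (mul_zero (C.π a))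
  smul_add a ω η := OneForm.ext (mul_add (C.π a) ω.val η.val)
  add_smul a b ω := OneForm.ext (by
    change C.π (a + b) * ω.val = C.π a * ω.val + C.π b * ω.val; simp [add_mul])
  zero_smul ω := OneForm.ext (by change C.π 0 * ω.val = 0; simp)

/-- Right multiplication of one-forms by `A`. -/
instance : Module Aᵐᵒᵖ C.OneForm where
  smul a ω := OneForm.mk (ω.val * C.π a.unop) (mul_π_mem a.unop ω.val_mem)
  one_smul ω := OneForm.ext (by change ω.val * C.π 1 = _; simp)
  mul_smul a b ω := OneForm.ext (by
    change ω.val * C.π (b.unop * a.unop) = ω.val * C.π b.unop * C.π a.unop; simp [mul_assoc])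
  smul_zero a := OneForm.ext (zero_mul (C.π a.unop))
  smul_add a ω η := OneForm.ext (add_mul ω.val η.val (C.π a.unop))
  add_smul a b ω := OneForm.ext (by
    change ω.val * C.π (a.unop + b.unop) = ω.val * C.π a.unop + ω.val * C.π b.unop
    simp [mul_add])
  zero_smul ω := OneForm.ext (by change ω.val * C.π 0 = 0; simp)

instance : IsBimodule A C.OneForm where
  scalar_left c a ω := OneForm.ext (by
    change C.π (c • a) * ω.val = c • (C.π a * ω.val); simp)
  scalar_right c a ω := OneForm.ext (by
    change ω.val * C.π (c • a) = c • (ω.val * C.π a); simp)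
  assoc a b ω := OneForm.ext (mul_assoc (C.π a) ω.val (C.π b))

variable (C)

/-- The differential `d : A → E`. -/
def d : A →ₗ[ℂ] C.OneForm := C.δ.codRestrict C.oneForms δ_mem

theorem mul_mem_preTwoForms {x y : B} (hx : x ∈ C.oneForms) (hy : y ∈ C.oneForms) :
    x * y ∈ C.preTwoForms := Submodule.mul_mem_mul hx hy

theorem formMap₂_mem (t : A ⊗[ℂ] A) : C.formMap₂ t ∈ C.preTwoForms := by
  induction t using TensorProduct.induction_on with
  | zero => rw [map_zero]; exact zero_mem _
  | tmul a b =>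
    have h : C.formMap₂ (a ⊗ₜ b) = C.δ a * C.δ b := by simp [formMap₂]
    rw [h]; exact C.mul_mem_preTwoForms (δ_mem a) (δ_mem b)
  | add s t hs ht => rw [map_add]; exact add_mem hs ht

/-- The quotient map onto two-forms. -/
def twoFormMk : C.preTwoForms →ₗ[ℂ] C.TwoForm := (C.junk.submoduleOf C.preTwoForms).mkQ

/-- The map `a ⊗ b ↦ δ(a) δ(b)` modulo junk forms, which vanishes on the kernel of `a ⊗ b ↦ a δ(b)`. -/
def d₁Aux : ((A ⊗[ℂ] A) ⧸ LinearMap.ker C.formMap) →ₗ[ℂ] C.TwoForm :=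
  (LinearMap.ker C.formMap).liftQ
    (C.twoFormMk ∘ₗ C.formMap₂.codRestrict C.preTwoForms C.formMap₂_mem)
    (fun t ht => (Submodule.Quotient.mk_eq_zero _).2
      (Submodule.subset_span ⟨t, 1, ht, by simp⟩))

/-- The differential `d : E → Ω²`, `d(∑ aᵢ δ(bᵢ)) = ∑ δ(aᵢ) δ(bᵢ)` modulo junk forms. -/
def d₁ : C.OneForm →ₗ[ℂ] C.TwoForm := C.d₁Aux ∘ₗ C.formMap.quotKerEquivRange.symm.toLinearMap

theorem d₁_smul_d (a b : A) : C.d₁ (a • C.d b) =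
    C.twoFormMk ⟨C.δ a * C.δ b, C.mul_mem_preTwoForms (δ_mem a) (δ_mem b)⟩ := by
  have h : C.formMap.quotKerEquivRange.symm (a • C.d b : C.OneForm) =
      (LinearMap.ker C.formMap).mkQ (a ⊗ₜ b) := by
    refine (LinearEquiv.symm_apply_eq _).2 (Subtype.ext ?_)
    change C.π a * C.δ b = C.formMap (a ⊗ₜ b)
    simp [formMap]
  refine (congrArg C.d₁Aux h).trans ?_
  refine (Submodule.liftQ_apply (LinearMap.ker C.formMap) _ _).trans ?_
  refine congrArg C.twoFormMk (Subtype.ext ?_)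
  change C.formMap₂ (a ⊗ₜ b) = _
  simp [formMap₂]

/-- The multiplication map `m : E ⊗_A E → Ω²`. -/
def m : BTensor A C.OneForm C.OneForm →ₗ[ℂ] C.TwoForm :=
  BTensor.lift (LinearMap.mk₂ ℂ
    (fun ω η => C.twoFormMk ⟨ω.val * η.val, C.mul_mem_preTwoForms ω.val_mem η.val_mem⟩)
    (fun ω ω' η => (congrArg C.twoFormMk (Subtype.ext (add_mul ω.val ω'.val η.val))).trans
      (map_add C.twoFormMk ⟨_, C.mul_mem_preTwoForms ω.val_mem η.val_mem⟩
        ⟨_, C.mul_mem_preTwoForms ω'.val_mem η.val_mem⟩))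
    (fun c ω η => (congrArg C.twoFormMk (Subtype.ext (smul_mul_assoc c ω.val η.val))).trans
      (map_smul C.twoFormMk c ⟨_, C.mul_mem_preTwoForms ω.val_mem η.val_mem⟩))
    (fun ω η η' => (congrArg C.twoFormMk (Subtype.ext (mul_add ω.val η.val η'.val))).trans
      (map_add C.twoFormMk ⟨_, C.mul_mem_preTwoForms ω.val_mem η.val_mem⟩
        ⟨_, C.mul_mem_preTwoForms ω.val_mem η'.val_mem⟩))
    (fun c ω η => (congrArg C.twoFormMk (Subtype.ext (mul_smul_comm c ω.val η.val))).trans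
      (map_smul C.twoFormMk c ⟨_, C.mul_mem_preTwoForms ω.val_mem η.val_mem⟩)))
    (fun ω a η => by
      simp only [LinearMap.mk₂_apply]
      exact congrArg C.twoFormMk (Subtype.ext (mul_assoc ω.val (C.π a) η.val)))

/-- `E ⊗_A E`. -/
abbrev E2 : Type _ := BTensor A C.OneForm C.OneForm

/-- `E ⊗_A E ⊗_A E`. -/
abbrev E3 : Type _ := BTensor A C.OneForm C.E2

variable {C}

/-- `σ = 2 P_sym - 1` for an idempotent bimodule map `P_sym` of `E ⊗_A E` with range
`ker m`, and `σ(ω ⊗ η) = η ⊗ ω` for central `ω`, `η`. -/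
structure IsFlip (σ : BimodHom A C.E2 C.E2) : Prop where
  invol : ∀ z, σ (σ z) = z
  ker_m : ∀ z, C.m z = 0 ↔ σ z = z
  flip : ∀ ω η : C.OneForm, IsCentral A ω → IsCentral A η →
    σ (BTensor.tmul A ω η) = BTensor.tmul A η ω

variable (C)

/-- A right connection on the bimodule of one-forms. -/
@[ext] structure Connection where
  toMap : C.OneForm →ₗ[ℂ] C.E2
  leibniz : ∀ (ω : C.OneForm) (a : A),
    toMap (ω <• a) = toMap ω <• a + BTensor.tmul A ω (C.d a)

variable {C}

/-- Vanishing torsion: `m ∘ ∇ + d = 0`. With the graded Leibniz rule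
`d(ω a) = d(ω) a - m(ω ⊗ d a)`, the torsion `m ∘ ∇ + d` of a right connection is right `A`-linear. -/
def Connection.IsTorsionFree (D : C.Connection) : Prop := ∀ ω, C.m (D.toMap ω) + C.d₁ ω = 0

/-- `Π⁰_g(∇)(ω ⊗ η) = (g ⊗ id) σ₂₃ (∇ω ⊗ η + ∇η ⊗ ω)`. -/
def Connection.pi₀ (D : C.Connection) (σ : BimodHom A C.E2 C.E2) (g : C.E2 →ₗ[Aᵐᵒᵖ] A)
    (ω η : C.OneForm) : C.OneForm :=
  metricId g (BTensor.lTensor C.OneForm σ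
    (BTensor.assoc (BTensor.tmul A (D.toMap ω) η + BTensor.tmul A (D.toMap η) ω)))

/-- `P` is the map `Π_g(∇) : E ⊗_A E → E`: the difference `S = d ∘ g - P` is right `A`-linear, and
`P = Π⁰_g(∇)` on tensor products of central elements. -/
def Connection.IsPi (D : C.Connection) (σ : BimodHom A C.E2 C.E2) (g : C.E2 →ₗ[Aᵐᵒᵖ] A)
    (P : C.E2 → C.OneForm) : Prop :=
  (∃ S : C.E2 →ₗ[Aᵐᵒᵖ] C.OneForm, ∀ z, S z = C.d (g z) - P z) ∧
  ∀ ω η : C.OneForm, IsCentral A ω → IsCentral A η →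
    P (BTensor.tmul A ω η) = D.pi₀ σ g ω η

/-- Compatibility of `∇` with the metric: `Π_g(∇)(ω ⊗ η) = d(g(ω ⊗ η))`. -/
def Connection.IsCompatible (D : C.Connection) (σ : BimodHom A C.E2 C.E2)
    (g : C.E2 →ₗ[Aᵐᵒᵖ] A) : Prop :=
  ∃ P : C.E2 → C.OneForm, D.IsPi σ g P ∧
    ∀ ω η, P (BTensor.tmul A ω η) = C.d (g (BTensor.tmul A ω η))

/-- Levi-Civita connections: torsion-free and compatible with the metric. -/
structure Connection.IsLeviCivita (D : C.Connection) (σ : BimodHom A C.E2 C.E2)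
    (g : C.E2 →ₗ[Aᵐᵒᵖ] A) : Prop where
  torsionFree : D.IsTorsionFree
  compatible : D.IsCompatible σ g

/-- `R` is the curvature operator `R(∇) = H ∘ ∇` of `∇`, where
`H(ω ⊗ η) = (id ⊗ (1 - σ))(∇ω ⊗ η) + ω ⊗ q(d η)`, and `q : Ω² → E ⊗_A E` identifies two-forms with
antisymmetric tensors by `q(m(z)) = z - σ(z)`. -/
def Connection.IsCurvature (D : C.Connection) (σ : BimodHom A C.E2 C.E2)
    (R : C.OneForm →ₗ[ℂ] C.E3) : Prop :=
  ∃ (q : C.TwoForm →ₗ[ℂ] C.E2) (H : C.E2 →ₗ[ℂ] C.E3),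
    (∀ z, q (C.m z) = z - σ z) ∧
    (∀ ω η, H (BTensor.tmul A ω η) =
      BTensor.lTensor C.OneForm σ.idSub (BTensor.assoc (BTensor.tmul A (D.toMap ω) η)) +
        BTensor.tmul A ω (q (C.d₁ η))) ∧
    ∀ ω, R ω = H (D.toMap ω)

/-- `Ric` is the Ricci curvature of `∇`: with `Θ = (σ₂₃ ⊗ id) ζ⁻¹ ((id ⊗ (1 - P_sym)) R(∇))`, an element
of `E ⊗ E ⊗ E ⊗ E*`, it is the contraction `(id ⊗ id ⊗ τ)(Θ)`. Here `τ = ev ∘ ρ : E ⊗_A E* → A` is the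
left `A`-linear map with `τ(e ⊗ φ) = φ(e)` for central `e`, and `1 - P_sym = (1 - σ)/2`. -/
def Connection.IsRicci (D : C.Connection) (σ : BimodHom A C.E2 C.E2) (Ric : C.E2) : Prop :=
  ∃ (R : C.OneForm →ₗ[ℂ] C.E3) (Θ₀ : BTensor A C.E3 (RDual A C.OneForm))
    (τ : BTensor A C.OneForm (RDual A C.OneForm) →ₗ[ℂ] A)
    (hτ : ∀ (a : A) z, τ (a • z) = a * τ z),
    D.IsCurvature σ R ∧
    (∀ e, zetaAt e Θ₀ = BTensor.lTensor C.OneForm (σ.idSub.scale (1 / 2)) (R e)) ∧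
    (∀ (e : C.OneForm) (φ : RDual A C.OneForm), IsCentral A e → τ (BTensor.tmul A e φ) = φ e) ∧
    Ric = contractLast τ hτ
      (BTensor.rTensor (RDual A C.OneForm) (BTensor.lTensor C.OneForm σ) Θ₀)

end Calculus


section Dirac

variable {H : Type*} [NormedAddCommGroup H] [InnerProductSpace ℂ H]

/-- The bounded operator `b` is the commutator `[T, a]` of the (unbounded) operator `T` with the
bounded operator `a`: `a` maps the domain of `T` to itself, and `b = T a - a T` on it. -/
def IsCommutator (T : H →ₗ.[ℂ] H) (a b : H →L[ℂ] H) : Prop :=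
  ∀ ξ : T.domain, ∃ h : a ξ ∈ T.domain, b ξ = T ⟨a ξ, h⟩ - a (T ξ)

theorem IsCommutator.unique {T : H →ₗ.[ℂ] H} (hT : Dense (T.domain : Set H)) {a b b' : H →L[ℂ] H}
    (h : IsCommutator T a b) (h' : IsCommutator T a b') : b = b' := by
  refine ContinuousLinearMap.coeFn_injective ?_
  refine Continuous.ext_on hT b.continuous b'.continuous fun ξ hξ => ?_
  obtain ⟨_, h1⟩ := h ⟨ξ, hξ⟩
  obtain ⟨_, h2⟩ := h' ⟨ξ, hξ⟩
  exact h1.trans h2.symm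

theorem IsCommutator.add {T : H →ₗ.[ℂ] H} {a a' b b' : H →L[ℂ] H}
    (h : IsCommutator T a b) (h' : IsCommutator T a' b') : IsCommutator T (a + a') (b + b') := by
  intro ξ
  obtain ⟨m1, h1⟩ := h ξ
  obtain ⟨m2, h2⟩ := h' ξ
  refine ⟨add_mem m1 m2, ?_⟩
  have : T ⟨(a + a') ξ, add_mem m1 m2⟩ = T ⟨a ξ, m1⟩ + T ⟨a' ξ, m2⟩ := T.map_add ⟨_, m1⟩ ⟨_, m2⟩
  rw [this, _root_.add_apply, _root_.add_apply, h1, h2]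
  abel

theorem IsCommutator.smul {T : H →ₗ.[ℂ] H} {a b : H →L[ℂ] H} (c : ℂ)
    (h : IsCommutator T a b) : IsCommutator T (c • a) (c • b) := by
  intro ξ
  obtain ⟨m1, h1⟩ := h ξ
  refine ⟨T.domain.smul_mem c m1, ?_⟩
  have : T ⟨(c • a) ξ, T.domain.smul_mem c m1⟩ = c • T ⟨a ξ, m1⟩ := T.map_smul c ⟨_, m1⟩
  rw [this, _root_.smul_apply, _root_.smul_apply, h1, smul_sub]

theorem IsCommutator.mul {T : H →ₗ.[ℂ] H} {a a' b b' : H →L[ℂ] H}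
    (h : IsCommutator T a b) (h' : IsCommutator T a' b') :
    IsCommutator T (a * a') (b * a' + a * b') := by
  intro ξ
  obtain ⟨m2, h2⟩ := h' ξ
  obtain ⟨m1, h1⟩ := h ⟨a' ξ, m2⟩
  refine ⟨m1, ?_⟩
  change b (a' ξ) + a (b' ξ) = T ⟨a (a' ξ), m1⟩ - a (a' (T ξ))
  have h1' : b (a' ξ) = T ⟨a (a' ξ), m1⟩ - a (T ⟨a' ξ, m2⟩) := h1
  rw [h1', h2, map_sub]
  abel

theorem IsCommutator.one (T : H →ₗ.[ℂ] H) : IsCommutator T 1 0 :=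
  fun ξ => ⟨ξ.2, by simp⟩

/-- A representation `π` of the algebra `A` on a Hilbert space `H` and a densely defined operator `D`
whose commutators with `π(A)` are bounded: the part of a spectral triple that determines its
differential forms. -/
structure DiracTriple (A H : Type*) [Ring A] [Algebra ℂ A] [NormedAddCommGroup H]
    [InnerProductSpace ℂ H] where
  π : A →ₐ[ℂ] (H →L[ℂ] H)
  D : H →ₗ.[ℂ] H
  dense : Dense (D.domain : Set H)
  bounded : ∀ a, ∃ b, IsCommutator D (π a) b

variable {A : Type*} [Ring A] [Algebra ℂ A]

/-- The bounded operator `[D, a]`. -/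
def DiracTriple.comm (T : DiracTriple A H) (a : A) : H →L[ℂ] H := (T.bounded a).choose

theorem DiracTriple.comm_spec (T : DiracTriple A H) (a : A) :
    IsCommutator T.D (T.π a) (T.comm a) := (T.bounded a).choose_spec

theorem DiracTriple.comm_eq (T : DiracTriple A H) {a : A} {b : H →L[ℂ] H}
    (h : IsCommutator T.D (T.π a) b) : T.comm a = b := (T.comm_spec a).unique T.dense h

/-- The derivation `a ↦ √-1 [D, a]`. -/
def DiracTriple.calculus (T : DiracTriple A H) : Calculus A (H →L[ℂ] H) where
  π := T.π
  δ :=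
    { toFun := fun a => Complex.I • T.comm a
      map_add' := fun a b => by
        rw [T.comm_eq (b := T.comm a + T.comm b), smul_add]
        rw [map_add]; exact (T.comm_spec a).add (T.comm_spec b)
      map_smul' := fun c a => by
        rw [T.comm_eq (b := c • T.comm a), smul_comm]; rfl
        rw [map_smul]; exact (T.comm_spec a).smul c }
  leibniz a b := by
    change Complex.I • T.comm (a * b) = (Complex.I • T.comm a) * T.π b + T.π a * (Complex.I • T.comm b)
    rw [T.comm_eq (b := T.comm a * T.π b + T.π a * T.comm b), smul_add, smul_mul_assoc,
      mul_smul_comm]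
    rw [map_mul]; exact (T.comm_spec a).mul (T.comm_spec b)

end Dirac

/-- The GNS space `L²(C(𝕋²_θ), τ)` with the orthonormal basis `U^m V^n`, `(m, n) ∈ ℤ × ℤ`. -/
abbrev TorusL2 : Type := lp (fun _ : ℤ × ℤ => ℂ) 2

theorem memℓp_wshift (v : ℤ × ℤ) (w : ℤ × ℤ → Circle) {f : ℤ × ℤ → ℂ} (hf : Memℓp f 2) :
    Memℓp (fun n => (w n : ℂ) * f (n - v)) 2 := by
  have h2 : 0 < (2 : ENNReal).toReal := by norm_num
  rw [memℓp_gen_iff h2] at hf ⊢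
  refine ((Equiv.subRight v).summable_iff.2 hf).congr fun n => ?_
  simp [Circle.norm_coe]

/-- The unitary operator `(W ξ)(n) = w(n) ξ(n - v)`. -/
def wshift (v : ℤ × ℤ) (w : ℤ × ℤ → Circle) : TorusL2 ≃ₗᵢ[ℂ] TorusL2 where
  toFun ξ := ⟨fun n => (w n : ℂ) * ξ (n - v), memℓp_wshift v w (lp.memℓp ξ)⟩
  map_add' ξ η := by
    ext n
    change (w n : ℂ) * (ξ (n - v) + η (n - v)) = w n * ξ (n - v) + w n * η (n - v)
    ring
  map_smul' c ξ := by
    ext n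
    change (w n : ℂ) * (c * ξ (n - v)) = c * (w n * ξ (n - v))
    ring
  invFun ξ := ⟨fun n => ((w (n + v))⁻¹ : Circle) * ξ (n - -v),
    memℓp_wshift (-v) (fun n => (w (n + v))⁻¹) (lp.memℓp ξ)⟩
  left_inv ξ := by
    ext n
    change ((w (n + v))⁻¹ : Circle) * ((w (n - -v) : ℂ) * ξ (n - -v - v)) = ξ n
    rw [sub_neg_eq_add, add_sub_cancel_right, ← mul_assoc, ← Circle.coe_mul, inv_mul_cancel]
    simp
  right_inv ξ := by
    ext n
    change (w n : ℂ) * (((w (n - v + v))⁻¹ : Circle) * ξ (n - v - -v)) = ξ n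
    rw [sub_neg_eq_add, sub_add_cancel, ← mul_assoc, ← Circle.coe_mul, mul_inv_cancel]
    simp
  norm_map' ξ := by
    have h2 : 0 < (2 : ENNReal).toReal := by norm_num
    rw [lp.norm_eq_tsum_rpow h2, lp.norm_eq_tsum_rpow h2]
    congr 1
    rw [← (Equiv.subRight v).tsum_eq (fun n => ‖ξ n‖ ^ (2 : ENNReal).toReal)]
    refine tsum_congr fun n => ?_
    change ‖(w n : ℂ) * ξ (n - v)‖ ^ (2 : ENNReal).toReal = ‖ξ (n - v)‖ ^ (2 : ENNReal).toReal
    rw [norm_mul, Circle.norm_coe, one_mul]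

theorem wshift_apply (v : ℤ × ℤ) (w : ℤ × ℤ → Circle) (ξ : TorusL2) (n : ℤ × ℤ) :
    wshift v w ξ n = (w n : ℂ) * ξ (n - v) := rfl

theorem wshift_symm (v : ℤ × ℤ) (w : ℤ × ℤ → Circle) :
    (wshift v w).symm = wshift (-v) (fun n => (w (n + v))⁻¹) :=
  LinearIsometryEquiv.ext fun _ => rfl

/-- Left multiplication by `U`: `U (U^m V^n) = U^(m+1) V^n`. -/
def torusU : TorusL2 →L[ℂ] TorusL2 := (wshift (1, 0) 1).toContinuousLinearEquiv

/-- Left multiplication by `V`: `V (U^m V^n) = e^(-2πiθm) U^m V^(n+1)`. -/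
def torusV (θ : ℝ) : TorusL2 →L[ℂ] TorusL2 :=
  (wshift (0, 1) (fun n => Circle.exp (-(2 * Real.pi * θ * n.1)))).toContinuousLinearEquiv

/-- The `*`-algebra `A(𝕋²_θ)` generated by `U` and `V`. -/
def torusPoly (θ : ℝ) : StarSubalgebra ℂ (TorusL2 →L[ℂ] TorusL2) :=
  StarAlgebra.adjoin ℂ {torusU, torusV θ}

theorem torusU_mem (θ : ℝ) : torusU ∈ torusPoly θ := StarAlgebra.subset_adjoin _ _ (by simp)

theorem torusV_mem (θ : ℝ) : torusV θ ∈ torusPoly θ := StarAlgebra.subset_adjoin _ _ (by simp)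

theorem torusU_mul_torusV (θ : ℝ) :
    torusU * torusV θ = (Circle.exp (2 * Real.pi * θ) : ℂ) • (torusV θ * torusU) := by
  ext ξ n
  change ((1 : Circle) : ℂ) * (Circle.exp (-(2 * Real.pi * θ * ((n.1 - 1 : ℤ) : ℝ))) * ξ (n - (1, 0) - (0, 1))) =
    (Circle.exp (2 * Real.pi * θ) : ℂ) *
      (Circle.exp (-(2 * Real.pi * θ * n.1)) * (((1 : Circle) : ℂ) * ξ (n - (0, 1) - (1, 0))))
  rw [sub_right_comm n (0, 1) (1, 0), Circle.coe_one, one_mul, one_mul, ← mul_assoc,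
    ← Circle.coe_mul, ← Circle.exp_add]
  congr 4
  push_cast; ring

/-- The eigenvalue of `d_j` on `U^m V^n`: `m` for the first derivation and `n` for the second. -/
def torusWeight (j : Fin 2) (n : ℤ × ℤ) : ℂ := ![(n.1 : ℂ), (n.2 : ℂ)] j

/-- The operator `d_j` on the Hilbert space: `d_1 (U^m V^n) = m U^m V^n`, `d_2 (U^m V^n) = n U^m V^n`,
on its maximal domain. -/
def torusNumber (j : Fin 2) : TorusL2 →ₗ.[ℂ] TorusL2 where
  domain :=
    { carrier := {ξ | Memℓp (fun n => torusWeight j n * ξ n) 2}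
      add_mem' := fun {ξ η} h h' => by
        have e : (fun n => torusWeight j n * (ξ + η : TorusL2) n) =
            (fun n => torusWeight j n * ξ n) + fun n => torusWeight j n * η n := by
          ext n
          change torusWeight j n * (ξ n + η n) = torusWeight j n * ξ n + torusWeight j n * η n
          ring
        rw [Set.mem_ofPred_eq, e]; exact h.add h'
      zero_mem' := by
        have e : (fun n => torusWeight j n * (0 : TorusL2) n) = 0 := by
          ext n
          exact mul_zero _
        rw [Set.mem_ofPred_eq, e]; exact zero_memℓp
      smul_mem' := fun c ξ h => by
        have e : (fun n => torusWeight j n * (c • ξ : TorusL2) n) =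
            c • fun n => torusWeight j n * ξ n := by
          ext n
          change torusWeight j n * (c * ξ n) = c * (torusWeight j n * ξ n)
          ring
        rw [Set.mem_ofPred_eq, e]; exact h.const_smul c }
  toFun :=
    { toFun := fun ξ => ⟨fun n => torusWeight j n * (ξ : TorusL2) n, ξ.2⟩
      map_add' := fun ξ η => by
        ext n
        exact mul_add _ _ _
      map_smul' := fun c ξ => by
        ext n
        exact mul_left_comm _ _ _ }

theorem torusNumber_apply (j : Fin 2) (ξ : (torusNumber j).domain) (n : ℤ × ℤ) :
    torusNumber j ξ n = torusWeight j n * (ξ : TorusL2) n := rfl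

theorem torusWeight_add (j : Fin 2) (n v : ℤ × ℤ) :
    torusWeight j (n + v) = torusWeight j n + torusWeight j v := by
  fin_cases j <;> simp [torusWeight]

theorem isCommutator_wshift (j : Fin 2) (v : ℤ × ℤ) (w : ℤ × ℤ → Circle) :
    IsCommutator (torusNumber j) ((wshift v w).toContinuousLinearEquiv : TorusL2 →L[ℂ] TorusL2)
      (torusWeight j v • ((wshift v w).toContinuousLinearEquiv : TorusL2 →L[ℂ] TorusL2)) := by
  intro ξ
  have key : ∀ n, torusWeight j n * ((w n : ℂ) * (ξ : TorusL2) (n - v)) =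
      w n * (torusWeight j (n - v) * (ξ : TorusL2) (n - v)) +
        torusWeight j v * ((w n : ℂ) * (ξ : TorusL2) (n - v)) := fun n => by
    have := torusWeight_add j (n - v) v
    rw [sub_add_cancel] at this
    rw [this]; ring
  have hm : (wshift v w (ξ : TorusL2)) ∈ (torusNumber j).domain := by
    change Memℓp (fun n => torusWeight j n * ((w n : ℂ) * (ξ : TorusL2) (n - v))) 2
    have h1 : Memℓp (fun n => torusWeight j n * (ξ : TorusL2) n) 2 := ξ.2
    have h2 : Memℓp (fun n => (ξ : TorusL2) n) 2 := lp.memℓp (ξ : TorusL2)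
    have e : (fun n => torusWeight j n * ((w n : ℂ) * (ξ : TorusL2) (n - v))) =
        (fun n => (w n : ℂ) * (torusWeight j (n - v) * (ξ : TorusL2) (n - v))) +
          torusWeight j v • fun n => (w n : ℂ) * (ξ : TorusL2) (n - v) := funext key
    rw [e]
    exact (memℓp_wshift v w h1).add ((memℓp_wshift v w h2).const_smul (torusWeight j v))
  refine ⟨hm, ?_⟩
  ext n
  change torusWeight j v * ((w n : ℂ) * (ξ : TorusL2) (n - v)) =
    torusWeight j n * ((w n : ℂ) * (ξ : TorusL2) (n - v)) -
      w n * (torusWeight j (n - v) * (ξ : TorusL2) (n - v))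
  rw [key n]; ring

theorem single_mem_domain (j : Fin 2) (n : ℤ × ℤ) (c : ℂ) :
    lp.single 2 n c ∈ (torusNumber j).domain := by
  change Memℓp (fun k => torusWeight j k * lp.single (E := fun _ : ℤ × ℤ => ℂ) 2 n c k) 2
  have e : (fun k => torusWeight j k * lp.single (E := fun _ : ℤ × ℤ => ℂ) 2 n c k) =
      torusWeight j n • (lp.single (E := fun _ : ℤ × ℤ => ℂ) 2 n c : ℤ × ℤ → ℂ) := by
    ext k
    by_cases hk : k = n
    · subst hk; rfl
    · simp [lp.single_apply, hk]
  rw [e]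
  exact (lp.memℓp (lp.single (E := fun _ : ℤ × ℤ => ℂ) 2 n c)).const_smul _

theorem dense_torusNumber_inf :
    Dense (((torusNumber 0).domain ⊓ (torusNumber 1).domain : Submodule ℂ TorusL2) :
      Set TorusL2) := by
  intro ξ
  have h := lp.hasSum_single (p := 2) (by norm_num) ξ
  refine mem_closure_of_tendsto h (Filter.Eventually.of_forall fun s => ?_)
  exact Submodule.sum_mem _ fun n _ => ⟨single_mem_domain 0 n _, single_mem_domain 1 n _⟩

theorem dense_torusNumber (j : Fin 2) : Dense ((torusNumber j).domain : Set TorusL2) :=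
  dense_torusNumber_inf.mono fun ξ h => by
    fin_cases j
    · exact h.1
    · exact h.2

/-- `A` is an algebra of smooth functions on the noncommutative torus: a unital `*`-algebra of
operators with `A(𝕋²_θ) ⊆ A ⊆ C(𝕋²_θ)`, closed under the derivations `d_j = [d_j, ·]`. -/
structure IsSmoothTorusAlgebra (θ : ℝ) (A : StarSubalgebra ℂ (TorusL2 →L[ℂ] TorusL2)) : Prop where
  poly_le : torusPoly θ ≤ A
  le_closure : A ≤ (torusPoly θ).topologicalClosure
  stable : ∀ (a : A) (j : Fin 2), ∃ b : A, IsCommutator (torusNumber j) a b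

/-- The polynomial algebra `A(𝕋²_θ)` is closed under the derivations. -/
theorem isSmoothTorusAlgebra_torusPoly (θ : ℝ) : IsSmoothTorusAlgebra θ (torusPoly θ) where
  poly_le := le_rfl
  le_closure := StarSubalgebra.le_topologicalClosure _
  stable := by
    rintro ⟨a, ha⟩ j
    suffices h : ∃ b ∈ torusPoly θ, IsCommutator (torusNumber j) a b by
      obtain ⟨b, hb, h⟩ := h
      exact ⟨⟨b, hb⟩, h⟩
    have ha' : a ∈ (StarAlgebra.adjoin ℂ {torusU, torusV θ}).toSubalgebra := ha
    rw [StarAlgebra.adjoin_toSubalgebra] at ha'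
    induction ha' using Algebra.adjoin_induction with
    | mem x hx =>
      have hs : ∀ v w, ((wshift v w).toContinuousLinearEquiv : TorusL2 →L[ℂ] TorusL2) ∈ torusPoly θ →
          ∃ b ∈ torusPoly θ, IsCommutator (torusNumber j)
            ((wshift v w).toContinuousLinearEquiv : TorusL2 →L[ℂ] TorusL2) b := fun v w h =>
        ⟨_, (torusPoly θ).smul_mem h _, isCommutator_wshift j v w⟩
      have hstar : ∀ v w, star ((wshift v w).toContinuousLinearEquiv : TorusL2 →L[ℂ] TorusL2) =
          ((wshift (-v) (fun n => (w (n + v))⁻¹)).toContinuousLinearEquiv :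
            TorusL2 →L[ℂ] TorusL2) := fun v w => by
        rw [← wshift_symm, ContinuousLinearMap.star_eq_adjoint]
        exact LinearIsometryEquiv.adjoint_eq_symm _
      rcases hx with (rfl | rfl) | hx
      · exact hs _ _ (torusU_mem θ)
      · exact hs _ _ (torusV_mem θ)
      · rcases hx with hx | hx
        · have h := torusU_mem θ
          rw [← hx] at h
          have h' : x = star torusU := by rw [← hx, star_star]
          have h2 := star_mem h
          rw [star_star, h', torusU, hstar] at h2
          rw [h', torusU, hstar]
          exact hs _ _ h2
        · have h := torusV_mem θ
          have hx : star x = torusV θ := hx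
          rw [← hx] at h
          have h' : x = star (torusV θ) := by rw [← hx, star_star]
          have h2 := star_mem h
          rw [star_star, h', torusV, hstar] at h2
          rw [h', torusV, hstar]
          exact hs _ _ h2
    | algebraMap c =>
      refine ⟨0, zero_mem _, ?_⟩
      have := (IsCommutator.one (torusNumber j)).smul c
      rwa [smul_zero, ← Algebra.algebraMap_eq_smul_one] at this
    | add x y hx hy ihx ihy =>
      obtain ⟨b, hb, h⟩ := ihx (by
        have : x ∈ (StarAlgebra.adjoin ℂ {torusU, torusV θ}).toSubalgebra := by
          rwa [StarAlgebra.adjoin_toSubalgebra]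
        exact this)
      obtain ⟨b', hb', h'⟩ := ihy (by
        have : y ∈ (StarAlgebra.adjoin ℂ {torusU, torusV θ}).toSubalgebra := by
          rwa [StarAlgebra.adjoin_toSubalgebra]
        exact this)
      exact ⟨_, add_mem hb hb', h.add h'⟩
    | mul x y hx hy ihx ihy =>
      have mx : x ∈ torusPoly θ := by
        have : x ∈ (StarAlgebra.adjoin ℂ {torusU, torusV θ}).toSubalgebra := by
          rwa [StarAlgebra.adjoin_toSubalgebra]
        exact this
      have my : y ∈ torusPoly θ := by
        have : y ∈ (StarAlgebra.adjoin ℂ {torusU, torusV θ}).toSubalgebra := by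
          rwa [StarAlgebra.adjoin_toSubalgebra]
        exact this
      obtain ⟨b, hb, h⟩ := ihx mx
      obtain ⟨b', hb', h'⟩ := ihy my
      exact ⟨_, add_mem (mul_mem hb my) (mul_mem mx hb'), h.mul h'⟩

/-- The Hilbert space `L² ⊕ L²`. -/
abbrev TorusH : Type := PiLp 2 (fun _ : Fin 2 => TorusL2)

/-- The action of `M_2(ℂ)` on `L² ⊕ L²`: the operator `1 ⊗ M`. -/
def spinOp (M : Matrix (Fin 2) (Fin 2) ℂ) : TorusH →L[ℂ] TorusH :=
  (PiLp.continuousLinearEquiv 2 ℂ (fun _ : Fin 2 => TorusL2)).symm.toContinuousLinearMap ∘L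
    ContinuousLinearMap.pi (fun i => ∑ j, M i j • ContinuousLinearMap.proj j) ∘L
    (PiLp.continuousLinearEquiv 2 ℂ (fun _ : Fin 2 => TorusL2)).toContinuousLinearMap

theorem spinOp_apply (M : Matrix (Fin 2) (Fin 2) ℂ) (ξ : TorusH) (i : Fin 2) :
    spinOp M ξ i = M i 0 • ξ 0 + M i 1 • ξ 1 := by
  simp [spinOp, Fin.sum_univ_two]

/-- The diagonal operator `a ⊕ a` on `L² ⊕ L²`. -/
def diagOp (a : TorusL2 →L[ℂ] TorusL2) : TorusH →L[ℂ] TorusH :=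
  (PiLp.continuousLinearEquiv 2 ℂ (fun _ : Fin 2 => TorusL2)).symm.toContinuousLinearMap ∘L
    ContinuousLinearMap.pi (fun i => a ∘L ContinuousLinearMap.proj i) ∘L
    (PiLp.continuousLinearEquiv 2 ℂ (fun _ : Fin 2 => TorusL2)).toContinuousLinearMap

theorem diagOp_apply (a : TorusL2 →L[ℂ] TorusL2) (ξ : TorusH) (i : Fin 2) :
    diagOp a ξ i = a (ξ i) := rfl

theorem TorusH.op_ext {S T : TorusH →L[ℂ] TorusH} (h : ∀ ξ i, S ξ i = T ξ i) : S = T :=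
  ContinuousLinearMap.ext fun ξ => PiLp.ext (h ξ)

/-- `a ↦ a ⊕ a` as a homomorphism of algebras. -/
def diagHom : (TorusL2 →L[ℂ] TorusL2) →ₐ[ℂ] (TorusH →L[ℂ] TorusH) where
  toFun := diagOp
  map_one' := rfl
  map_mul' _ _ := rfl
  map_zero' := rfl
  map_add' _ _ := rfl
  commutes' _ := rfl

/-- The matrices `γ_1 = (0 1; 1 0)` and `γ_2 = (0 i; -i 0)`. -/
def gammaMatrix (j : Fin 2) : Matrix (Fin 2) (Fin 2) ℂ :=
  ![!![0, 1; 1, 0], !![0, Complex.I; -Complex.I, 0]] j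

/-- The Dirac operator `D = (0, d_1 + i d_2; d_1 - i d_2, 0)`. -/
def torusDirac : TorusH →ₗ.[ℂ] TorusH where
  domain :=
    { carrier := {ξ | ∀ i j, ξ i ∈ (torusNumber j).domain}
      add_mem' := fun h h' i j => add_mem (h i j) (h' i j)
      zero_mem' := fun _ j => zero_mem (torusNumber j).domain
      smul_mem' := fun c _ h i j => (torusNumber j).domain.smul_mem c (h i j) }
  toFun :=
    { toFun := fun ξ => WithLp.toLp 2
        ![torusNumber 0 ⟨ξ.1 1, ξ.2 1 0⟩ + Complex.I • torusNumber 1 ⟨ξ.1 1, ξ.2 1 1⟩,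
          torusNumber 0 ⟨ξ.1 0, ξ.2 0 0⟩ - Complex.I • torusNumber 1 ⟨ξ.1 0, ξ.2 0 1⟩]
      map_add' := fun ξ η => by
        have h : ∀ i j, torusNumber j ⟨(ξ + η).1 i, (ξ + η).2 i j⟩ =
            torusNumber j ⟨ξ.1 i, ξ.2 i j⟩ + torusNumber j ⟨η.1 i, η.2 i j⟩ := fun i j =>
          (torusNumber j).map_add ⟨ξ.1 i, ξ.2 i j⟩ ⟨η.1 i, η.2 i j⟩
        refine PiLp.ext fun i => ?_
        simp only [h, smul_add]
        fin_cases i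
        · exact add_add_add_comm _ _ _ _
        · exact add_sub_add_comm _ _ _ _
      map_smul' := fun c ξ => by
        have h : ∀ i j, torusNumber j ⟨(c • ξ).1 i, (c • ξ).2 i j⟩ =
            c • torusNumber j ⟨ξ.1 i, ξ.2 i j⟩ := fun i j =>
          (torusNumber j).map_smul c ⟨ξ.1 i, ξ.2 i j⟩
        refine PiLp.ext fun i => ?_
        simp only [h, smul_comm Complex.I c, ← smul_add, ← smul_sub]
        fin_cases i <;> rfl }

theorem dense_torusDirac : Dense (torusDirac.domain : Set TorusH) := by
  have h : Dense (Set.pi Set.univ fun _ : Fin 2 =>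
      (((torusNumber 0).domain ⊓ (torusNumber 1).domain : Submodule ℂ TorusL2) : Set TorusL2)) :=
    dense_pi _ fun _ _ => dense_torusNumber_inf
  have h' := h.preimage
    (PiLp.continuousLinearEquiv 2 ℂ (fun _ : Fin 2 => TorusL2)).toHomeomorph.isOpenMap
  refine h'.mono fun ξ hξ i j => ?_
  have := hξ i (Set.mem_univ i)
  fin_cases j
  · exact this.1
  · exact this.2

theorem isCommutator_torusDirac {a b₀ b₁ : TorusL2 →L[ℂ] TorusL2}
    (h0 : IsCommutator (torusNumber 0) a b₀) (h1 : IsCommutator (torusNumber 1) a b₁) :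
    IsCommutator torusDirac (diagOp a)
      (spinOp (gammaMatrix 0) * diagOp b₀ + spinOp (gammaMatrix 1) * diagOp b₁) := by
  intro ξ
  have hm : ∀ i j, a (ξ.1 i) ∈ (torusNumber j).domain := fun i j => by
    fin_cases j
    · exact (h0 ⟨ξ.1 i, ξ.2 i 0⟩).1
    · exact (h1 ⟨ξ.1 i, ξ.2 i 1⟩).1
  refine ⟨hm, PiLp.ext fun i => ?_⟩
  have e0 : ∀ i, b₀ (ξ.1 i) = torusNumber 0 ⟨a (ξ.1 i), hm i 0⟩ -
      a (torusNumber 0 ⟨ξ.1 i, ξ.2 i 0⟩) := fun i => (h0 ⟨ξ.1 i, ξ.2 i 0⟩).2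
  have e1 : ∀ i, b₁ (ξ.1 i) = torusNumber 1 ⟨a (ξ.1 i), hm i 1⟩ -
      a (torusNumber 1 ⟨ξ.1 i, ξ.2 i 1⟩) := fun i => (h1 ⟨ξ.1 i, ξ.2 i 1⟩).2
  change spinOp (gammaMatrix 0) (diagOp b₀ ξ) i + spinOp (gammaMatrix 1) (diagOp b₁ ξ) i = _
  rw [spinOp_apply, spinOp_apply]
  simp only [diagOp_apply, e0, e1]
  fin_cases i
  · change (0 : ℂ) • _ + (1 : ℂ) • (_ - _) + ((0 : ℂ) • _ + Complex.I • (_ - _)) =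
      (torusNumber 0 ⟨a (ξ.1 1), hm 1 0⟩ + Complex.I • torusNumber 1 ⟨a (ξ.1 1), hm 1 1⟩) -
      a (torusNumber 0 ⟨ξ.1 1, ξ.2 1 0⟩ + Complex.I • torusNumber 1 ⟨ξ.1 1, ξ.2 1 1⟩)
    rw [map_add, map_smul, zero_smul, zero_smul, one_smul, smul_sub]
    abel
  · change (1 : ℂ) • (_ - _) + (0 : ℂ) • _ + ((-Complex.I) • (_ - _) + (0 : ℂ) • _) =
      (torusNumber 0 ⟨a (ξ.1 0), hm 0 0⟩ - Complex.I • torusNumber 1 ⟨a (ξ.1 0), hm 0 1⟩) -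
      a (torusNumber 0 ⟨ξ.1 0, ξ.2 0 0⟩ - Complex.I • torusNumber 1 ⟨ξ.1 0, ξ.2 0 1⟩)
    rw [map_sub, map_smul, zero_smul, zero_smul, one_smul, smul_sub, neg_smul, neg_smul]
    abel

section Torus

variable {θ : ℝ} {A : StarSubalgebra ℂ (TorusL2 →L[ℂ] TorusL2)} (hA : IsSmoothTorusAlgebra θ A)

/-- The canonical spectral data `(A, L² ⊕ L², D)` of the noncommutative torus. -/
def torusTriple : DiracTriple A TorusH where
  π := diagHom.comp A.subtype.toAlgHom
  D := torusDirac
  dense := dense_torusDirac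
  bounded a := by
    obtain ⟨b₀, h0⟩ := hA.stable a 0
    obtain ⟨b₁, h1⟩ := hA.stable a 1
    exact ⟨_, isCommutator_torusDirac h0 h1⟩

/-- The differential calculus of the noncommutative torus. -/
def torusCalculus : Calculus A (TorusH →L[ℂ] TorusH) := (torusTriple hA).calculus

/-- The derivations `∂_j = √-1 d_j` of `A`, with `∂_1 U = √-1 U`, `∂_1 V = 0`, `∂_2 U = 0`,
`∂_2 V = √-1 V`. -/
def torusPartial (j : Fin 2) (a : A) : A := Complex.I • (hA.stable a j).choose

theorem torusPartial_eq (j : Fin 2) (a b : A) (h : IsCommutator (torusNumber j) a b) :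
    torusPartial hA j a = Complex.I • b := by
  have : (hA.stable a j).choose = b :=
    Subtype.ext ((hA.stable a j).choose_spec.unique (dense_torusNumber j) h)
  rw [torusPartial, this]

theorem torusCalculus_δ (a : A) : (torusCalculus hA).δ a =
    spinOp (gammaMatrix 0) * diagOp (torusPartial hA 0 a) +
      spinOp (gammaMatrix 1) * diagOp (torusPartial hA 1 a) := by
  change Complex.I • (torusTriple hA).comm a = _
  rw [(torusTriple hA).comm_eq (isCommutator_torusDirac (hA.stable a 0).choose_spec
    (hA.stable a 1).choose_spec), smul_add, ← mul_smul_comm, ← mul_smul_comm]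
  rfl

theorem diagOp_commute (M : Matrix (Fin 2) (Fin 2) ℂ) (a : TorusL2 →L[ℂ] TorusL2) :
    diagOp a * spinOp M = spinOp M * diagOp a :=
  TorusH.op_ext fun ξ i => by
    change a (spinOp M ξ i) = spinOp M (diagOp a ξ) i
    rw [spinOp_apply, spinOp_apply, map_add, map_smul, map_smul]
    rfl

theorem isCommutator_torusU (j : Fin 2) :
    IsCommutator (torusNumber j) torusU (torusWeight j (1, 0) • torusU) :=
  isCommutator_wshift j _ _

theorem isCommutator_torusV (θ : ℝ) (j : Fin 2) :
    IsCommutator (torusNumber j) (torusV θ) (torusWeight j (0, 1) • torusV θ) :=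
  isCommutator_wshift j _ _

/-- `U` as an element of `A`. -/
def elemU : A := ⟨torusU, hA.poly_le (torusU_mem θ)⟩

/-- `V` as an element of `A`. -/
def elemV : A := ⟨torusV θ, hA.poly_le (torusV_mem θ)⟩

theorem torusPartial_elemU (j : Fin 2) :
    torusPartial hA j (elemU hA) = (Complex.I * torusWeight j (1, 0)) • elemU hA := by
  rw [mul_smul]; exact torusPartial_eq hA j _ (torusWeight j (1, 0) • elemU hA) (isCommutator_torusU j)

theorem torusPartial_elemV (j : Fin 2) :
    torusPartial hA j (elemV hA) = (Complex.I * torusWeight j (0, 1)) • elemV hA := by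
  rw [mul_smul]
  exact torusPartial_eq hA j _ (torusWeight j (0, 1) • elemV hA) (isCommutator_torusV θ j)

theorem star_wshift_mul (v : ℤ × ℤ) (w : ℤ × ℤ → Circle) :
    star ((wshift v w).toContinuousLinearEquiv : TorusL2 →L[ℂ] TorusL2) *
      ((wshift v w).toContinuousLinearEquiv : TorusL2 →L[ℂ] TorusL2) = 1 := by
  rw [ContinuousLinearMap.star_eq_adjoint]
  have h := LinearIsometryEquiv.adjoint_eq_symm (wshift v w)
  refine ContinuousLinearMap.ext fun ξ => ?_
  refine (congrArg (fun T : TorusL2 →L[ℂ] TorusL2 => T (wshift v w ξ)) h).trans ?_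
  exact (wshift v w).symm_apply_apply ξ

theorem spinOp_mem_aux (M : Matrix (Fin 2) (Fin 2) ℂ) {x : A} (hx : star x * x = 1)
    (h : (torusCalculus hA).δ x = spinOp M * diagOp (Complex.I • x : A)) :
    spinOp M ∈ (torusCalculus hA).oneForms := by
  have hm : (torusCalculus hA).π ((-Complex.I) • star x) * (torusCalculus hA).δ x ∈
      (torusCalculus hA).oneForms := (torusCalculus hA).mem_oneForms _ _
  have e : (torusCalculus hA).π ((-Complex.I) • star x) * (torusCalculus hA).δ x = spinOp M := by
    have e1 : ((-Complex.I) • star x) * (Complex.I • x) = 1 := by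
      rw [smul_mul_smul_comm, hx]; simp
    have e2 : diagOp ((-Complex.I) • star x : A) * diagOp (Complex.I • x : A) = 1 :=
      congrArg (fun y : A => diagOp y) e1
    have e3 : (torusCalculus hA).π ((-Complex.I) • star x) = diagOp ((-Complex.I) • star x : A) :=
      rfl
    rw [h, e3, ← mul_assoc, diagOp_commute, mul_assoc, e2, mul_one]
  rwa [e] at hm

theorem spinOp_gamma_mem (j : Fin 2) :
    spinOp (gammaMatrix j) ∈ (torusCalculus hA).oneForms := by
  have hz : ∀ (i : Fin 2) (x : A), spinOp (gammaMatrix i) * diagOp ((0 : ℂ) • x : A) = 0 :=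
    fun i x => by rw [zero_smul]; exact mul_zero (spinOp (gammaMatrix i))
  fin_cases j
  · refine spinOp_mem_aux hA _ (x := elemU hA) (Subtype.ext (star_wshift_mul _ _)) ?_
    rw [torusCalculus_δ, torusPartial_elemU, torusPartial_elemU]
    simp only [torusWeight, Matrix.cons_val_zero, Matrix.cons_val_one, Int.cast_one, Int.cast_zero,
      mul_one, mul_zero, hz, add_zero]
    rfl
  · refine spinOp_mem_aux hA _ (x := elemV hA) (Subtype.ext (star_wshift_mul _ _)) ?_
    rw [torusCalculus_δ, torusPartial_elemV, torusPartial_elemV]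
    simp only [torusWeight, Matrix.cons_val_zero, Matrix.cons_val_one, Int.cast_one, Int.cast_zero,
      mul_one, mul_zero, hz, zero_add]
    rfl

/-- The one-forms `e_1 = 1 ⊗ γ_1` and `e_2 = 1 ⊗ γ_2`. -/
def torusForm (j : Fin 2) : (torusCalculus hA).OneForm :=
  Calculus.OneForm.mk (spinOp (gammaMatrix j)) (spinOp_gamma_mem hA j)

/-- The tensor `e_j ⊗_A e_l`. -/
def torusForm₂ (j l : Fin 2) : (torusCalculus hA).E2 :=
  BTensor.tmul A (torusForm hA j) (torusForm hA l)

/-- The canonical metric `g₀` of the noncommutative torus: the bimodule map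
`E ⊗_A E → A` with `g₀(e_j ⊗ e_l) = δ_jl`. -/
structure IsTorusMetric (g₀ : (torusCalculus hA).E2 →ₗ[Aᵐᵒᵖ] A) : Prop where
  map_lsmul : ∀ (a : A) (z : (torusCalculus hA).E2), g₀ (a • z) = a * g₀ z
  apply : ∀ j l, g₀ (torusForm₂ hA j l) = if j = l then 1 else 0

end Torus

end NCG

end

open NCG

noncomputable section

namespace NCG
set_option linter.unusedSectionVars false

/-! ### Elementary rules for balanced tensor products. -/

namespace BTensor

section

variable {A E F : Type*} [Ring A]
  [AddCommGroup E] [Module ℂ E] [Module Aᵐᵒᵖ E] [AddCommGroup F] [Module ℂ F] [Module A F]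

/-! The one-forms of the noncommutative torus are free on two central forms, so every tensor has
coordinates in $A$ and the coordinate maps respect both actions. `Frame` collects what the geometry
needs: such a basis, the fact that $m$ kills exactly the tensors with symmetric coefficients, the
rule $d(e_j a)=-m(e_j\otimes da)$, and commuting derivations $\partial_j$. What remains is
two-dimensional tensor calculus with the order of factors preserved.

With indices 0 and 1, the flip transposes coefficients, and a connection is an arbitrary array
$\nabla e_j=\sum e_p\otimes e_q\,\Gamma_{jpq}$. Vanishing torsion means $\Gamma_{jpq}=\Gamma_{jqp}$
(`isTorsionFree_iff`). Compatibility with $kg_0$ means $\Gamma_{jlq}+\Gamma_{ljq}=\delta_{jl}x_q$,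
where $x_q=k^{-1}\partial_q k$ (`isCompatible_iff`). The Koszul combination gives the only solution,
$\Gamma_{jlq}=\frac12(\delta_{jl}x_q+\delta_{jq}x_l-\delta_{lq}x_j)$ (`isLeviCivita_iff`).

Let $A_q$ be the matrix with entry $\Gamma_{jlq}$ in row $l$ and column $j$. In dimension two
$A_1=JA_0$ for a scalar matrix $J$ with $J^2=-1$, hence $A_0A_1=A_1A_0$ although $x_0,x_1$ need not
commute. The quadratic part of the curvature therefore vanishes, and Ricci is linear in the
$\partial_i x_j$ (`ricciCoeff_eq`). The product rule and $\partial_0\partial_1=\partial_1\partial_0$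
yield the stated formulas.

For the torus, $U^*dU=\sqrt{-1}\,\gamma_1$ and $V^*dV=\sqrt{-1}\,\gamma_2$ produce the frame. A
product of one-forms is $\pi(a)+\gamma_1\gamma_2\pi(b)$, and it is junk exactly when $b=0$.
Differentiating $\sum a_i\,\partial_j b_i=0$ shows that junk has no $\gamma_1\gamma_2$ part
(`diagDiff_junk`), while $u=U$ with its inverse $v$ shows that all of $\pi(A)$ is junk
(`π_mem_junk_of_eigen`). -/

theorem tmul_zero (x : E) : tmul A x (0 : F) = 0 := by
  rw [← zero_smul ℂ (0 : F), tmul_smul, zero_smul]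

theorem zero_tmul (y : F) : tmul A (0 : E) y = 0 := by
  rw [← zero_smul ℂ (0 : E), smul_tmul, zero_smul]

theorem tmul_neg (x : E) (y : F) : tmul A x (-y) = -tmul A x y := by
  rw [← neg_one_smul ℂ y, tmul_smul, neg_one_smul]

theorem neg_tmul (x : E) (y : F) : tmul A (-x) y = -tmul A x y := by
  rw [← neg_one_smul ℂ x, smul_tmul, neg_one_smul]

theorem tmul_sub (x : E) (y y' : F) : tmul A x (y - y') = tmul A x y - tmul A x y' := by
  rw [sub_eq_add_neg, tmul_add, tmul_neg, ← sub_eq_add_neg]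

theorem sub_tmul (x x' : E) (y : F) : tmul A (x - x') y = tmul A x y - tmul A x' y := by
  rw [sub_eq_add_neg, add_tmul, neg_tmul, ← sub_eq_add_neg]

theorem tmul_sum {ι : Type*} (s : Finset ι) (x : E) (f : ι → F) :
    tmul A x (∑ i ∈ s, f i) = ∑ i ∈ s, tmul A x (f i) := by
  classical
  induction s using Finset.induction_on with
  | empty => simp [tmul_zero]
  | insert i s hi ih => rw [Finset.sum_insert hi, Finset.sum_insert hi, tmul_add, ih]

theorem sum_tmul {ι : Type*} (s : Finset ι) (f : ι → E) (y : F) :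
    tmul A (∑ i ∈ s, f i) y = ∑ i ∈ s, tmul A (f i) y := by
  classical
  induction s using Finset.induction_on with
  | empty => simp [zero_tmul]
  | insert i s hi ih => rw [Finset.sum_insert hi, Finset.sum_insert hi, add_tmul, ih]

end

section

variable {A E F G : Type*} [Ring A] [Algebra ℂ A]
  [AddCommGroup E] [Module ℂ E] [Module A E] [Module Aᵐᵒᵖ E] [IsBimodule A E]
  [AddCommGroup F] [Module ℂ F] [Module A F] [Module Aᵐᵒᵖ F] [IsBimodule A F]
  [AddCommGroup G] [Module ℂ G] [Module A G] [Module Aᵐᵒᵖ G] [IsBimodule A G]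

theorem lTensor_tmul (f : BimodHom A F G) (x : E) (y : F) :
    lTensor E f (tmul A x y) = tmul A x (f y) := by
  change lTensorAux E f.toLinearMap f.map_lsmul (tmul A x y) = _
  rw [lTensorAux, lift_tmul, LinearMap.mk₂_apply]; rfl

theorem lTensor_add (f : BimodHom A F G) (z w : BTensor A E F) :
    lTensor E f (z + w) = lTensor E f z + lTensor E f w := map_add (lTensor E f).toLinearMap z w

theorem lTensor_sub (f : BimodHom A F G) (z w : BTensor A E F) :
    lTensor E f (z - w) = lTensor E f z - lTensor E f w := map_sub (lTensor E f).toLinearMap z w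

theorem lTensor_sum {ι : Type*} (s : Finset ι) (f : BimodHom A F G) (z : ι → BTensor A E F) :
    lTensor E f (∑ i ∈ s, z i) = ∑ i ∈ s, lTensor E f (z i) :=
  map_sum (lTensor E f).toLinearMap z s

theorem assoc_ract (z : BTensor A E F) (a : A) (y : G) :
    assoc (tmul A z (y <• a)) = assoc (tmul A z y) <• a := by
  induction z using induction with
  | h0 => simp [zero_tmul]
  | ht x w => rw [assoc_tmul, assoc_tmul, ract_tmul, ract_tmul]
  | ha v w hv hw => simp only [add_tmul, map_add, smul_add, hv, hw]

end

theorem rTensor_tmul {A E F G : Type*} [Ring A] [Algebra ℂ A]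
    [AddCommGroup E] [Module ℂ E] [Module A E] [Module Aᵐᵒᵖ E] [IsBimodule A E]
    [AddCommGroup F] [Module ℂ F] [Module A F] [Module Aᵐᵒᵖ F] [IsBimodule A F]
    [AddCommGroup G] [Module ℂ G] [Module A G] (f : BimodHom A E F) (x : E) (y : G) :
    rTensor G f (tmul A x y) = tmul A (f x) y := by
  rw [rTensor, lift_tmul, LinearMap.mk₂_apply]

end BTensor

open BTensor

/-! ### Bimodule maps and contractions on elementary tensors. -/

namespace BimodHom

variable {A E F : Type*} [Ring A] [Algebra ℂ A]
  [AddCommGroup E] [Module ℂ E] [Module A E] [Module Aᵐᵒᵖ E] [IsBimodule A E]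
  [AddCommGroup F] [Module ℂ F] [Module A F] [Module Aᵐᵒᵖ F] [IsBimodule A F]

theorem apply_lsmul (f : BimodHom A E F) (a : A) (x : E) : f (a • x) = a • f x := f.map_lsmul a x
theorem apply_rsmul (f : BimodHom A E F) (a : A) (x : E) : f (x <• a) = f x <• a := f.map_rsmul a x
theorem apply_add (f : BimodHom A E F) (x y : E) : f (x + y) = f x + f y := map_add f.toLinearMap x y
theorem apply_zero (f : BimodHom A E F) : f 0 = 0 := map_zero f.toLinearMap
theorem apply_neg (f : BimodHom A E F) (x : E) : f (-x) = -f x := map_neg f.toLinearMap x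
theorem apply_smul (f : BimodHom A E F) (c : ℂ) (x : E) : f (c • x) = c • f x :=
  map_smul f.toLinearMap c x
theorem apply_sum (f : BimodHom A E F) {ι : Type*} (s : Finset ι) (x : ι → E) :
    f (∑ i ∈ s, x i) = ∑ i ∈ s, f (x i) := map_sum f.toLinearMap x s

theorem idSub_apply (σ : BimodHom A E E) (x : E) : σ.idSub x = x - σ x := rfl

/-- A bimodule map as a map of right modules. -/
def toRight (f : BimodHom A E F) : E →ₗ[Aᵐᵒᵖ] F where
  toFun x := f x
  map_add' := f.apply_add
  map_smul' a x := f.apply_rsmul a.unop x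

end BimodHom

theorem smul_rsmul {A E : Type*} [Ring A] [Algebra ℂ A] [AddCommGroup E] [Module ℂ E] [Module A E]
    [Module Aᵐᵒᵖ E] [IsBimodule A E] (a b : A) (x : E) : a • (x <• b) = (a • x) <• b :=
  (IsBimodule.assoc a b x).symm

theorem rsmul_rsmul {A E : Type*} [Ring A] [AddCommGroup E] [Module Aᵐᵒᵖ E] (a b : A) (x : E) :
    (x <• a) <• b = x <• (a * b) := by rw [MulOpposite.op_mul, mul_smul]

theorem rsmul_add {A E : Type*} [Ring A] [AddCommGroup E] [Module Aᵐᵒᵖ E] (a b : A) (x : E) :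
    x <• (a + b) = x <• a + x <• b := by rw [MulOpposite.op_add, add_smul]

theorem rsmul_sub {A E : Type*} [Ring A] [AddCommGroup E] [Module Aᵐᵒᵖ E] (a b : A) (x : E) :
    x <• (a - b) = x <• a - x <• b := by rw [MulOpposite.op_sub, sub_smul]

theorem rsmul_one {A E : Type*} [Ring A] [AddCommGroup E] [Module Aᵐᵒᵖ E] (x : E) :
    x <• (1 : A) = x := by rw [MulOpposite.op_one, one_smul]

theorem rsmul_zero {A E : Type*} [Ring A] [AddCommGroup E] [Module Aᵐᵒᵖ E] (x : E) :
    x <• (0 : A) = 0 := by rw [MulOpposite.op_zero, zero_smul]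

theorem zetaAt_tmul {A E X : Type*} [Ring A] [Algebra ℂ A]
    [AddCommGroup E] [Module ℂ E] [Module A E] [Module Aᵐᵒᵖ E] [IsBimodule A E]
    [AddCommGroup X] [Module ℂ X] [Module A X] [Module Aᵐᵒᵖ X] [IsBimodule A X]
    (e : E) (x : X) (φ : RDual A E) : zetaAt e (tmul A x φ) = x <• φ e := lift_tmul _ _ _ _

theorem contractLast_tmul {A E : Type*} [Ring A] [Algebra ℂ A]
    [AddCommGroup E] [Module ℂ E] [Module A E] [Module Aᵐᵒᵖ E] [IsBimodule A E]
    (τ : BTensor A E (RDual A E) →ₗ[ℂ] A)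
    (hτ : ∀ (a : A) z, τ (a • z) = a * τ z) (x y z : E) (φ : RDual A E) :
    contractLast τ hτ (tmul A (tmul A x (tmul A y z)) φ) =
      tmul A x (y <• τ (tmul A z φ)) := by
  simp [contractLast, lTensorAux, contractInner]

theorem metricId_tmul {A E : Type*} [Ring A] [Algebra ℂ A]
    [AddCommGroup E] [Module ℂ E] [Module A E] [Module Aᵐᵒᵖ E] [IsBimodule A E]
    (g : BTensor A E E →ₗ[Aᵐᵒᵖ] A) (x y z : E) :
    metricId g (tmul A x (tmul A y z)) = g (tmul A x y) • z := by
  simp [metricId]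

/-- Evaluation after $V_g\otimes\mathrm{id}$ is $g$ itself, so the scalar curvature is
$g(\mathrm{Ric})$. -/
theorem scalarCurvature_tmul {A E : Type*} [Ring A] [Algebra ℂ A]
    [AddCommGroup E] [Module ℂ E] [Module A E] [Module Aᵐᵒᵖ E] [IsBimodule A E]
    (g : BTensor A E E →ₗ[Aᵐᵒᵖ] A) (z : BTensor A E E) : scalarCurvature g z = g z := by
  induction z using BTensor.induction with
  | h0 => rw [map_zero]; exact map_zero (lift _ _)
  | ht x y => exact lift_tmul _ _ _ _
  | ha v w hv hw => rw [map_add, ← hv, ← hw]; exact map_add (lift _ _) v w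

/-! ### Leibniz rules and the curvature operator of an abstract calculus. -/

namespace Calculus

variable {A B : Type*} [Ring A] [Algebra ℂ A] [Ring B] [Algebra ℂ B] {C : Calculus A B}

theorem d_mul (a b : A) : C.d (a * b) = C.d a <• b + a • C.d b :=
  OneForm.ext (C.leibniz a b)

theorem d_one : C.d 1 = 0 := by
  have h := d_mul (C := C) 1 1
  rw [rsmul_one, one_smul, one_mul] at h
  simpa using h

theorem oneForm_induction {p : C.OneForm → Prop} (ω : C.OneForm) (h0 : p 0)
    (hd : ∀ a b : A, p (a • C.d b)) (ha : ∀ ω η, p ω → p η → p (ω + η)) : p ω := by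
  obtain ⟨x, hx⟩ := ω
  change p (OneForm.mk x hx)
  obtain ⟨t, rfl⟩ := hx
  induction t using TensorProduct.induction_on with
  | zero =>
    have e : OneForm.mk (C.formMap 0) ⟨0, rfl⟩ = (0 : C.OneForm) :=
      OneForm.ext (map_zero C.formMap)
    rw [e]; exact h0
  | tmul a b =>
    have e : OneForm.mk (C.formMap (a ⊗ₜ b)) ⟨_, rfl⟩ = a • C.d b :=
      OneForm.ext (by change C.formMap (a ⊗ₜ b) = C.π a * C.δ b; simp [formMap])
    rw [e]; exact hd a b
  | add s t hs ht =>
    have e : OneForm.mk (C.formMap (s + t)) ⟨_, rfl⟩ =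
        OneForm.mk (C.formMap s) ⟨_, rfl⟩ + (OneForm.mk (C.formMap t) ⟨_, rfl⟩ : C.OneForm) :=
      OneForm.ext (map_add C.formMap s t)
    rw [e]; exact ha _ _ hs ht

/-- Exhibits $d$ of a one-form as a value of $m$; this is where the antisymmetrizer $q$ is known
explicitly. -/
theorem d₁_smul_d_eq_m (a b : A) : C.d₁ (a • C.d b) = C.m (tmul A (C.d a) (C.d b)) :=
  by
  rw [d₁_smul_d, m, lift_tmul]; rfl

/-- Since $\ker m=\ker(1-\sigma)$, the map $1-\sigma$ factors through the range of $m$. -/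
theorem exists_antisymmetrizer {σ : BimodHom A C.E2 C.E2} (hσ : IsFlip σ) :
    ∃ q : C.TwoForm →ₗ[ℂ] C.E2, ∀ z, q (C.m z) = z - σ z := by
  have hk : LinearMap.ker C.m ≤ LinearMap.ker σ.idSub.toLinearMap := fun z hz => by
    rw [LinearMap.mem_ker] at hz ⊢
    change z - σ z = 0
    rw [(hσ.ker_m z).1 hz, sub_self]
  let f : LinearMap.range C.m →ₗ[ℂ] C.E2 :=
    (LinearMap.ker C.m).liftQ σ.idSub.toLinearMap hk ∘ₗ C.m.quotKerEquivRange.symm.toLinearMap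
  -- An arbitrary linear extension suffices: surjectivity of $m$ is not needed, because $q$ is only
  -- ever evaluated on the range of $m$.
  obtain ⟨q, hq⟩ := LinearMap.exists_extend f
  refine ⟨q, fun z => ?_⟩
  have h := LinearMap.congr_fun hq ⟨C.m z, z, rfl⟩
  refine h.trans ?_
  have e : C.m.quotKerEquivRange.symm ⟨C.m z, z, rfl⟩ = (LinearMap.ker C.m).mkQ z :=
    (LinearEquiv.symm_apply_eq _).2 rfl
  refine (congrArg ((LinearMap.ker C.m).liftQ σ.idSub.toLinearMap hk) e).trans ?_
  exact Submodule.liftQ_apply _ _ _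

/-! ### Well-definedness and right linearity of the curvature operator. -/

section Curvature

variable {σ : BimodHom A C.E2 C.E2} {q : C.TwoForm →ₗ[ℂ] C.E2} (hq : ∀ z, q (C.m z) = z - σ z)
include hq

/-- The graded Leibniz rule read through $q$. Two-forms carry no module structure here, so the rule
is expressed in $E\otimes_A E$, where both actions are available. -/
theorem antisymmetrizer_d₁_rsmul (η : C.OneForm) (a : A) :
    q (C.d₁ (η <• a)) = q (C.d₁ η) <• a - σ.idSub (tmul A η (C.d a)) := by
  induction η using oneForm_induction with
  | h0 => simp [zero_tmul, BimodHom.apply_zero]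
  | hd x y =>
    -- Brings $(x\,dy)a$ back to a combination of terms $b\,dc$, on which $d$ is computable.
    have e : (x • C.d y) <• a = x • C.d (y * a) - (x * y) • C.d a := by
      rw [d_mul, smul_add, ← mul_smul, add_sub_cancel_right]; exact IsBimodule.assoc _ _ _
    rw [e, map_sub, map_sub, d₁_smul_d_eq_m, d₁_smul_d_eq_m, d₁_smul_d_eq_m, hq, hq, hq,
      ← σ.idSub_apply, ← σ.idSub_apply, ← σ.idSub_apply, d_mul, d_mul, tmul_add, add_tmul,
      balance, ← lact_tmul, ← ract_tmul, σ.idSub.apply_add, σ.idSub.apply_add,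
      σ.idSub.apply_rsmul]
    abel
  | ha ω η hω hη =>
    rw [smul_add, map_add, map_add, map_add, map_add, hω, hη, smul_add, add_tmul,
      σ.idSub.apply_add]
    abel

theorem antisymmetrizer_d₁_lsmul (η : C.OneForm) (a : A) :
    q (C.d₁ (a • η)) = a • q (C.d₁ η) + σ.idSub (tmul A (C.d a) η) := by
  induction η using oneForm_induction with
  | h0 => simp [tmul_zero, BimodHom.apply_zero]
  | hd x y =>
    rw [← mul_smul, d₁_smul_d_eq_m, d₁_smul_d_eq_m, hq, hq, ← σ.idSub_apply, ← σ.idSub_apply,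
      d_mul, add_tmul, balance, ← lact_tmul, σ.idSub.apply_add, σ.idSub.apply_lsmul, add_comm]
  | ha ω η hω hη =>
    rw [smul_add, map_add, map_add, map_add, map_add, hω, hη, smul_add, tmul_add,
      σ.idSub.apply_add]
    abel

theorem antisymmetrizer_d₁_d (a : A) : q (C.d₁ (C.d a)) = 0 := by
  have h := d₁_smul_d_eq_m (C := C) 1 a
  rw [one_smul, d_one, zero_tmul, map_zero] at h
  rw [h, map_zero]

/-- Neither summand of $H$ is balanced over $A$, but their defects cancel. -/
theorem Connection.exists_curvatureMap (D : C.Connection) :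
    ∃ H : C.E2 →ₗ[ℂ] C.E3, ∀ ω η, H (tmul A ω η) =
      lTensor C.OneForm σ.idSub (BTensor.assoc (tmul A (D.toMap ω) η)) +
        tmul A ω (q (C.d₁ η)) := by
  refine ⟨lift (LinearMap.mk₂ ℂ (fun ω η =>
      lTensor C.OneForm σ.idSub (BTensor.assoc (tmul A (D.toMap ω) η)) +
        tmul A ω (q (C.d₁ η)))
      (fun ω ω' η => ?_) (fun c ω η => ?_) (fun ω η η' => ?_) (fun c ω η => ?_)) ?_,
      fun ω η => lift_tmul _ _ _ _⟩
  · rw [map_add, add_tmul, add_tmul, map_add, lTensor_add]; abel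
  · rw [map_smul, smul_tmul, smul_tmul, map_smul, BimodHom.apply_smul, smul_add]
  · rw [map_add, map_add, tmul_add, tmul_add, map_add, lTensor_add]; abel
  · rw [map_smul, map_smul, tmul_smul, tmul_smul, map_smul, BimodHom.apply_smul, smul_add]
  -- Moving $a$ across the tensor produces $\omega\otimes(1-\sigma)(da\otimes\eta)$ once from the
  -- Leibniz rule of the connection and once from $q(d(a\eta))$.
  · intro ω a η
    simp only [LinearMap.mk₂_apply]
    rw [D.leibniz, add_tmul, map_add, lTensor_add, antisymmetrizer_d₁_lsmul hq, tmul_add,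
      balance, balance, assoc_tmul, lTensor_tmul]
    abel

/-- Right linearity of $R(\nabla)$ is what allows it to come from an element of
$E^{\otimes3}\otimes_A E^*$ through $\zeta$. -/
theorem Connection.curvature_rsmul {D : C.Connection} {H : C.E2 →ₗ[ℂ] C.E3}
    (hH : ∀ ω η, H (tmul A ω η) =
      lTensor C.OneForm σ.idSub (BTensor.assoc (tmul A (D.toMap ω) η)) +
        tmul A ω (q (C.d₁ η))) (ω : C.OneForm) (a : A) :
    H (D.toMap (ω <• a)) = H (D.toMap ω) <• a := by
  -- $H$ alone fails to be right linear. At $z=\nabla\omega$ the defect is cancelled by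
  -- $H(\omega\otimes da)$, because $q(d(da))=0$.
  have h : ∀ z : C.E2, H (z <• a) = H z <• a -
      lTensor C.OneForm σ.idSub (BTensor.assoc (tmul A z (C.d a))) := fun z => by
    induction z using BTensor.induction with
    | h0 => simp [zero_tmul, BimodHom.apply_zero]
    | ht ω η =>
      rw [ract_tmul, hH, hH, antisymmetrizer_d₁_rsmul hq, assoc_tmul, lTensor_tmul, tmul_sub,
        assoc_ract, BimodHom.apply_rsmul, smul_add, ract_tmul]
      abel
    | ha z w hz hw =>
      rw [smul_add, map_add, map_add, hz, hw, smul_add, add_tmul, map_add, lTensor_add]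
      abel
  rw [D.leibniz, map_add, h, hH, antisymmetrizer_d₁_d hq, tmul_zero]
  abel

end Curvature

end Calculus

/-! ### Coordinates in a central frame, the flip and the metric. -/

namespace Calculus
open BTensor

variable {A B : Type*} [Ring A] [Algebra ℂ A] [Ring B] [Algebra ℂ B]

/-- A central basis `e₀, e₁` of the bimodule of one-forms of a two-dimensional calculus, with
dual coordinates, for which `e₀ e₁ = -e₁ e₀` generates the two-forms, `d e_j = 0`, and the
derivations `∂_j = coord_j ∘ d` commute. -/
structure Frame (C : Calculus A B) where
  e : Fin 2 → C.OneForm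
  central : ∀ j, IsCentral A (e j)
  coord : Fin 2 → BimodHom A C.OneForm A
  coord_e : ∀ j l, coord j (e l) = if l = j then 1 else 0
  expand : ∀ ω, ω = ∑ j, e j <• coord j ω
  m_eq_zero : ∀ a : Fin 2 → Fin 2 → A,
    C.m (∑ p, ∑ q, tmul A (e p) (e q) <• a p q) = 0 ↔ a 0 1 = a 1 0
  d₁_rsmul : ∀ j a, C.d₁ (e j <• a) = -C.m (tmul A (e j) (C.d a))
  coord_d_comm : ∀ i j a, coord i (C.d (coord j (C.d a))) = coord j (C.d (coord i (C.d a)))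

namespace Frame

variable {C : Calculus A B} (F : Frame C)

/-- The derivation `∂_j = coord_j ∘ d`. -/
def deriv (j : Fin 2) (a : A) : A := F.coord j (C.d a)

theorem deriv_add (j : Fin 2) (a b : A) : F.deriv j (a + b) = F.deriv j a + F.deriv j b := by
  rw [deriv, map_add, BimodHom.apply_add]; rfl

theorem deriv_neg (j : Fin 2) (a : A) : F.deriv j (-a) = -F.deriv j a := by
  rw [deriv, map_neg, BimodHom.apply_neg]; rfl

theorem deriv_smul (j : Fin 2) (c : ℂ) (a : A) : F.deriv j (c • a) = c • F.deriv j a := by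
  rw [deriv, map_smul, BimodHom.apply_smul]; rfl

theorem deriv_mul (j : Fin 2) (a b : A) :
    F.deriv j (a * b) = F.deriv j a * b + a * F.deriv j b := by
  rw [deriv, d_mul, BimodHom.apply_add, BimodHom.apply_lsmul, BimodHom.apply_rsmul]; rfl

theorem d_eq (a : A) : C.d a = ∑ j, F.e j <• F.deriv j a := F.expand _

theorem coord_ext {ω η : C.OneForm} (h : ∀ j, F.coord j ω = F.coord j η) : ω = η := by
  rw [F.expand ω, F.expand η]; simp only [h]

theorem coord_sum (x : Fin 2 → A) (j : Fin 2) : F.coord j (∑ l, F.e l <• x l) = x j := by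
  rw [BimodHom.apply_sum]
  simp only [BimodHom.apply_rsmul, F.coord_e]
  fin_cases j <;> simp

/-- Central forms have central coordinates. Identities postulated only on central forms thus reduce
to the frame with central coefficients. -/
theorem commute_coord {ω : C.OneForm} (hω : IsCentral A ω) (j : Fin 2) (a : A) :
    a * F.coord j ω = F.coord j ω * a := by
  have h := congrArg (fun ω => F.coord j ω) (hω a)
  simp only [BimodHom.apply_lsmul, BimodHom.apply_rsmul] at h
  exact h

theorem rsmul_of_commute (F : Frame C) {z : A} (hz : ∀ a, a * z = z * a) (ω : C.OneForm) : ω <• z = z • ω :=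
  F.coord_ext fun j => by
    rw [BimodHom.apply_lsmul, BimodHom.apply_rsmul]; exact hz _

/-- The tensor `e_p ⊗ e_q`. -/
def b (p q : Fin 2) : C.E2 := tmul A (F.e p) (F.e q)

theorem b_central (p q : Fin 2) : IsCentral A (F.b p q) := fun a => by
  rw [b, lact_tmul, F.central, balance, F.central, ract_tmul]

/-- The coordinates on `E ⊗ E` as linear maps. -/
def coord₂Lin (p q : Fin 2) : C.E2 →ₗ[ℂ] A :=
  lift (LinearMap.mk₂ ℂ (fun x y => F.coord p x * F.coord q y)
    (fun x x' y => by rw [BimodHom.apply_add, add_mul])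
    (fun c x y => by rw [BimodHom.apply_smul, smul_mul_assoc])
    (fun x y y' => by rw [BimodHom.apply_add, mul_add])
    (fun c x y => by rw [BimodHom.apply_smul, mul_smul_comm]))
    (fun x a y => by
      simp only [LinearMap.mk₂_apply]
      rw [BimodHom.apply_lsmul, BimodHom.apply_rsmul]
      exact mul_assoc _ _ _)

theorem coord₂Lin_tmul (p q : Fin 2) (x y : C.OneForm) :
    F.coord₂Lin p q (tmul A x y) = F.coord p x * F.coord q y := by
  rw [coord₂Lin, lift_tmul, LinearMap.mk₂_apply]

/-- The coordinates on `E ⊗ E`. -/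
def coord₂ (p q : Fin 2) : BimodHom A C.E2 A where
  toLinearMap := F.coord₂Lin p q
  map_lsmul a z := by
    change F.coord₂Lin p q (a • z) = a • F.coord₂Lin p q z
    induction z using BTensor.induction with
    | h0 => simp
    | ht x y =>
      rw [lact_tmul, coord₂Lin_tmul, coord₂Lin_tmul,
        BimodHom.apply_lsmul]
      exact mul_assoc _ _ _
    | ha v w hv hw => rw [smul_add, map_add, map_add, hv, hw, smul_add]
  map_rsmul a z := by
    change F.coord₂Lin p q (z <• a) = F.coord₂Lin p q z <• a
    induction z using BTensor.induction with
    | h0 => simp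
    | ht x y =>
      rw [ract_tmul, coord₂Lin_tmul, coord₂Lin_tmul,
        BimodHom.apply_rsmul]
      exact (mul_assoc _ _ _).symm
    | ha v w hv hw => rw [smul_add, map_add, map_add, hv, hw, smul_add]

theorem coord₂_tmul (p q : Fin 2) (x y : C.OneForm) :
    F.coord₂ p q (tmul A x y) = F.coord p x * F.coord q y := F.coord₂Lin_tmul p q x y

theorem coord₂_b (p q r s : Fin 2) :
    F.coord₂ p q (F.b r s) = (if r = p then 1 else 0) * (if s = q then 1 else 0) := by
  rw [b, coord₂_tmul, F.coord_e, F.coord_e]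

theorem tmul_rsmul (p q : Fin 2) (a c : A) :
    tmul A (F.e p <• a) (F.e q <• c) = F.b p q <• (a * c) := by
  rw [balance, smul_rsmul, F.central, rsmul_rsmul, ← ract_tmul, b]

/-- Centrality of the frame collects all coefficients on the right; with `coord₂_sum` this makes the
$e_p\otimes e_q$ a right basis of $E\otimes_A E$. -/
theorem expand₂ (z : C.E2) : z = ∑ p, ∑ q, F.b p q <• F.coord₂ p q z := by
  induction z using BTensor.induction with
  | h0 => simp [BimodHom.apply_zero]
  | ht x y =>
    conv_lhs => rw [F.expand x, F.expand y]
    simp only [tmul_sum, sum_tmul, tmul_rsmul, coord₂_tmul]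
    exact Finset.sum_comm
  | ha v w hv hw =>
    simp only [BimodHom.apply_add, rsmul_add, Finset.sum_add_distrib]
    rw [← hv, ← hw]

theorem coord₂_sum (x : Fin 2 → Fin 2 → A) (p q : Fin 2) :
    F.coord₂ p q (∑ r, ∑ s, F.b r s <• x r s) = x p q := by
  simp only [BimodHom.apply_sum, BimodHom.apply_rsmul, F.coord₂_b]
  fin_cases p <;> fin_cases q <;> simp

theorem coord₂_ext {z w : C.E2} (h : ∀ p q, F.coord₂ p q z = F.coord₂ p q w) : z = w := by
  rw [F.expand₂ z, F.expand₂ w]; simp only [h]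

section Lift

variable {M : Type*} [AddCommGroup M] [Module ℂ M] [Module A M] [Module Aᵐᵒᵖ M] [IsBimodule A M]

/-- The bimodule map of `E ⊗ E` with given central values on the tensors `e_p ⊗ e_q`. -/
def lift₂ (t : Fin 2 → Fin 2 → M) (ht : ∀ p q, IsCentral A (t p q)) : BimodHom A C.E2 M where
  toFun z := ∑ p, ∑ q, t p q <• F.coord₂ p q z
  map_add' z w := by simp only [BimodHom.apply_add, rsmul_add, Finset.sum_add_distrib]
  map_smul' c z := by
    simp only [BimodHom.apply_smul, IsBimodule.scalar_right, Finset.smul_sum, RingHom.id_apply]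
  map_lsmul a z := by
    simp only [BimodHom.apply_lsmul, Finset.smul_sum]
    refine Finset.sum_congr rfl fun p _ => Finset.sum_congr rfl fun q _ => ?_
    rw [smul_rsmul, ht, rsmul_rsmul]; rfl
  map_rsmul a z := by
    simp only [BimodHom.apply_rsmul, Finset.smul_sum]
    refine Finset.sum_congr rfl fun p _ => Finset.sum_congr rfl fun q _ => ?_
    rw [rsmul_rsmul]; rfl

theorem lift₂_apply (t : Fin 2 → Fin 2 → M) (ht : ∀ p q, IsCentral A (t p q)) (z : C.E2) :
    F.lift₂ t ht z = ∑ p, ∑ q, t p q <• F.coord₂ p q z := rfl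

theorem right_ext {f g : C.E2 →ₗ[Aᵐᵒᵖ] M} (h : ∀ p q, f (F.b p q) = g (F.b p q)) : f = g := by
  ext z
  rw [F.expand₂ z]
  simp only [map_sum, map_smul, h]

end Lift

/-- The flip of `E ⊗ E`. -/
def flip : BimodHom A C.E2 C.E2 := F.lift₂ (fun p q => F.b q p) fun p q => F.b_central q p

theorem coord₂_flip (p q : Fin 2) (z : C.E2) : F.coord₂ p q (F.flip z) = F.coord₂ q p z := by
  rw [flip, lift₂_apply, Finset.sum_comm]
  exact F.coord₂_sum (fun r s => F.coord₂ s r z) p q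

theorem flip_b (p q : Fin 2) : F.flip (F.b p q) = F.b q p :=
  F.coord₂_ext fun r s => by
    rw [coord₂_flip, coord₂_b, coord₂_b]; split_ifs <;> simp

/-- The flip transposes coefficient arrays, so its fixed points are the symmetric ones, which are
the kernel of $m$ by `m_eq_zero`. On central forms the coordinates commute, which gives the exchange
rule. -/
theorem isFlip_flip : IsFlip F.flip where
  invol z := F.coord₂_ext fun p q => by rw [coord₂_flip, coord₂_flip]
  ker_m z := by
    have h := F.m_eq_zero fun p q => F.coord₂ p q z
    have h' := F.expand₂ z
    simp only [b] at h'
    rw [← h'] at h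
    rw [h]
    refine ⟨fun e => F.coord₂_ext fun p q => ?_, fun e => ?_⟩
    · rw [coord₂_flip]
      fin_cases p <;> fin_cases q
      · rfl
      · exact e.symm
      · exact e
      · rfl
    · conv_rhs => rw [← e, coord₂_flip]
  flip ω η hω _ := F.coord₂_ext fun p q => by
    rw [coord₂_flip, coord₂_tmul, coord₂_tmul, F.commute_coord hω]

/-- The exchange rule on the central frame determines a right linear map on the whole basis. -/
theorem flip_unique {σ : BimodHom A C.E2 C.E2} (hσ : IsFlip σ) : σ = F.flip := by
  have h : σ.toRight = F.flip.toRight := F.right_ext fun p q =>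
    (hσ.flip _ _ (F.central p) (F.central q)).trans (F.flip_b p q).symm
  exact BimodHom.ext (funext fun z => LinearMap.congr_fun h z)

theorem idSub_flip_b (p q : Fin 2) : F.flip.idSub (F.b p q) = F.b p q - F.b q p := by
  rw [BimodHom.idSub_apply, flip_b]

/-- The bimodule map with `g₀(e_p ⊗ e_q) = δ_pq`. -/
def metricHom : BimodHom A C.E2 A :=
  F.lift₂ (fun p q => if p = q then (1 : A) else 0) fun p q a => by split_ifs <;> simp

/-- The metric with `g₀(e_p ⊗ e_q) = δ_pq`. -/
def metric : C.E2 →ₗ[Aᵐᵒᵖ] A := F.metricHom.toRight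

theorem metric_apply (z : C.E2) : F.metric z = F.coord₂ 0 0 z + F.coord₂ 1 1 z := by
  change ∑ p : Fin 2, ∑ q : Fin 2, (if p = q then (1 : A) else 0) <• F.coord₂ p q z = _
  simp only [Fin.sum_univ_two]
  simp

theorem metric_b (p q : Fin 2) : F.metric (F.b p q) = if p = q then 1 else 0 := by
  rw [metric_apply, coord₂_b, coord₂_b]
  fin_cases p <;> fin_cases q <;> simp

theorem metric_lsmul (a : A) (z : C.E2) : F.metric (a • z) = a * F.metric z :=
  F.metricHom.apply_lsmul a z

/-- The functional $V_g(x)$ takes the value $k\,x_j$ at $e_j$. Invertibility of $k$ recovers the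
coordinates of $x$, and $\phi$ is attained at $\sum_j e_j\,k^{-1}\phi(e_j)$. -/
theorem isPseudoRiemannian_smul_metric (k : Aˣ) :
    IsPseudoRiemannian F.flip ((k : A) • F.metric) where
  symm z := by
    rw [LinearMap.smul_apply, LinearMap.smul_apply, metric_apply, metric_apply]
    simp only [coord₂_flip]
  nondegenerate := by
    have key : ∀ (x : C.OneForm) j, metricDual ((k : A) • F.metric) x (F.e j) =
        k * F.coord j x := fun x j => by
      change (k : A) * F.metric (tmul A x (F.e j)) = _
      rw [metric_apply, coord₂_tmul, coord₂_tmul, F.coord_e, F.coord_e]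
      fin_cases j <;> simp
    refine ⟨fun x y h => F.coord_ext fun j => ?_, fun φ => ?_⟩
    · have h' := LinearMap.congr_fun h (F.e j)
      rw [key, key] at h'
      exact k.isUnit.mul_left_cancel h'
    · refine ⟨∑ j, F.e j <• (((k⁻¹ : Aˣ) : A) * φ (F.e j)), LinearMap.ext fun y => ?_⟩
      conv_lhs => rw [F.expand y]
      conv_rhs => rw [F.expand y]
      rw [map_sum, map_sum]
      refine Finset.sum_congr rfl fun j _ => ?_
      rw [map_smul, map_smul, key, coord_sum, Units.mul_inv_cancel_left]

end Frame
end Calculus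

/-! ### Connections and torsion in coordinates. -/

namespace Calculus
open BTensor

variable {A B : Type*} [Ring A] [Algebra ℂ A] [Ring B] [Algebra ℂ B]

namespace Frame

variable {C : Calculus A B} (F : Frame C)

/-- The coefficients of a connection, `∇ e_j = ∑ e_p ⊗ e_q Γ j p q`. -/
def christoffel (D : C.Connection) (j p q : Fin 2) : A := F.coord₂ p q (D.toMap (F.e j))

theorem toMap_e (D : C.Connection) (j : Fin 2) :
    D.toMap (F.e j) = ∑ p, ∑ q, F.b p q <• F.christoffel D j p q := F.expand₂ _

/-- The Leibniz rule extends the values on the frame to all one-forms. Together with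
`christoffel_connection`, this identifies connections with arbitrary coefficient arrays. -/
theorem connection_ext {D D' : C.Connection}
    (h : ∀ j p q, F.christoffel D j p q = F.christoffel D' j p q) : D = D' := by
  refine Connection.ext (LinearMap.ext fun ω => ?_)
  rw [F.expand ω, map_sum, map_sum]
  refine Finset.sum_congr rfl fun j _ => ?_
  rw [D.leibniz, D'.leibniz, F.toMap_e, F.toMap_e]
  simp only [h]

/-- The map `∑ e_j x_j ↦ ∑ (∑ e_p ⊗ e_q Γ j p q) x_j + e_j ⊗ d x_j`. -/
def connectionMap (Γ : Fin 2 → Fin 2 → Fin 2 → A) : C.OneForm →ₗ[ℂ] C.E2 where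
  toFun ω := ∑ j, ((∑ p, ∑ q, F.b p q <• Γ j p q) <• F.coord j ω +
    tmul A (F.e j) (C.d (F.coord j ω)))
  map_add' ω η := by
    simp only [BimodHom.apply_add, rsmul_add, map_add, tmul_add, ← Finset.sum_add_distrib]
    refine Finset.sum_congr rfl fun j _ => ?_
    abel
  map_smul' c ω := by
    simp only [BimodHom.apply_smul, IsBimodule.scalar_right, map_smul, tmul_smul,
      Finset.smul_sum (r := c), smul_add, RingHom.id_apply]

theorem connectionMap_apply (Γ : Fin 2 → Fin 2 → Fin 2 → A) (ω : C.OneForm) :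
    F.connectionMap Γ ω = ∑ j, ((∑ p, ∑ q, F.b p q <• Γ j p q) <• F.coord j ω +
      tmul A (F.e j) (C.d (F.coord j ω))) := rfl

/-- The connection with given coefficients. -/
def connection (Γ : Fin 2 → Fin 2 → Fin 2 → A) : C.Connection where
  toMap := F.connectionMap Γ
  leibniz ω a := by
    rw [connectionMap_apply, connectionMap_apply]
    have h : tmul A ω (C.d a) = ∑ j, tmul A (F.e j <• F.coord j ω) (C.d a) := by
      rw [← sum_tmul, ← F.expand]
    rw [h, Finset.smul_sum, ← Finset.sum_add_distrib]
    refine Finset.sum_congr rfl fun j _ => ?_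
    rw [BimodHom.apply_rsmul, op_smul_eq_mul, d_mul, tmul_add, smul_add, rsmul_rsmul,
      ract_tmul, balance, add_assoc]

theorem christoffel_connection (Γ : Fin 2 → Fin 2 → Fin 2 → A) (j p q : Fin 2) :
    F.christoffel (F.connection Γ) j p q = Γ j p q := by
  have h : (F.connection Γ).toMap (F.e j) = ∑ p, ∑ q, F.b p q <• Γ j p q := by
    refine (F.connectionMap_apply Γ (F.e j)).trans ?_
    rw [Finset.sum_eq_single j]
    · rw [F.coord_e, if_pos rfl, d_one, tmul_zero, add_zero, rsmul_one]
    · intro l _ hl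
      rw [F.coord_e, if_neg (Ne.symm hl), map_zero, tmul_zero, add_zero, rsmul_zero]
    · simp
  rw [christoffel, h, coord₂_sum]

/-- On $e_j a$ the Leibniz term $m(e_j\otimes da)$ cancels $d(e_j a)$. The torsion is then $m$ of
the coefficients multiplied by $a$ on the right, so testing $a=1$ is enough. -/
theorem isTorsionFree_iff (D : C.Connection) :
    D.IsTorsionFree ↔ ∀ j, F.christoffel D j 0 1 = F.christoffel D j 1 0 := by
  have key : ∀ (j : Fin 2) (a : A), C.m (D.toMap (F.e j <• a)) + C.d₁ (F.e j <• a) =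
      C.m (∑ p, ∑ q, F.b p q <• (F.christoffel D j p q * a)) := fun j a => by
    rw [D.leibniz, map_add, F.d₁_rsmul, F.toMap_e, add_assoc, add_neg_cancel, add_zero]
    simp only [Finset.smul_sum, rsmul_rsmul]
  refine ⟨fun h j => ?_, fun h ω => ?_⟩
  · have := h (F.e j <• (1 : A))
    rw [key] at this
    simpa using (F.m_eq_zero _).1 this
  · rw [F.expand ω, map_sum, map_sum, map_sum, ← Finset.sum_add_distrib]
    refine Finset.sum_eq_zero fun j _ => ?_
    rw [key]
    exact (F.m_eq_zero _).2 (by rw [h])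

/-! ### Metric compatibility in coordinates. -/

section Compatibility

variable (D : C.Connection) (g : C.E2 →ₗ[Aᵐᵒᵖ] A)

/-- `z ⊗ y ↦ (g ⊗ id) σ₂₃ (z ⊗ y)`. -/
def contractFirst (z : C.E2) (y : C.OneForm) : C.OneForm :=
  metricId g (lTensor C.OneForm F.flip (BTensor.assoc (tmul A z y)))

theorem pi₀_eq (ω η : C.OneForm) : D.pi₀ F.flip g ω η =
    F.contractFirst g (D.toMap ω) η + F.contractFirst g (D.toMap η) ω := by
  rw [Connection.pi₀, map_add, lTensor_add, map_add]; rfl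

theorem contractFirst_add_left (z w : C.E2) (y : C.OneForm) :
    F.contractFirst g (z + w) y = F.contractFirst g z y + F.contractFirst g w y := by
  rw [contractFirst, add_tmul, map_add, lTensor_add, map_add]; rfl

theorem contractFirst_sum_left {ι : Type*} (s : Finset ι) (z : ι → C.E2) (y : C.OneForm) :
    F.contractFirst g (∑ i ∈ s, z i) y = ∑ i ∈ s, F.contractFirst g (z i) y := by
  rw [contractFirst, sum_tmul, map_sum, lTensor_sum, map_sum]; rfl

theorem contractFirst_sum_right {ι : Type*} (s : Finset ι) (z : C.E2) (y : ι → C.OneForm) :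
    F.contractFirst g z (∑ i ∈ s, y i) = ∑ i ∈ s, F.contractFirst g z (y i) := by
  rw [contractFirst, tmul_sum, map_sum, lTensor_sum, map_sum]; rfl

/-- The flip of the last two factors lets $g$ pair the first index of the connection with the added
form, leaving the form index $q$ free. -/
theorem contractFirst_tmul (p q l : Fin 2) (a c : A) :
    F.contractFirst g (tmul A (F.e p) (F.e q <• a)) (F.e l <• c) =
      g (F.b p l) • (F.e q <• (a * c)) := by
  rw [contractFirst, assoc_tmul, lTensor_tmul, tmul_rsmul, BimodHom.apply_rsmul, flip_b, b,
    ract_tmul, metricId_tmul]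
  rfl

theorem contractFirst_b (p q l : Fin 2) (a c : A) :
    F.contractFirst g (F.b p q <• a) (F.e l <• c) = g (F.b p l) • (F.e q <• (a * c)) := by
  rw [b, ract_tmul, contractFirst_tmul]

theorem contractFirst_tmul_d (p l : Fin 2) (a c : A) :
    F.contractFirst g (tmul A (F.e p) (C.d a)) (F.e l <• c) = g (F.b p l) • (C.d a <• c) := by
  rw [F.d_eq, tmul_sum, contractFirst_sum_left, Finset.smul_sum, Finset.smul_sum]
  simp only [contractFirst_tmul, rsmul_rsmul]

theorem contractFirst_rsmul (z : C.E2) (l : Fin 2) (a c : A) :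
    F.contractFirst g (z <• a) (F.e l <• c) =
      F.contractFirst g z (F.e l) <• (a * c) := by
  rw [F.expand₂ z, ← rsmul_one (A := A) (F.e l), rsmul_rsmul]
  simp only [Finset.smul_sum, rsmul_rsmul, contractFirst_sum_left, contractFirst_b]
  simp only [smul_rsmul, rsmul_rsmul, one_mul, mul_one, mul_assoc]

theorem coord_pi₀_e (k : A) (hg : ∀ p q, g (F.b p q) = if p = q then k else 0) (j l q : Fin 2) :
    F.coord q (D.pi₀ F.flip g (F.e j) (F.e l)) =
      k * (F.christoffel D j l q + F.christoffel D l j q) := by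
  rw [pi₀_eq, F.toMap_e, F.toMap_e, ← rsmul_one (A := A) (F.e l), ← rsmul_one (A := A) (F.e j)]
  simp only [contractFirst_sum_left, contractFirst_b, hg, mul_one]
  have h : ∀ (l : Fin 2) (x : Fin 2 → Fin 2 → A),
      F.coord q (∑ p, ∑ s, (if p = l then k else 0) • (F.e s <• x p s)) = k * x l q :=
    fun l x => by
      simp only [← Finset.smul_sum]
      rw [Finset.sum_eq_single l (fun p _ hp => by rw [if_neg hp, zero_smul]) (by simp),
        if_pos rfl, BimodHom.apply_lsmul, coord_sum, smul_eq_mul]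
  rw [BimodHom.apply_add, h, h, mul_add]

/-- On the frame, compatibility reads $k(\Gamma_{jlq}+\Gamma_{ljq})=\delta_{jl}\,\partial_q k$, from
which $k$ cancels on the left. The converse must extend this identity from the frame to all central
forms. -/
theorem isCompatible_iff (k : Aˣ) (hg : ∀ p q, g (F.b p q) = if p = q then (k : A) else 0) :
    D.IsCompatible F.flip g ↔ ∀ j l q, F.christoffel D j l q + F.christoffel D l j q =
      if j = l then ((k⁻¹ : Aˣ) : A) * F.deriv q k else 0 := by
  have key : (∀ j l, D.pi₀ F.flip g (F.e j) (F.e l) = C.d (g (F.b j l))) ↔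
      ∀ j l q, F.christoffel D j l q + F.christoffel D l j q =
        if j = l then ((k⁻¹ : Aˣ) : A) * F.deriv q k else 0 := by
    have h : ∀ j l q, F.coord q (C.d (g (F.b j l))) =
        k * if j = l then ((k⁻¹ : Aˣ) : A) * F.deriv q k else 0 := fun j l q => by
      rw [hg]
      split_ifs
      · rw [Units.mul_inv_cancel_left]; rfl
      · rw [map_zero, BimodHom.apply_zero, mul_zero]
    refine forall_congr' fun j => forall_congr' fun l => ⟨fun e q => ?_, fun e => ?_⟩
    · refine k.isUnit.mul_left_cancel ?_
      rw [← F.coord_pi₀_e D g k hg, e, h]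
    · refine F.coord_ext fun q => ?_
      rw [F.coord_pi₀_e D g k hg, e, h]
  rw [← key]
  constructor
  · rintro ⟨P, ⟨-, hP⟩, h⟩ j l
    rw [← hP _ _ (F.central j) (F.central l)]
    exact h _ _
  · intro h
    -- Compatibility forces $\Pi_g=d\circ g$, with right linear difference zero. What remains is
    -- agreement with $\Pi^0_g$ on central pairs.
    refine ⟨fun z => C.d (g z), ⟨⟨0, fun z => (sub_self _).symm⟩, fun ω η hω hη => ?_⟩,
      fun ω η => rfl⟩
    have hz : ∀ j x, x * F.coord j ω = F.coord j ω * x := fun j x => F.commute_coord hω j x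
    have hw : ∀ j x, x * F.coord j η = F.coord j η * x := fun j x => F.commute_coord hη j x
    -- Both sides expand by Leibniz. Since the coordinates $\omega_j$ are central,
    -- $\omega_j\,d\eta_l=d\eta_l\,\omega_j$, and so the derivative terms match; the rest is the
    -- frame identity.
    have e : ∀ j l, C.d (g (tmul A (F.e j <• F.coord j ω) (F.e l <• F.coord l η))) =
        F.contractFirst g (D.toMap (F.e j <• F.coord j ω)) (F.e l <• F.coord l η) +
        F.contractFirst g (D.toMap (F.e l <• F.coord l η)) (F.e j <• F.coord j ω) := fun j l => by
      have hs : g (F.b l j) = g (F.b j l) := by rw [hg, hg]; simp only [eq_comm]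
      rw [D.leibniz, D.leibniz, contractFirst_add_left, contractFirst_add_left,
        contractFirst_tmul_d, contractFirst_tmul_d, contractFirst_rsmul,
        contractFirst_rsmul, tmul_rsmul, map_smul, op_smul_eq_mul, d_mul, ← h,
        pi₀_eq, hs, d_mul, ← hw l (F.coord j ω), F.rsmul_of_commute (hz j), smul_add, smul_add]
      abel
    rw [pi₀_eq]
    conv_lhs => rw [F.expand ω, F.expand η]
    conv_rhs => rw [F.expand ω, F.expand η]
    simp only [map_sum, contractFirst_sum_left, contractFirst_sum_right, tmul_sum, sum_tmul,
      e, Finset.sum_add_distrib]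
    exact congrArg _ Finset.sum_comm

end Compatibility

/-! ### Curvature and Ricci tensor in coordinates. -/

section Ricci

/-- The right dual basis. -/
def dual (j : Fin 2) : RDual A C.OneForm := (F.coord j).toRight

theorem dual_e (j l : Fin 2) : F.dual j (F.e l) = if l = j then 1 else 0 := F.coord_e j l

/-- The tensor `e_r ⊗ e_s ⊗ e_q x`, additively in `x`. -/
def basis₃ (r s q : Fin 2) : A →+ C.E3 where
  toFun x := tmul A (F.e r) (F.b s q <• x)
  map_zero' := by rw [rsmul_zero, tmul_zero]
  map_add' x y := by rw [rsmul_add, tmul_add]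

theorem basis₃_apply (r s q : Fin 2) (x : A) : F.basis₃ r s q x = tmul A (F.e r) (F.b s q <• x) :=
  rfl

theorem assoc_b_rsmul (r s q : Fin 2) (x a : A) :
    BTensor.assoc (tmul A (F.b r s <• x) (F.e q <• a)) = F.basis₃ r s q (x * a) := by
  rw [b, ract_tmul, assoc_tmul, tmul_rsmul]; rfl

theorem lTensor_flip_basis₃ (r s q : Fin 2) (x : A) :
    lTensor C.OneForm F.flip (F.basis₃ r s q x) = F.basis₃ r q s x := by
  rw [basis₃_apply, lTensor_tmul, BimodHom.apply_rsmul, flip_b]; rfl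

theorem lTensor_idSub_basis₃ (r s q : Fin 2) (x : A) :
    lTensor C.OneForm F.flip.idSub (F.basis₃ r s q x) = F.basis₃ r s q x - F.basis₃ r q s x := by
  rw [basis₃_apply, lTensor_tmul, BimodHom.apply_rsmul, idSub_flip_b, smul_sub, tmul_sub]; rfl

theorem lTensor_scale (σ : BimodHom A C.E2 C.E2) (c : ℂ) (z : C.E3) :
    lTensor C.OneForm (σ.scale c) z = c • lTensor C.OneForm σ z := by
  induction z using BTensor.induction with
  | h0 => rw [BimodHom.apply_zero, BimodHom.apply_zero, smul_zero]
  | ht x y => rw [lTensor_tmul, lTensor_tmul, ← tmul_smul]; rfl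
  | ha v w hv hw => rw [lTensor_add, lTensor_add, hv, hw, smul_add]

/-- The coefficients of the curvature before antisymmetrization:
`R(e_j) = ∑ e_r ⊗ (e_s ⊗ e_q - e_q ⊗ e_s) W j r s q`. -/
def curvatureCoeff (D : C.Connection) (j r s q : Fin 2) : A :=
  ∑ p, F.christoffel D p r s * F.christoffel D j p q - F.deriv q (F.christoffel D j r s)

/-- The product $\Gamma\Gamma$ comes from differentiating the first factor of $\nabla e_j$, and
$-\partial\Gamma$ from $d$ of the second. -/
theorem curvature_e {D : C.Connection} {R : C.OneForm →ₗ[ℂ] C.E3} (hR : D.IsCurvature F.flip R)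
    (j : Fin 2) : R (F.e j) = ∑ r, ∑ s, ∑ q, (F.basis₃ r s q (F.curvatureCoeff D j r s q) -
      F.basis₃ r q s (F.curvatureCoeff D j r s q)) := by
  obtain ⟨Q, H, hQ, hH, hR⟩ := hR
  -- The formula for $d(e_q a)$ places the argument of $q$ in the range of $m$, so the result does
  -- not depend on how $q$ was extended.
  have h1 : ∀ p q a, H (F.b p q <• a) =
      ∑ r, ∑ s, (F.basis₃ r s q (F.christoffel D p r s * a) -
        F.basis₃ r q s (F.christoffel D p r s * a)) -
      ∑ s, (F.basis₃ p q s (F.deriv s a) - F.basis₃ p s q (F.deriv s a)) := fun p q a => by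
    rw [b, ract_tmul, hH, F.toMap_e, F.d₁_rsmul, map_neg, hQ, ← BimodHom.idSub_apply, F.d_eq]
    simp only [sum_tmul, map_sum, assoc_b_rsmul, lTensor_idSub_basis₃, tmul_sum,
      BimodHom.apply_sum, tmul_neg, ← sub_eq_add_neg]
    congr 1
    refine Finset.sum_congr rfl fun s _ => ?_
    rw [← ract_tmul, BimodHom.apply_rsmul]
    change tmul A (F.e p) (F.flip.idSub (F.b q s) <• _) = _
    rw [idSub_flip_b, smul_sub, tmul_sub]
    rfl
  rw [hR, F.toMap_e]
  simp only [h1, curvatureCoeff, map_sub, Fin.sum_univ_two, map_add]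
  abel

/-- The coefficients of the Ricci curvature. -/
def ricciCoeff (D : C.Connection) (r s : Fin 2) : A :=
  ∑ j, (F.curvatureCoeff D j r j s - F.curvatureCoeff D j r s j)

/-- Injectivity of $\zeta$: a tensor is recovered from its values on the frame, because the
coordinate functionals generate $E^*$ on the left. -/
theorem eq_sum_zetaAt (Θ : BTensor A C.E3 (RDual A C.OneForm)) :
    Θ = ∑ j, tmul A (zetaAt (F.e j) Θ) (F.dual j) := by
  induction Θ using BTensor.induction with
  | h0 => simp [zero_tmul]
  | ht x φ =>
    have h : φ = ∑ j, φ (F.e j) • F.dual j := LinearMap.ext fun y => by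
      conv_lhs => rw [F.expand y]
      rw [map_sum, LinearMap.sum_apply]
      refine Finset.sum_congr rfl fun j _ => ?_
      rw [map_smul]
      rfl
    conv_lhs => rw [h]
    rw [tmul_sum]
    refine Finset.sum_congr rfl fun j _ => ?_
    rw [zetaAt_tmul, balance]
  | ha v w hv hw =>
    simp only [map_add, add_tmul, Finset.sum_add_distrib]
    rw [← hv, ← hw]

/-- Left linearity and the normalization on central forms determine $\tau$ here: the coefficient
passes to the left of the central $e_q$ and leaves $\tau$. -/
theorem contractLast_basis₃ {τ : BTensor A C.OneForm (RDual A C.OneForm) →ₗ[ℂ] A}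
    (hτ : ∀ (a : A) z, τ (a • z) = a * τ z)
    (hc : ∀ (e : C.OneForm) (φ : RDual A C.OneForm), IsCentral A e → τ (tmul A e φ) = φ e)
    (r s q j : Fin 2) (x : A) :
    contractLast τ hτ (tmul A (F.basis₃ r s q x) (F.dual j)) =
      F.b r s <• (if q = j then x else 0) := by
  rw [basis₃_apply, b, ract_tmul, contractLast_tmul, ← F.central q, ← lact_tmul, hτ,
    hc _ _ (F.central q), dual_e, mul_ite, mul_one, mul_zero, b, ract_tmul]

/-- Every admissible choice of $R$, $\Theta_0$ and $\tau$ leads to the same coefficients, which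
gives uniqueness of the Ricci tensor. -/
theorem ricci_eq {D : C.Connection} {Ric : C.E2} (h : D.IsRicci F.flip Ric) :
    Ric = ∑ r, ∑ s, F.b r s <• F.ricciCoeff D r s := by
  obtain ⟨R, Θ, τ, hτ, hR, hΘ, hc, rfl⟩ := h
  rw [F.eq_sum_zetaAt Θ]
  simp only [hΘ, lTensor_scale, F.curvature_e hR, lTensor_sum, lTensor_sub, lTensor_idSub_basis₃,
    map_sum, rTensor_tmul, BimodHom.apply_smul, lTensor_flip_basis₃]
  -- $R(e_j)$ is already antisymmetric in its last two factors: $1-\sigma$ doubles it, and the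
  -- factor $1/2$ undoes this. Only the sign from $\sigma_{23}$ remains before contraction.
  have e : ∀ j r s q x,
      contractLast τ hτ (tmul A ((1 / 2 : ℂ) • (F.basis₃ r q s x - F.basis₃ r s q x -
        (F.basis₃ r s q x - F.basis₃ r q s x))) (F.dual j)) =
      F.b r q <• (if s = j then x else 0) - F.b r s <• (if q = j then x else 0) :=
    fun j r s q x => by
      have : (1 / 2 : ℂ) • (F.basis₃ r q s x - F.basis₃ r s q x -
          (F.basis₃ r s q x - F.basis₃ r q s x)) = F.basis₃ r q s x - F.basis₃ r s q x := by
        module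
      rw [this, sub_tmul, map_sub, F.contractLast_basis₃ hτ hc, F.contractLast_basis₃ hτ hc]
  simp only [Finset.smul_sum, sum_tmul, map_sum, e]
  simp only [Fin.sum_univ_two, ricciCoeff, rsmul_add, rsmul_sub]
  simp
  abel

/-- The evaluation `τ : E ⊗ E* → A`. -/
def evalDual : BTensor A C.OneForm (RDual A C.OneForm) →ₗ[ℂ] A :=
  lift (LinearMap.mk₂ ℂ (fun x (φ : RDual A C.OneForm) => ∑ j, F.coord j x * φ (F.e j))
    (fun x x' φ => by simp only [BimodHom.apply_add, add_mul, Finset.sum_add_distrib])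
    (fun c x φ => by simp only [BimodHom.apply_smul, smul_mul_assoc, Finset.smul_sum])
    (fun x φ ψ => by simp only [LinearMap.add_apply, mul_add, Finset.sum_add_distrib])
    (fun c x φ => by simp only [LinearMap.smul_apply, mul_smul_comm, Finset.smul_sum]))
    (fun x a φ => by
      simp only [LinearMap.mk₂_apply, BimodHom.apply_rsmul, LinearMap.smul_apply, smul_eq_mul,
        op_smul_eq_mul, mul_assoc])

theorem evalDual_tmul (x : C.OneForm) (φ : RDual A C.OneForm) :
    F.evalDual (tmul A x φ) = ∑ j, F.coord j x * φ (F.e j) := by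
  rw [evalDual, lift_tmul, LinearMap.mk₂_apply]

theorem evalDual_lsmul (a : A) (z : BTensor A C.OneForm (RDual A C.OneForm)) :
    F.evalDual (a • z) = a * F.evalDual z := by
  induction z using BTensor.induction with
  | h0 => simp
  | ht x φ =>
    rw [lact_tmul, evalDual_tmul, evalDual_tmul, Finset.mul_sum]
    simp only [BimodHom.apply_lsmul, smul_eq_mul, mul_assoc]
  | ha v w hv hw => rw [smul_add, map_add, map_add, hv, hw, mul_add]

/-- By right linearity of $R$, the preimage under $\zeta$ is $\sum_j\frac{1-\sigma}{2}R(e_j)\otimes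
e_j^*$, with $1-\sigma$ acting on the last two factors of $R(e_j)$. For central $x$, commuting
coordinates give $\tau(x\otimes\phi)=\phi(x)$. -/
theorem exists_isRicci (D : C.Connection) : ∃ Ric, D.IsRicci F.flip Ric := by
  obtain ⟨q, hq⟩ := exists_antisymmetrizer F.isFlip_flip
  obtain ⟨H, hH⟩ := D.exists_curvatureMap hq
  let N := lTensor C.OneForm (F.flip.idSub.scale (1 / 2))
  refine ⟨_, H ∘ₗ D.toMap, ∑ j, tmul A (N (H (D.toMap (F.e j)))) (F.dual j), F.evalDual,
    F.evalDual_lsmul, ⟨q, H, hq, hH, fun _ => rfl⟩, fun x => ?_, fun x φ hx => ?_, rfl⟩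
  · simp only [map_sum, zetaAt_tmul]
    change _ = N (H (D.toMap x))
    conv_rhs => rw [F.expand x]
    simp only [map_sum, BimodHom.apply_sum, Connection.curvature_rsmul hq hH, BimodHom.apply_rsmul]
    rfl
  · rw [evalDual_tmul]
    conv_rhs => rw [F.expand x]
    simp only [map_sum, map_smul]
    exact Finset.sum_congr rfl fun j _ => (F.commute_coord hx j _).symm

end Ricci

end Frame
end Calculus

/-! ### The Levi-Civita connection of a conformal metric and its curvature. -/

namespace Calculus
open BTensor

variable {A B : Type*} [Ring A] [Algebra ℂ A] [Ring B] [Algebra ℂ B]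

namespace Frame

variable {C : Calculus A B} (F : Frame C)

theorem deriv_zero (j : Fin 2) : F.deriv j 0 = 0 := by
  rw [deriv, map_zero, BimodHom.apply_zero]

theorem deriv_sub (j : Fin 2) (a b : A) : F.deriv j (a - b) = F.deriv j a - F.deriv j b := by
  rw [sub_eq_add_neg, deriv_add, deriv_neg, ← sub_eq_add_neg]

theorem deriv_comm (i j : Fin 2) (a : A) : F.deriv i (F.deriv j a) = F.deriv j (F.deriv i a) :=
  F.coord_d_comm i j a

/-- The logarithmic derivative `k⁻¹ ∂_j k`. -/
def logDeriv (k : Aˣ) (j : Fin 2) : A := ((k⁻¹ : Aˣ) : A) * F.deriv j k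

/-- The coefficients of the Levi-Civita connection of `k g₀`. -/
def conformalChristoffel (k : Aˣ) (j l q : Fin 2) : A :=
  (1 / 2 : ℂ) • ((if j = l then F.logDeriv k q else 0) + (if j = q then F.logDeriv k l else 0) -
    (if l = q then F.logDeriv k j else 0))

theorem smul_metric_b (k : A) (p q : Fin 2) :
    (k • F.metric) (F.b p q) = if p = q then k else 0 := by
  rw [LinearMap.smul_apply, metric_b, smul_eq_mul, mul_ite, mul_one, mul_zero]

/-- The Koszul argument survives noncommutativity because both conditions are linear in the
coefficients. -/
theorem isLeviCivita_iff (D : C.Connection) (k : Aˣ) :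
    D.IsLeviCivita F.flip ((k : A) • F.metric) ↔
      ∀ j l q, F.christoffel D j l q = F.conformalChristoffel k j l q := by
  have hC := F.isCompatible_iff D ((k : A) • F.metric) k (F.smul_metric_b k)
  have hT := F.isTorsionFree_iff D
  constructor
  · rintro ⟨ht, hc⟩ j l q
    rw [hC] at hc
    rw [hT] at ht
    have s : ∀ j l q, F.christoffel D j l q = F.christoffel D j q l := fun j l q => by
      fin_cases l <;> fin_cases q
      · rfl
      · exact ht j
      · exact (ht j).symm
      · rfl
    have h1 := hc j l q
    have h2 := hc j q l
    have h3 := hc l q j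
    rw [conformalChristoffel]
    simp only [logDeriv]
    -- Adding compatibility for $(j,l,q)$ and $(j,q,l)$ and subtracting it for $(l,q,j)$ leaves
    -- $2\Gamma_{jlq}$ once symmetry in the last two indices is used.
    linear_combination (norm := module) (1 / 2 : ℂ) • h1 + (1 / 2 : ℂ) • h2 - (1 / 2 : ℂ) • h3 +
      (1 / 2 : ℂ) • s j l q - (1 / 2 : ℂ) • s l j q + (1 / 2 : ℂ) • s q l j
  · intro h
    refine ⟨hT.2 fun j => ?_, hC.2 fun j l q => ?_⟩
    · rw [h, h, conformalChristoffel, conformalChristoffel]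
      simp [add_comm]
    · rw [h, h, conformalChristoffel, conformalChristoffel]
      simp only [logDeriv, @eq_comm _ l j]
      module

/-- Put $A_0=\frac12(x_0-x_1J)$ and $A_1=\frac12(x_1+x_0J)=JA_0$, where the scalar matrix $J$ has
$J^2=-1$. Then $A_0A_1=JA_0^2=A_1A_0$, so all quadratic terms in the logarithmic derivatives cancel
without any commutation between $x_0$ and $x_1$. -/
theorem ricciCoeff_eq {D : C.Connection} {k : Aˣ}
    (h : ∀ j l q, F.christoffel D j l q = F.conformalChristoffel k j l q) :
    (F.ricciCoeff D 0 0 =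
        -(1 / 2 : ℂ) • (F.deriv 0 (F.logDeriv k 0) + F.deriv 1 (F.logDeriv k 1)) ∧
      F.ricciCoeff D 1 1 = F.ricciCoeff D 0 0) ∧
    (F.ricciCoeff D 0 1 =
        (1 / 2 : ℂ) • (F.deriv 0 (F.logDeriv k 1) - F.deriv 1 (F.logDeriv k 0)) ∧
      F.ricciCoeff D 1 0 = -F.ricciCoeff D 0 1) := by
  simp only [ricciCoeff, curvatureCoeff, Fin.sum_univ_two, h, conformalChristoffel, deriv_smul,
    deriv_add, deriv_sub, smul_mul_smul_comm]
  simp only [if_true, Fin.zero_eq_one_iff, Fin.one_eq_zero_iff, OfNat.ofNat_ne_one, if_false,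
    deriv_zero, add_zero, zero_add, sub_zero, zero_sub, sub_self, neg_mul,
    mul_neg, neg_neg]
  -- The cancellation is an identity in free noncommuting variables; the definition of the
  -- logarithmic derivatives plays no part.
  generalize F.logDeriv k 0 = x
  generalize F.logDeriv k 1 = y
  refine ⟨⟨?_, ?_⟩, ?_, ?_⟩ <;> noncomm_ring <;> module

theorem deriv_logDeriv (k : Aˣ) (i j : Fin 2) : F.deriv i (F.logDeriv k j) =
    F.deriv i ((k⁻¹ : Aˣ) : A) * F.deriv j k + ((k⁻¹ : Aˣ) : A) * F.deriv i (F.deriv j k) :=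
  F.deriv_mul _ _ _

/-- The connection with the coefficients of the Levi-Civita connection of `k g₀`. -/
def leviCivita (k : Aˣ) : C.Connection := F.connection (F.conformalChristoffel k)

theorem isLeviCivita_leviCivita (k : Aˣ) :
    (F.leviCivita k).IsLeviCivita F.flip ((k : A) • F.metric) :=
  (F.isLeviCivita_iff _ k).2 (F.christoffel_connection _)

theorem eq_leviCivita {k : Aˣ} {D : C.Connection}
    (h : D.IsLeviCivita F.flip ((k : A) • F.metric)) : D = F.leviCivita k :=
  F.connection_ext fun j p q => by
    rw [(F.isLeviCivita_iff D k).1 h, leviCivita, christoffel_connection]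

theorem eq_sum_iff {z : C.E2} {x : Fin 2 → Fin 2 → A} (h : z = ∑ p, ∑ q, F.b p q <• x p q)
    (r : Fin 2 → Fin 2 → A) : z = ∑ p, ∑ q, F.b p q <• r p q ↔ ∀ p q, r p q = x p q := by
  refine ⟨fun e p q => ?_, fun e => by simp only [h, e]⟩
  rw [← F.coord₂_sum r p q, ← F.coord₂_sum x p q, ← h, ← e]

/-- Expands $\partial_i(k^{-1}\partial_j k)$ by the product rule. In the off-diagonal coefficient
the second derivatives cancel because $\partial_0$ and $\partial_1$ commute. -/
theorem ricci_eq_iff {k : Aˣ} {Ric : C.E2} (h : (F.leviCivita k).IsRicci F.flip Ric)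
    (r : Fin 2 → Fin 2 → A) : Ric = ∑ p, ∑ q, F.b p q <• r p q ↔
      (r 0 0 = -(1 / 2 : ℂ) • (((k⁻¹ : Aˣ) : A) *
          (F.deriv 0 (F.deriv 0 k) + F.deriv 1 (F.deriv 1 k)) +
          F.deriv 0 ((k⁻¹ : Aˣ) : A) * F.deriv 0 k + F.deriv 1 ((k⁻¹ : Aˣ) : A) * F.deriv 1 k) ∧
        r 1 1 = r 0 0 ∧
        r 0 1 = (1 / 2 : ℂ) • (F.deriv 0 ((k⁻¹ : Aˣ) : A) * F.deriv 1 k -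
          F.deriv 1 ((k⁻¹ : Aˣ) : A) * F.deriv 0 k) ∧
        r 1 0 = -r 0 1) := by
  obtain ⟨⟨h00, h11⟩, h01, h10⟩ := F.ricciCoeff_eq (F.christoffel_connection
    (F.conformalChristoffel k))
  rw [F.eq_sum_iff (F.ricci_eq h) r]
  simp only [Fin.forall_fin_two, leviCivita, h11, h10]
  simp only [h00, h01, deriv_logDeriv, F.deriv_comm 1 0]
  have e0 : ∀ a b c d e : A, a + c * d + (b + c * e) = c * (d + e) + a + b := fun a b c d e => by
    noncomm_ring
  have e1 : ∀ a b c : A, a + c - (b + c) = a - b := fun a b c => by abel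
  rw [e0, e1]
  constructor
  · rintro ⟨⟨a, b⟩, c, d⟩
    exact ⟨a, d.trans a.symm, b, by rw [c, b]⟩
  · rintro ⟨a, b, c, d⟩
    exact ⟨⟨a, c⟩, d.trans (by rw [c]), b.trans a⟩

/-- The metric contracts Ricci to $k(\mathrm{Ric}_{00}+\mathrm{Ric}_{11})$. The equal diagonal terms
absorb the $1/2$, and $k$ cancels $k^{-1}$ only in front of the second derivatives. -/
theorem scalarCurvature_eq {k : Aˣ} {Ric : C.E2} (h : (F.leviCivita k).IsRicci F.flip Ric) :
    scalarCurvature ((k : A) • F.metric) Ric =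
      -(F.deriv 0 (F.deriv 0 k) + F.deriv 1 (F.deriv 1 k)) -
        (k : A) * (F.deriv 1 ((k⁻¹ : Aˣ) : A) * F.deriv 1 k +
          F.deriv 0 ((k⁻¹ : Aˣ) : A) * F.deriv 0 k) := by
  have e := F.expand₂ Ric
  obtain ⟨h00, h11, -⟩ := (F.ricci_eq_iff h fun p q => F.coord₂ p q Ric).1 e
  rw [scalarCurvature_tmul, LinearMap.smul_apply, metric_apply, h11, h00, smul_eq_mul]
  have e1 : ∀ x y z : A, (k : A) * (-(1 / 2 : ℂ) • (((k⁻¹ : Aˣ) : A) * x + y + z) +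
      -(1 / 2 : ℂ) • (((k⁻¹ : Aˣ) : A) * x + y + z)) = -x - k * (z + y) := fun x y z => by
    rw [← add_smul, mul_smul_comm, mul_add, mul_add, Units.mul_inv_cancel_left, mul_add]
    module
  exact e1 _ _ _

end Frame
end Calculus

open BTensor Calculus

/-! ### Matrix coefficients of operators on the GNS space. -/

section Coefficients

/-- Basis vectors are eigenvectors of $d_j$, so the commutator multiplies each matrix coefficient by
a difference of weights. Later arguments thereby avoid the domains of unbounded operators. -/
theorem IsCommutator.coefficient {j : Fin 2} {a b : TorusL2 →L[ℂ] TorusL2}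
    (h : IsCommutator (torusNumber j) a b) (n m : ℤ × ℤ) :
    b (lp.single 2 n 1) m = (torusWeight j m - torusWeight j n) * a (lp.single 2 n 1) m := by
  obtain ⟨hm, e⟩ := h ⟨lp.single 2 n 1, single_mem_domain j n 1⟩
  have e1 : torusNumber j ⟨lp.single 2 n 1, single_mem_domain j n 1⟩ =
      torusWeight j n • (lp.single 2 n 1 : TorusL2) := by
    ext k
    change torusWeight j k * lp.single (E := fun _ : ℤ × ℤ => ℂ) 2 n 1 k =
      torusWeight j n * lp.single (E := fun _ : ℤ × ℤ => ℂ) 2 n 1 k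
    by_cases hk : k = n
    · rw [hk]
    · simp [lp.single_apply, hk]
  have e2 : b (lp.single 2 n 1) =
      torusNumber j ⟨a (lp.single 2 n 1), hm⟩ - a (torusWeight j n • lp.single 2 n 1) := by
    rw [← e1]; exact e
  rw [e2, map_smul]
  change torusWeight j m * a (lp.single 2 n 1) m - torusWeight j n * a (lp.single 2 n 1) m = _
  ring

theorem TorusL2.op_ext {S T : TorusL2 →L[ℂ] TorusL2}
    (h : ∀ n m, S (lp.single 2 n 1) m = T (lp.single 2 n 1) m) : S = T := by
  refine ContinuousLinearMap.ext fun ξ => ?_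
  have hs := lp.hasSum_single (p := 2) (by norm_num) ξ
  refine (hs.mapL S).unique ?_
  convert hs.mapL T using 2 with n
  have e : (lp.single 2 n (ξ n) : TorusL2) = ξ n • lp.single 2 n 1 := by
    rw [← lp.single_smul, smul_eq_mul, mul_one]
  rw [e, map_smul, map_smul]
  congr 1
  exact lp.ext (funext fun m => h n m)

end Coefficients

/-! ### The Clifford matrices and the extraction of coefficients. -/

section Entries

/-- The matrix entries of an operator on `L² ⊕ L²`. -/
def entry (i j : Fin 2) : (TorusH →L[ℂ] TorusH) →ₗ[ℂ] (TorusL2 →L[ℂ] TorusL2) where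
  toFun T := ContinuousLinearMap.proj i ∘L
    (PiLp.continuousLinearEquiv 2 ℂ (fun _ : Fin 2 => TorusL2)).toContinuousLinearMap ∘L T ∘L
    (PiLp.continuousLinearEquiv 2 ℂ (fun _ : Fin 2 => TorusL2)).symm.toContinuousLinearMap ∘L
    ContinuousLinearMap.single ℂ (fun _ : Fin 2 => TorusL2) j
  map_add' _ _ := rfl
  map_smul' _ _ := rfl

theorem entry_apply (i j : Fin 2) (T : TorusH →L[ℂ] TorusH) (ξ : TorusL2) :
    entry i j T ξ = T (WithLp.toLp 2 (Pi.single j ξ)) i := rfl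

theorem entry_diagOp_mul (i j : Fin 2) (a : TorusL2 →L[ℂ] TorusL2) (T : TorusH →L[ℂ] TorusH) :
    entry i j (diagOp a * T) = a * entry i j T := rfl

theorem entry_mul_diagOp (i j : Fin 2) (a : TorusL2 →L[ℂ] TorusL2) (T : TorusH →L[ℂ] TorusH) :
    entry i j (T * diagOp a) = entry i j T * a := by
  ext1 ξ
  change T (diagOp a (WithLp.toLp 2 (Pi.single j ξ))) i = T (WithLp.toLp 2 (Pi.single j (a ξ))) i
  refine congrArg (fun η : TorusH => T η i) (PiLp.ext fun l => ?_)
  change a ((Pi.single j ξ : Fin 2 → TorusL2) l) = (Pi.single j (a ξ) : Fin 2 → TorusL2) l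
  by_cases hl : l = j
  · subst hl; simp
  · simp [hl]

theorem entry_spinOp (i j : Fin 2) (M : Matrix (Fin 2) (Fin 2) ℂ) :
    entry i j (spinOp M) = M i j • (1 : TorusL2 →L[ℂ] TorusL2) := by
  ext1 ξ
  rw [entry_apply, spinOp_apply]
  change M i 0 • (Pi.single j ξ : Fin 2 → TorusL2) 0 + M i 1 • (Pi.single j ξ : Fin 2 → TorusL2) 1 =
    M i j • ξ
  fin_cases j <;> simp

theorem entry_spinOp_mul_diagOp (i j : Fin 2) (M : Matrix (Fin 2) (Fin 2) ℂ)
    (a : TorusL2 →L[ℂ] TorusL2) : entry i j (spinOp M * diagOp a) = M i j • a := by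
  rw [entry_mul_diagOp, entry_spinOp, smul_mul_assoc, one_mul]

theorem spinOp_mul (M N : Matrix (Fin 2) (Fin 2) ℂ) : spinOp M * spinOp N = spinOp (M * N) :=
  TorusH.op_ext fun ξ i => by
    change spinOp M (spinOp N ξ) i = _
    simp only [spinOp_apply, Matrix.mul_apply, Fin.sum_univ_two]
    module

theorem spinOp_one : spinOp 1 = 1 :=
  TorusH.op_ext fun ξ i => by
    rw [spinOp_apply]
    change _ = ξ i
    obtain rfl | rfl : i = 0 ∨ i = 1 := by omega
    all_goals simp

theorem spinOp_neg (M : Matrix (Fin 2) (Fin 2) ℂ) : spinOp (-M) = -spinOp M :=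
  TorusH.op_ext fun ξ i => by
    change _ = -(spinOp M ξ i)
    simp only [spinOp_apply, Matrix.neg_apply]
    module

theorem gamma_sq (j : Fin 2) : spinOp (gammaMatrix j) * spinOp (gammaMatrix j) = 1 := by
  have h : gammaMatrix j * gammaMatrix j = 1 := by
    ext p q
    fin_cases j <;> fin_cases p <;> fin_cases q <;>
      simp [gammaMatrix, Matrix.mul_apply, Fin.sum_univ_two]
  rw [spinOp_mul, h, spinOp_one]

theorem gamma_anticomm : spinOp (gammaMatrix 1) * spinOp (gammaMatrix 0) =
    -(spinOp (gammaMatrix 0) * spinOp (gammaMatrix 1)) := by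
  have h : gammaMatrix 1 * gammaMatrix 0 = -(gammaMatrix 0 * gammaMatrix 1) := by
    ext p q
    fin_cases p <;> fin_cases q <;>
      simp [gammaMatrix, Matrix.mul_apply, Fin.sum_univ_two]
  rw [spinOp_mul, spinOp_mul, h, spinOp_neg]

/-- The coefficient of `γ_j` in an off-diagonal operator. -/
def gammaCoeff (j : Fin 2) : (TorusH →L[ℂ] TorusH) →ₗ[ℂ] (TorusL2 →L[ℂ] TorusL2) :=
  (1 / 2 : ℂ) • (gammaMatrix j 1 0 • entry 0 1 + gammaMatrix j 0 1 • entry 1 0)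

theorem gammaCoeff_apply (j : Fin 2) (T : TorusH →L[ℂ] TorusH) : gammaCoeff j T =
    (1 / 2 : ℂ) • (gammaMatrix j 1 0 • entry 0 1 T + gammaMatrix j 0 1 • entry 1 0 T) := rfl

/-- For these off-diagonal $\gamma_j$, `gammaCoeff` is the normalized trace
$\frac12\mathrm{tr}(\gamma_jT)$, and the matrices are orthonormal for it. -/
theorem gammaCoeff_gamma_mul_diagOp (j l : Fin 2) (a : TorusL2 →L[ℂ] TorusL2) :
    gammaCoeff j (spinOp (gammaMatrix l) * diagOp a) = if l = j then a else 0 := by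
  have h : (1 / 2 : ℂ) * (gammaMatrix j 1 0 * gammaMatrix l 0 1 +
      gammaMatrix j 0 1 * gammaMatrix l 1 0) = if l = j then 1 else 0 := by
    fin_cases j <;> fin_cases l <;> norm_num [gammaMatrix]
  rw [gammaCoeff_apply, entry_spinOp_mul_diagOp, entry_spinOp_mul_diagOp, smul_smul, smul_smul,
    ← add_smul, smul_smul, h]
  split_ifs <;> simp

/-- Half the difference of the diagonal entries: the coefficient of `γ_1 γ_2`, up to a scalar. -/
def diagDiff : (TorusH →L[ℂ] TorusH) →ₗ[ℂ] (TorusL2 →L[ℂ] TorusL2) :=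
  (-Complex.I / 2) • (entry 1 1 - entry 0 0)

theorem diagDiff_mul_diagOp (T : TorusH →L[ℂ] TorusH) (a : TorusL2 →L[ℂ] TorusL2) :
    diagDiff (T * diagOp a) = diagDiff T * a := by
  change (-Complex.I / 2) • (entry 1 1 _ - entry 0 0 _) =
    (-Complex.I / 2) • (entry 1 1 T - entry 0 0 T) * a
  rw [entry_mul_diagOp, entry_mul_diagOp, smul_mul_assoc, sub_mul]

/-- Here $\gamma_1\gamma_2=\mathrm{diag}(-i,i)$, so the difference of diagonal entries is $2i$ and
the factor $-i/2$ normalizes it. -/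
theorem diagDiff_gamma (a : TorusL2 →L[ℂ] TorusL2) : diagDiff (spinOp (gammaMatrix 0) *
    spinOp (gammaMatrix 1) * diagOp a) = a := by
  have h : (gammaMatrix 0 * gammaMatrix 1) 1 1 - (gammaMatrix 0 * gammaMatrix 1) 0 0 =
      2 * Complex.I := by
    simp [gammaMatrix, Matrix.mul_apply, Fin.sum_univ_two]; ring
  change (-Complex.I / 2) • (entry 1 1 _ - entry 0 0 _) = _
  rw [spinOp_mul, entry_spinOp_mul_diagOp, entry_spinOp_mul_diagOp, ← sub_smul, h, smul_smul]
  have : -Complex.I / 2 * (2 * Complex.I) = 1 := by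
    linear_combination -Complex.I_mul_I
  rw [this, one_smul]

theorem diagDiff_diagOp (a : TorusL2 →L[ℂ] TorusL2) : diagDiff (diagOp a) = 0 := by
  have h : diagOp a = spinOp 1 * diagOp a := by rw [spinOp_one, one_mul]
  change (-Complex.I / 2) • (entry 1 1 _ - entry 0 0 _) = _
  rw [h, entry_spinOp_mul_diagOp, entry_spinOp_mul_diagOp]
  simp

end Entries

theorem wshift_mul_star (v : ℤ × ℤ) (w : ℤ × ℤ → Circle) :
    ((wshift v w).toContinuousLinearEquiv : TorusL2 →L[ℂ] TorusL2) *
      star ((wshift v w).toContinuousLinearEquiv : TorusL2 →L[ℂ] TorusL2) = 1 := by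
  rw [ContinuousLinearMap.star_eq_adjoint]
  have h := LinearIsometryEquiv.adjoint_eq_symm (wshift v w)
  refine ContinuousLinearMap.ext fun ξ => ?_
  refine (congrArg (fun T : TorusL2 →L[ℂ] TorusL2 => wshift v w (T ξ)) h).trans ?_
  exact (wshift v w).apply_symm_apply ξ

/-! ### One-forms of the torus and their coordinates. -/

section Torus

variable {θ : ℝ} {A : StarSubalgebra ℂ (TorusL2 →L[ℂ] TorusL2)} (hA : IsSmoothTorusAlgebra θ A)

theorem torusPartial_coefficient (j : Fin 2) (a : A) (n m : ℤ × ℤ) :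
    (torusPartial hA j a : TorusL2 →L[ℂ] TorusL2) (lp.single 2 n 1) m =
      Complex.I * ((torusWeight j m - torusWeight j n) *
        (a : TorusL2 →L[ℂ] TorusL2) (lp.single 2 n 1) m) := by
  rw [← (hA.stable a j).choose_spec.coefficient n m]
  rfl

/-- Both derivations act on matrix coefficients by scalar multipliers, and these commute. -/
theorem torusPartial_comm (i j : Fin 2) (a : A) :
    torusPartial hA i (torusPartial hA j a) = torusPartial hA j (torusPartial hA i a) :=
  Subtype.ext (TorusL2.op_ext fun n m => by
    simp only [torusPartial_coefficient]
    ring)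

theorem torusCalculus_π (a : A) : (torusCalculus hA).π a = diagOp a := rfl

theorem gamma_mul_π (j : Fin 2) (a : A) : (torusCalculus hA).π a * spinOp (gammaMatrix j) =
    spinOp (gammaMatrix j) * (torusCalculus hA).π a := diagOp_commute _ _

theorem torusCalculus_δ_eq_sum (a : A) : (torusCalculus hA).δ a =
    ∑ j, spinOp (gammaMatrix j) * (torusCalculus hA).π (torusPartial hA j a) := by
  rw [torusCalculus_δ, Fin.sum_univ_two]; rfl

/-- Each $\gamma_j$ commutes with the diagonal action, so $a\,d(b)=\sum_j\gamma_j\,a\,\partial_j b$.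
In particular the coefficients lie in $A$, which makes the coordinate maps $A$-valued. -/
theorem exists_eq_gamma_sum {T : TorusH →L[ℂ] TorusH} (hT : T ∈ (torusCalculus hA).oneForms) :
    ∃ x : Fin 2 → A, T = ∑ j, spinOp (gammaMatrix j) * (torusCalculus hA).π (x j) := by
  obtain ⟨t, rfl⟩ := hT
  induction t using TensorProduct.induction_on with
  | zero => exact ⟨0, by simp⟩
  | tmul a b =>
    refine ⟨fun j => a * torusPartial hA j b, ?_⟩
    have h : (torusCalculus hA).formMap (a ⊗ₜ b) =
      (torusCalculus hA).π a * (torusCalculus hA).δ b := by simp [formMap]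
    rw [h, torusCalculus_δ_eq_sum, Finset.mul_sum]
    refine Finset.sum_congr rfl fun j _ => ?_
    rw [map_mul, ← mul_assoc, gamma_mul_π, mul_assoc]
  | add s t hs ht =>
    obtain ⟨x, hx⟩ := hs
    obtain ⟨y, hy⟩ := ht
    refine ⟨x + y, ?_⟩
    rw [map_add, hx, hy, ← Finset.sum_add_distrib]
    refine Finset.sum_congr rfl fun j _ => ?_
    rw [Pi.add_apply, map_add, mul_add]

theorem gammaCoeff_sum (x : Fin 2 → A) (j : Fin 2) :
    gammaCoeff j (∑ l, spinOp (gammaMatrix l) * (torusCalculus hA).π (x l)) = x j := by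
  rw [map_sum]
  simp only [torusCalculus_π, gammaCoeff_gamma_mul_diagOp]
  simp

theorem gammaCoeff_mem (j : Fin 2) (ω : (torusCalculus hA).OneForm) :
    gammaCoeff j ω.val ∈ A := by
  obtain ⟨x, hx⟩ := exists_eq_gamma_sum hA ω.val_mem
  rw [hx, gammaCoeff_sum]
  exact (x j).2

/-- The coordinates of one-forms in the basis `e_1, e_2`. -/
def torusCoord (j : Fin 2) : BimodHom A (torusCalculus hA).OneForm A where
  toFun ω := ⟨gammaCoeff j ω.val, gammaCoeff_mem hA j ω⟩
  map_add' ω η := Subtype.ext (map_add (gammaCoeff j) ω.val η.val)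
  map_smul' c ω := Subtype.ext (map_smul (gammaCoeff j) c ω.val)
  map_lsmul a ω := Subtype.ext (by
    change gammaCoeff j (diagOp a * ω.val) = a * gammaCoeff j ω.val
    rw [gammaCoeff_apply, gammaCoeff_apply, entry_diagOp_mul, entry_diagOp_mul, mul_smul_comm,
      mul_add, mul_smul_comm, mul_smul_comm])
  map_rsmul a ω := Subtype.ext (by
    change gammaCoeff j (ω.val * diagOp a) = gammaCoeff j ω.val * a
    rw [gammaCoeff_apply, gammaCoeff_apply, entry_mul_diagOp, entry_mul_diagOp, smul_mul_assoc,
      add_mul, smul_mul_assoc, smul_mul_assoc])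

theorem torusCoord_of_val_eq {ω : (torusCalculus hA).OneForm} {x : Fin 2 → A}
    (h : ω.val = ∑ l, spinOp (gammaMatrix l) * (torusCalculus hA).π (x l)) (j : Fin 2) :
    torusCoord hA j ω = x j :=
  Subtype.ext (by
    change gammaCoeff j ω.val = x j
    rw [h, gammaCoeff_sum])

theorem torusCoord_d (j : Fin 2) (a : A) :
    torusCoord hA j ((torusCalculus hA).d a) = torusPartial hA j a :=
  torusCoord_of_val_eq hA (ω := (torusCalculus hA).d a)
    (x := fun j => torusPartial hA j a) (torusCalculus_δ_eq_sum hA a) j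

end Torus

/-! ### Junk forms have no $\gamma_1\gamma_2$ component. -/

section Torus

variable {θ : ℝ} {A : StarSubalgebra ℂ (TorusL2 →L[ℂ] TorusL2)} (hA : IsSmoothTorusAlgebra θ A)

/-- The derivation `∂_j` as a linear map. -/
def torusDeriv (j : Fin 2) : A →ₗ[ℂ] A :=
  (torusCoord hA j).toLinearMap ∘ₗ (torusCalculus hA).d

theorem torusDeriv_apply (j : Fin 2) (a : A) : torusDeriv hA j a = torusPartial hA j a :=
  torusCoord_d hA j a

theorem torusDeriv_mul (j : Fin 2) (a b : A) : torusDeriv hA j (a * b) =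
    torusDeriv hA j a * b + a * torusDeriv hA j b := by
  change torusCoord hA j ((torusCalculus hA).d (a * b)) = _
  rw [d_mul, BimodHom.apply_add, BimodHom.apply_lsmul, BimodHom.apply_rsmul]
  rfl

theorem formMap_tmul_eq (a b : A) : (torusCalculus hA).formMap (a ⊗ₜ b) =
    (torusCalculus hA).π a * (torusCalculus hA).δ b := by simp [formMap]

theorem formMap₂_tmul_eq (a b : A) : (torusCalculus hA).formMap₂ (a ⊗ₜ b) =
    (torusCalculus hA).δ a * (torusCalculus hA).δ b := by simp [formMap₂]

theorem gamma_π_mul_gamma_π (p j : Fin 2) (a b : A) :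
    spinOp (gammaMatrix p) * (torusCalculus hA).π a *
      (spinOp (gammaMatrix j) * (torusCalculus hA).π b) =
      spinOp (gammaMatrix p) * spinOp (gammaMatrix j) * (torusCalculus hA).π (a * b) := by
  rw [map_mul, mul_assoc, ← mul_assoc _ _ ((torusCalculus hA).π b), gamma_mul_π]
  simp only [mul_assoc]

theorem clifford_sum {R : Type*} [Ring R] {g h : R} (hg : g * g = 1) (hh : h * h = 1)
    (hgh : h * g = -(g * h)) (a b c d : R) :
    g * g * a + g * h * b + (h * g * c + h * h * d) = a + d + g * h * (b - c) := by
  rw [hg, hh, hgh, one_mul, one_mul, neg_mul, mul_sub]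
  abel

theorem gamma_mul_gamma_sum (x : Fin 2 → Fin 2 → A) :
    ∑ p, ∑ j, spinOp (gammaMatrix p) * spinOp (gammaMatrix j) * (torusCalculus hA).π (x p j) =
      (torusCalculus hA).π (x 0 0 + x 1 1) + spinOp (gammaMatrix 0) * spinOp (gammaMatrix 1) *
        (torusCalculus hA).π (x 0 1 - x 1 0) := by
  rw [map_add, map_sub, Fin.sum_univ_two, Fin.sum_univ_two, Fin.sum_univ_two]
  exact clifford_sum (gamma_sq 0) (gamma_sq 1) gamma_anticomm _ _ _ _

theorem diagDiff_gamma_sum (x : Fin 2 → Fin 2 → A) :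
    diagDiff (∑ p, ∑ j, spinOp (gammaMatrix p) * spinOp (gammaMatrix j) *
      (torusCalculus hA).π (x p j)) = (x 0 1 - x 1 0 : A) := by
  rw [gamma_mul_gamma_sum, map_add, torusCalculus_π, torusCalculus_π, diagDiff_diagOp,
    diagDiff_gamma, zero_add]

/-- `a ⊗ b ↦ a ∂_j b`. -/
def mulDeriv (j : Fin 2) : A ⊗[ℂ] A →ₗ[ℂ] A :=
  TensorProduct.lift ((LinearMap.mul ℂ A).compl₂ (torusDeriv hA j))

/-- `a ⊗ b ↦ ∂_p a ∂_j b`. -/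
def derivMulDeriv (p j : Fin 2) : A ⊗[ℂ] A →ₗ[ℂ] A :=
  TensorProduct.lift ((LinearMap.mul ℂ A).compl₁₂ (torusDeriv hA p) (torusDeriv hA j))

theorem formMap_eq (t : A ⊗[ℂ] A) : (torusCalculus hA).formMap t =
    ∑ j, spinOp (gammaMatrix j) * (torusCalculus hA).π (mulDeriv hA j t) := by
  induction t using TensorProduct.induction_on with
  | zero => simp
  | tmul a b =>
    rw [formMap_tmul_eq, torusCalculus_δ_eq_sum, Finset.mul_sum]
    refine Finset.sum_congr rfl fun j _ => ?_
    have h : mulDeriv hA j (a ⊗ₜ b) = a * torusPartial hA j b := by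
      simp [mulDeriv, torusDeriv_apply]
    rw [h, map_mul, ← mul_assoc, gamma_mul_π, mul_assoc]
  | add s t hs ht => simp only [map_add, hs, ht, mul_add, Finset.sum_add_distrib]

theorem formMap₂_eq (t : A ⊗[ℂ] A) : (torusCalculus hA).formMap₂ t =
    ∑ p, ∑ j, spinOp (gammaMatrix p) * spinOp (gammaMatrix j) *
      (torusCalculus hA).π (derivMulDeriv hA p j t) := by
  induction t using TensorProduct.induction_on with
  | zero => simp
  | tmul a b =>
    rw [formMap₂_tmul_eq, torusCalculus_δ_eq_sum, torusCalculus_δ_eq_sum, Finset.sum_mul_sum]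
    refine Finset.sum_congr rfl fun p _ => Finset.sum_congr rfl fun j _ => ?_
    have h : derivMulDeriv hA p j (a ⊗ₜ b) = torusPartial hA p a * torusPartial hA j b := by
      simp [derivMulDeriv, torusDeriv_apply]
    rw [h, gamma_π_mul_gamma_π]
  | add s t hs ht => simp only [map_add, hs, ht, mul_add, Finset.sum_add_distrib]

/-- If $\sum a_i\,\partial_j b_i=0$ for each $j$, applying $\partial_p$ gives $\sum\partial_p
a_i\,\partial_j b_i=-\sum a_i\,\partial_p\partial_j b_i$, which is symmetric in $p,j$. -/
theorem derivMulDeriv_comm (p j : Fin 2) {t : A ⊗[ℂ] A} (ht : (torusCalculus hA).formMap t = 0) :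
    derivMulDeriv hA p j t = derivMulDeriv hA j p t := by
  have h0 : ∀ j, mulDeriv hA j t = 0 := fun j => Subtype.ext (by
    rw [← gammaCoeff_sum hA (fun j => mulDeriv hA j t), ← formMap_eq, ht, map_zero]; rfl)
  -- Both sides are the map $a\otimes b\mapsto a\,\partial_p\partial_j b$.
  have h1 : torusDeriv hA p ∘ₗ mulDeriv hA j - derivMulDeriv hA p j =
      torusDeriv hA j ∘ₗ mulDeriv hA p - derivMulDeriv hA j p :=
    TensorProduct.ext' fun a b => by
      simp [mulDeriv, derivMulDeriv, torusDeriv_mul]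
      simp only [torusDeriv_apply, torusPartial_comm hA p j]
  have h2 := LinearMap.congr_fun h1 t
  simpa [h0] using h2

/-- The $\gamma_1\gamma_2$ coefficient of a generator is an antisymmetrized product of derivatives,
which vanishes by `derivMulDeriv_comm`. -/
theorem diagDiff_junk {T : TorusH →L[ℂ] TorusH} (hT : T ∈ (torusCalculus hA).junk) :
    diagDiff T = 0 := by
  induction hT using Submodule.span_induction with
  | mem z hz =>
    obtain ⟨t, c, ht, rfl⟩ := hz
    rw [torusCalculus_π, diagDiff_mul_diagOp, formMap₂_eq, diagDiff_gamma_sum,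
      derivMulDeriv_comm hA 0 1 ht, sub_self, ZeroMemClass.coe_zero, zero_mul]
  | zero => exact map_zero _
  | add x y _ _ hx hy => rw [map_add, hx, hy, add_zero]
  | smul c x _ hx => rw [map_smul, hx, smul_zero]

/-- $U$ and $V$ are unitary eigenvectors of the derivations, each annihilated by the other
derivation, so each isolates a single $\gamma_j$. -/
theorem exists_eigen (j : Fin 2) : ∃ u v : A, v * u = 1 ∧ u * v = 1 ∧
    (torusCalculus hA).δ u =
      Complex.I • (spinOp (gammaMatrix j) * (torusCalculus hA).π u) := by
  have hz : ∀ (i : Fin 2) (x : A), spinOp (gammaMatrix i) * diagOp ((0 : ℂ) • x : A) = 0 :=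
    fun i x => by rw [zero_smul]; exact mul_zero (spinOp (gammaMatrix i))
  fin_cases j
  · refine ⟨elemU hA, star (elemU hA), Subtype.ext (star_wshift_mul _ _),
      Subtype.ext (wshift_mul_star _ _), ?_⟩
    rw [torusCalculus_δ, torusPartial_elemU, torusPartial_elemU]
    simp only [torusWeight, Matrix.cons_val_zero, Matrix.cons_val_one, Int.cast_one, Int.cast_zero,
      mul_one, mul_zero, hz, add_zero]
    exact mul_smul_comm Complex.I (spinOp (gammaMatrix 0)) (diagOp (elemU hA))
  · refine ⟨elemV hA, star (elemV hA), Subtype.ext (star_wshift_mul _ _),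
      Subtype.ext (wshift_mul_star _ _), ?_⟩
    rw [torusCalculus_δ, torusPartial_elemV, torusPartial_elemV]
    simp only [torusWeight, Matrix.cons_val_zero, Matrix.cons_val_one, Int.cast_one, Int.cast_zero,
      mul_one, mul_zero, hz, zero_add]
    exact mul_smul_comm Complex.I (spinOp (gammaMatrix 1)) (diagOp (elemV hA))

end Torus

/-! ### Consequences of an invertible element $u$ with $\delta(u)=\sqrt{-1}\,\gamma u$. -/

section Eigen

variable {A B : Type*} [Ring A] [Algebra ℂ A] [Ring B] [Algebra ℂ B] {C : Calculus A B} {γ : B}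
  {u v : A}

/-- Differentiate $vu=1$ and multiply by $v$ on the right. -/
theorem Calculus.δ_inverse (hγ : ∀ a, C.π a * γ = γ * C.π a) (hvu : v * u = 1) (huv : u * v = 1)
    (hu : C.δ u = Complex.I • (γ * C.π u)) : C.δ v = -(Complex.I • (γ * C.π v)) := by
  have h1 : C.δ (v * u) = 0 := by
    rw [hvu]; exact congrArg OneForm.val (d_one (C := C))
  rw [C.leibniz, hu, mul_smul_comm, ← mul_assoc, hγ, mul_assoc, ← map_mul, hvu, map_one,
    mul_one] at h1
  have h2 := congrArg (· * C.π v) h1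
  simp only [add_mul, mul_assoc, ← map_mul, huv, map_one, mul_one, smul_mul_assoc, zero_mul] at h2
  exact eq_neg_of_add_eq_zero_left h2

theorem Calculus.mul_conj (hγ : ∀ a, C.π a * γ = γ * C.π a) (a b : A) :
    γ * C.π a * (γ * C.π b) = γ * γ * C.π (a * b) := by
  rw [map_mul, mul_assoc, ← mul_assoc (C.π a), hγ]
  simp only [mul_assoc]

/-- The inverse has the opposite eigenvalue. Hence $v\,\delta(u)+u\,\delta(v)=0$ while
$\delta(v)\delta(u)+\delta(u)\delta(v)=2\gamma^2=2$: a nonzero scalar is junk, and with it all of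
$\pi(A)$. -/
theorem Calculus.π_mem_junk_of_eigen (hγ : ∀ a, C.π a * γ = γ * C.π a) (hsq : γ * γ = 1)
    (hvu : v * u = 1) (huv : u * v = 1) (hu : C.δ u = Complex.I • (γ * C.π u)) (a : A) :
    C.π a ∈ C.junk := by
  have hv := C.δ_inverse hγ hvu huv hu
  have e : ∀ x y : A, C.formMap (x ⊗ₜ y) = C.π x * C.δ y := fun x y => by simp [formMap]
  have e₂ : ∀ x y : A, C.formMap₂ (x ⊗ₜ y) = C.δ x * C.δ y := fun x y => by simp [formMap₂]
  -- The right factor $\frac12a$ compensates the scalar 2.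
  refine Submodule.subset_span ⟨v ⊗ₜ u + u ⊗ₜ v, (1 / 2 : ℂ) • a, ?_, ?_⟩
  · rw [map_add, e, e, hu, hv, mul_neg, mul_smul_comm, mul_smul_comm, ← mul_assoc, ← mul_assoc,
      hγ, hγ, mul_assoc, mul_assoc, ← map_mul, ← map_mul, hvu, huv, add_neg_cancel]
  · rw [map_add, e₂, e₂, hu, hv, neg_mul, mul_neg, smul_mul_smul_comm, smul_mul_smul_comm,
      C.mul_conj hγ, C.mul_conj hγ, hsq, hvu, huv, map_one, map_smul, mul_one, Complex.I_mul_I,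
      mul_smul_comm, ← neg_smul, neg_neg, one_smul, add_mul, one_mul]
    module

/-- Writes $\gamma a$ in the form $x\,\delta(u)$, on which the differential of one-forms can be
evaluated. -/
theorem Calculus.rsmul_eigen (hγ : ∀ a, C.π a * γ = γ * C.π a) (hvu : v * u = 1)
    (hu : C.δ u = Complex.I • (γ * C.π u)) (a : A) :
    C.π (a * (-Complex.I • v)) * C.δ u = γ * C.π a := by
  rw [hu, mul_smul_comm, ← mul_assoc, hγ, mul_assoc, ← map_mul, ← mul_smul_comm,
    ← map_smul, mul_assoc, smul_mul_assoc, hvu, mul_smul_comm, smul_smul, mul_neg,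
    Complex.I_mul_I, neg_neg, one_smul, mul_one]

/-- The resulting representative of $d(\gamma a)$ is $\delta(a)\gamma$ up to an element of $\pi(A)$,
which is junk on the torus. -/
theorem Calculus.δ_eigen_mul (hγ : ∀ a, C.π a * γ = γ * C.π a) (hsq : γ * γ = 1)
    (hvu : v * u = 1) (huv : u * v = 1) (hu : C.δ u = Complex.I • (γ * C.π u)) (a : A) :
    C.δ (a * (-Complex.I • v)) * C.δ u = C.δ a * γ + C.π (-Complex.I • a) := by
  have h1 : C.π (-Complex.I • v) * C.δ u = γ := by
    simpa using C.rsmul_eigen hγ hvu hu 1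
  have h2 : C.δ (-Complex.I • v) * C.δ u = C.π (-Complex.I • 1) := by
    rw [map_smul, C.δ_inverse hγ hvu huv hu, hu, smul_neg, smul_smul, neg_mul,
      smul_mul_smul_comm, C.mul_conj hγ, hsq, hvu, map_one, map_smul, map_one, mul_one,
      neg_mul, Complex.I_mul_I]
    module
  rw [C.leibniz, add_mul, mul_assoc, h1, mul_assoc, h2, ← map_mul, mul_smul_comm, mul_one]

/-- Moving $\gamma$ past $\delta(a)$ changes the sign modulo $\pi(A)$, since only the component
along $\gamma$ itself survives in the anticommutator. -/
theorem Calculus.anticommutator_sum {g h : B} (hg : ∀ a, C.π a * g = g * C.π a)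
    (hsq : g * g = 1) (hgh : h * g = -(g * h)) (x y : A) :
    (g * C.π x + h * C.π y) * g + g * (g * C.π x + h * C.π y) = C.π ((2 : ℂ) • x) := by
  have e : ∀ x, g * (g * C.π x) = C.π x := fun x => by rw [← mul_assoc, hsq, one_mul]
  rw [add_mul, mul_assoc, mul_assoc, hg, hg, mul_add, e, ← mul_assoc, hgh, ← mul_assoc g h,
    neg_mul, map_smul]
  module

end Eigen

/-! ### Two-forms of the torus and construction of the frame. -/

section Torus

variable {θ : ℝ} {A : StarSubalgebra ℂ (TorusL2 →L[ℂ] TorusL2)} (hA : IsSmoothTorusAlgebra θ A)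

theorem π_mem_junk (a : A) : (torusCalculus hA).π a ∈ (torusCalculus hA).junk := by
  obtain ⟨u, v, hvu, huv, hu⟩ := exists_eigen hA 0
  exact (torusCalculus hA).π_mem_junk_of_eigen (gamma_mul_π hA 0) (gamma_sq 0) hvu huv hu a

theorem twoFormMk_eq_zero_iff {T : TorusH →L[ℂ] TorusH}
    (hT : T ∈ (torusCalculus hA).preTwoForms) :
    (torusCalculus hA).twoFormMk ⟨T, hT⟩ = 0 ↔ T ∈ (torusCalculus hA).junk :=
  Submodule.Quotient.mk_eq_zero _

theorem m_tmul (ω η : (torusCalculus hA).OneForm) : (torusCalculus hA).m (tmul A ω η) =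
    (torusCalculus hA).twoFormMk
      ⟨ω.val * η.val, (torusCalculus hA).mul_mem_preTwoForms ω.val_mem η.val_mem⟩ := by
  rw [m, lift_tmul]; rfl

/-- The Clifford relations turn the product into
$\pi(a_{00}+a_{11})+\gamma_1\gamma_2\,\pi(a_{01}-a_{10})$. The first term is always junk, and the
second is detected by `diagDiff`. -/
theorem m_sum_torusForm₂_eq_zero (a : Fin 2 → Fin 2 → A) :
    (torusCalculus hA).m (∑ p, ∑ q, tmul A (torusForm hA p) (torusForm hA q) <• a p q) = 0 ↔
      a 0 1 = a 1 0 := by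
  have hmem : ∀ p q, spinOp (gammaMatrix p) * spinOp (gammaMatrix q) *
      (torusCalculus hA).π (a p q) ∈ (torusCalculus hA).preTwoForms := fun p q => by
    rw [mul_assoc]
    exact (torusCalculus hA).mul_mem_preTwoForms (spinOp_gamma_mem hA p)
      (mul_π_mem _ (spinOp_gamma_mem hA q))
  have h1 : ∀ p q, (torusCalculus hA).m (tmul A (torusForm hA p) (torusForm hA q) <• a p q) =
      (torusCalculus hA).twoFormMk ⟨_, hmem p q⟩ := fun p q => by
    rw [ract_tmul, m_tmul]
    exact congrArg _ (Subtype.ext (mul_assoc _ _ _).symm)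
  have hs : ∑ p, ∑ q, spinOp (gammaMatrix p) * spinOp (gammaMatrix q) *
      (torusCalculus hA).π (a p q) ∈ (torusCalculus hA).preTwoForms :=
    Submodule.sum_mem _ fun p _ => Submodule.sum_mem _ fun q _ => hmem p q
  have h2 : (torusCalculus hA).m
      (∑ p, ∑ q, tmul A (torusForm hA p) (torusForm hA q) <• a p q) =
      (torusCalculus hA).twoFormMk ⟨_, hs⟩ := by
    simp only [map_sum, h1]
    simp only [← map_sum]
    refine congrArg _ (Subtype.ext ?_)
    simp only [Fin.sum_univ_two]
    rfl
  rw [h2, twoFormMk_eq_zero_iff]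
  refine ⟨fun h => ?_, fun h => ?_⟩
  · have h' := diagDiff_junk hA h
    rw [diagDiff_gamma_sum] at h'
    exact sub_eq_zero.1 (Subtype.ext h')
  · rw [gamma_mul_gamma_sum, h, sub_self, map_zero, mul_zero, add_zero]
    exact π_mem_junk hA _

/-- With $e_ja=x\,du$, the sum of $d(e_ja)$ and $m(e_j\otimes da)$ is represented by the
anticommutator of $\delta(a)$ and $\gamma_j$ plus an element of $\pi(A)$. Both are in $\pi(A)$,
hence junk. -/
theorem d₁_torusForm_rsmul (j : Fin 2) (a : A) :
    (torusCalculus hA).d₁ (torusForm hA j <• a) =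
      -(torusCalculus hA).m (tmul A (torusForm hA j) ((torusCalculus hA).d a)) := by
  obtain ⟨u, v, hvu, huv, hu⟩ := exists_eigen hA j
  have e : torusForm hA j <• a = (a * (-Complex.I • v)) • (torusCalculus hA).d u :=
    OneForm.ext ((torusCalculus hA).rsmul_eigen (gamma_mul_π hA j) hvu hu a).symm
  rw [e, d₁_smul_d_eq_m, eq_neg_iff_add_eq_zero, m_tmul, m_tmul, ← map_add]
  refine (twoFormMk_eq_zero_iff hA _).2 ?_
  change (torusCalculus hA).δ (a * (-Complex.I • v)) * (torusCalculus hA).δ u +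
    spinOp (gammaMatrix j) * (torusCalculus hA).δ a ∈ _
  have e2 : (torusCalculus hA).δ a * spinOp (gammaMatrix j) +
      spinOp (gammaMatrix j) * (torusCalculus hA).δ a =
      (torusCalculus hA).π ((2 : ℂ) • torusPartial hA j a) := by
    rw [torusCalculus_δ_eq_sum, Fin.sum_univ_two]
    obtain rfl | rfl : j = 0 ∨ j = 1 := by omega
    · exact anticommutator_sum (gamma_mul_π hA 0) (gamma_sq 0)
        gamma_anticomm _ _
    -- `anticommutator_sum` expects the distinguished generator first, so the two Clifford
    -- generators exchange roles.
    · rw [add_comm (spinOp (gammaMatrix 0) * _)]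
      exact anticommutator_sum (gamma_mul_π hA 1) (gamma_sq 1)
        (neg_eq_iff_eq_neg.1 gamma_anticomm.symm) _ _
  rw [(torusCalculus hA).δ_eigen_mul (gamma_mul_π hA j) (gamma_sq j) hvu huv hu a,
    add_right_comm, e2, ← map_add]
  exact π_mem_junk hA _

/-- The frame `e_1, e_2` of the noncommutative torus. -/
def torusFrame : Frame (torusCalculus hA) where
  e := torusForm hA
  central j a := OneForm.ext (gamma_mul_π hA j a)
  coord := torusCoord hA
  coord_e j l := by
    have h : (torusForm hA l).val = ∑ p, spinOp (gammaMatrix p) *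
        (torusCalculus hA).π (if l = p then 1 else 0) := by
      rw [Finset.sum_eq_single l (fun p _ hp => by rw [if_neg (Ne.symm hp), map_zero, mul_zero])
        (by simp), if_pos rfl, map_one, mul_one]
      rfl
    exact torusCoord_of_val_eq hA h j
  expand ω := by
    obtain ⟨x, hx⟩ := exists_eq_gamma_sum hA ω.val_mem
    simp only [torusCoord_of_val_eq hA hx]
    refine OneForm.ext ?_
    rw [hx, Fin.sum_univ_two, Fin.sum_univ_two]
    rfl
  m_eq_zero := m_sum_torusForm₂_eq_zero hA
  d₁_rsmul := d₁_torusForm_rsmul hA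
  coord_d_comm i j a := by simp only [torusCoord_d]; exact torusPartial_comm hA i j a

theorem torusFrame_deriv (j : Fin 2) (a : A) : (torusFrame hA).deriv j a = torusPartial hA j a :=
  torusCoord_d hA j a

end Torus

end NCG

end

/-! ### The theorem for the noncommutative torus. -/

open NCG
set_option maxHeartbeats 1000000 in
theorem mainTheorem4 (θ : ℝ) (A : StarSubalgebra ℂ (TorusL2 →L[ℂ] TorusL2))
    (hA : IsSmoothTorusAlgebra θ A) (k : (A)ˣ) :
    -- the canonical flip of `E ⊗_A E`
    ∃ σ : BimodHom A (torusCalculus hA).E2 (torusCalculus hA).E2,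
      Calculus.IsFlip σ ∧ (∀ σ', Calculus.IsFlip σ' → σ' = σ) ∧
    -- the canonical metric `g₀` and its conformal perturbation `k g₀`
    ∃ g₀ : (torusCalculus hA).E2 →ₗ[Aᵐᵒᵖ] A,
      IsTorusMetric hA g₀ ∧ (∀ g', IsTorusMetric hA g' → g' = g₀) ∧
      IsPseudoRiemannian σ g₀ ∧ IsPseudoRiemannian σ ((k : A) • g₀) ∧
    -- the Levi-Civita connection of `k g₀`
    ∃ D : (torusCalculus hA).Connection,
      D.IsLeviCivita σ ((k : A) • g₀) ∧
      (∀ D' : (torusCalculus hA).Connection, D'.IsLeviCivita σ ((k : A) • g₀) → D' = D) ∧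
    -- its Ricci curvature
    ∃ Ric : (torusCalculus hA).E2,
      D.IsRicci σ Ric ∧ (∀ Ric', D.IsRicci σ Ric' → Ric' = Ric) ∧
    -- the coefficients `r j l = Ric(e_j, e_l)` in the basis `e_j ⊗ e_l`
      (∀ r : Fin 2 → Fin 2 → A,
        Ric = ∑ j, ∑ l, torusForm₂ hA j l <• r j l ↔
          (r 0 0 = -(1 / 2 : ℂ) • ((↑k⁻¹ : A) *
              (torusPartial hA 0 (torusPartial hA 0 k) + torusPartial hA 1 (torusPartial hA 1 k)) +
              torusPartial hA 0 ↑k⁻¹ * torusPartial hA 0 k +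
              torusPartial hA 1 ↑k⁻¹ * torusPartial hA 1 k) ∧
            r 1 1 = r 0 0 ∧
            r 0 1 = (1 / 2 : ℂ) • (torusPartial hA 0 ↑k⁻¹ * torusPartial hA 1 k -
              torusPartial hA 1 ↑k⁻¹ * torusPartial hA 0 k) ∧
            r 1 0 = -r 0 1)) ∧
    -- the scalar curvature
      scalarCurvature ((k : A) • g₀) Ric =
        -(torusPartial hA 0 (torusPartial hA 0 k) + torusPartial hA 1 (torusPartial hA 1 k)) -
          (k : A) * (torusPartial hA 1 ↑k⁻¹ * torusPartial hA 1 k +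
            torusPartial hA 0 ↑k⁻¹ * torusPartial hA 0 k) := by
  have hm : IsTorusMetric hA (torusFrame hA).metric :=
    ⟨(torusFrame hA).metric_lsmul, (torusFrame hA).metric_b⟩
  obtain ⟨Ric, hRic⟩ := (torusFrame hA).exists_isRicci ((torusFrame hA).leviCivita k)
  have hr := (torusFrame hA).ricci_eq_iff hRic
  have hs := (torusFrame hA).scalarCurvature_eq hRic
  simp only [torusFrame_deriv] at hr hs
  refine ⟨(torusFrame hA).flip, (torusFrame hA).isFlip_flip,
    fun σ hσ => (torusFrame hA).flip_unique hσ, ?_⟩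
  refine ⟨(torusFrame hA).metric, hm, ?_, ?_, ?_, ?_⟩
  · exact fun g' hg' => (torusFrame hA).right_ext fun p q =>
      (hg'.apply p q).trans (hm.apply p q).symm
  -- The canonical metric is the conformal metric with $k=1$.
  · simpa using (torusFrame hA).isPseudoRiemannian_smul_metric 1
  · exact (torusFrame hA).isPseudoRiemannian_smul_metric k
  refine ⟨(torusFrame hA).leviCivita k, ?_, ?_, ?_⟩
  · exact (torusFrame hA).isLeviCivita_leviCivita k
  · exact fun D' hD' => (torusFrame hA).eq_leviCivita hD'
  refine ⟨Ric, hRic, ?_, ?_, ?_⟩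
  · exact fun Ric' h' => ((torusFrame hA).ricci_eq h').trans ((torusFrame hA).ricci_eq hRic).symm
  · exact hr
  · exact hs
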